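/- Let $f(x)=a+bx+\int_0^\infty(1-e^{-xs})\,\overline\nu(ds)$, $a,b\ge 0$, $\int_0^\infty (s\wedge1)\,\overline\nu(ds)<\infty$, be a Bernstein function with tail $\nu(s)=a+\overline\nu(s,\infty)$, and assume $\overline\nu(0,\infty)=\infty$ and that $\nu$ is (locally) absolutely continuous on $(0,\infty)$. For locally absolutely continuous $u$ on $[0,\infty)$ put $$\mathcal D^f_t u(t)=b\,u'(t)+\int_0^t \frac{\partial}{\partial t}u(t-s)\,\nu(s)\,ds .$$ Let $H^f$ be a subordinator (killed at rate $a$ if $a>0$) with $\mathsf E e^{-rH^f(t)}=e^{-tf(r)}$, $r>0$, let $Y^f(t)=\inf\{s\ge0:H^f(s)>t\}$ be its inverse, and $\tilde\ell_f(t,\mu)=\mathsf E e^{-\mu Y^f(t)}$. Let $k\ge1$, $\lambda_1,\dots,\lambda_k>0$, $\Lambda=\sum_{j=1}^k\lambda_j$, $\Omega(k,n)=\{(x_1,\dots,x_k)\in\mathbb N_0^k:\sum_{j=1}^k jx_j=n\}$, $z_k=\sum_{j=1}^k x_j$. Let $M$ be the generalized counting process (GCP) with rates $\lambda_1,\dots,\lambda_k$,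 that is, the nondecreasing process with $M(0)=0$ and stationary independent increments such that $\mathsf P\{M(t)=n\}=\sum_{\Omega(k,n)}\prod_{j=1}^k\frac{(\lambda_jt)^{x_j}}{x_j!}\,e^{-\Lambda t}$. Let $\lambda,\alpha,\beta>0$, let $N$ be a Poisson process with intensity $\lambda$, let $G$ be a Gamma process for which $G(t)$ has the Gamma distribution with shape $\alpha t$ and rate $\beta$, and let $G_N(t)=G(N(t))$ be the compound Poisson–Gamma subordinator, whose Laplace exponent is $\psi_{GN}(u)=\lambda\beta^\alpha\left(\beta^{-\alpha}-(\beta+u)^{-\alpha}\right)$. Assume that $M,N,G,H^f$ are mutually independent, and put $M^{GN,f}(t)=M(G_N(Y^f(t)))$, $\tilde p_n^{GN,f}(t)=\mathsf P\{M^{GN,f}(t)=n\}$. Then for every $t\ge0$ the function $L\mapsto\tilde\ell_f(t,\psi_{GN}(L))$ is $C^\infty$ near $L=\Lambda$, and for every $n\ge0$ $$\tilde p_n^{GN,f}(t)=\sum_{\Omega(k,n)}\prod_{j=1}^k\frac{\lambda_j^{x_j}}{x_j!}\,(-\partial_\Lambda)^{z_k}\,\tilde\ell_f(t,\psi_{GN}(\Lambda)),$$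 where $\partial_\Lambda$ is the derivative in the single variable $\Lambda$. Moreover, for every $n\ge0$, $\tilde p_n^{GN,f}$ is absolutely continuous on every $[0,T]$, and for every $t>0$ the derivative $\mathcal D^f_t\tilde p_n^{GN,f}(t)$ exists (the integral converges absolutely and, if $b>0$, the function is differentiable at $t$) and $$\mathcal D^f_t\tilde p_n^{GN,f}(t)=\left(\frac{\lambda\beta^\alpha}{(\Lambda+\beta)^\alpha}-\lambda\right)\tilde p_n^{GN,f}(t)+\frac{\lambda\beta^\alpha}{(\Lambda+\beta)^\alpha\,\Gamma(\alpha)}\sum_{m=1}^n\sum_{\Omega(k,m)}\frac{\Gamma(z_k+\alpha)}{(\Lambda+\beta)^{z_k}}\prod_{j=1}^k\frac{\lambda_j^{x_j}}{x_j!}\;\tilde p_{n-m}^{GN,f}(t).$$ In the exponential case $\alpha=1$, where $G_N=E_N$ is the compound Poisson–exponential subordinator and $M^{E,f}(t)=M(E_N(Y^f(t)))$, the probabilities $\tilde p_n^{E,f}(t)=\mathsf P\{M^{E,f}(t)=n\}$ are given by the same formula with $\psi_E(u)=\frac{\lambda u}{\beta+u}$ in place of $\psi_{GN}$, with the same regularity,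 and for every $n\ge0$, $t>0$ $$\mathcal D^f_t\tilde p_n^{E,f}(t)=-\lambda\frac{\Lambda}{\Lambda+\beta}\,\tilde p_n^{E,f}(t)+\frac{\lambda\beta}{\Lambda+\beta}\sum_{m=1}^n\sum_{\Omega(k,m)}\frac{\Gamma(z_k+1)}{(\Lambda+\beta)^{z_k}}\prod_{j=1}^k\frac{\lambda_j^{x_j}}{x_j!}\;\tilde p_{n-m}^{E,f}(t).$$ -/

import Mathlib

open MeasureTheory ProbabilityTheory Set Filter Topology
open scoped NNReal ENNReal Nat

noncomputable section

namespace GenCounting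

/-! ### Bernstein functions and convolution-type derivatives -/

/-- The data `(a, b, ν̄)` of a Bernstein function: `a, b ≥ 0` and a measure `ν̄` on `(0, ∞)` (only the
restriction of `levy` to `(0, ∞)` is ever used) with `∫ (s ∧ 1) ν̄(ds) < ∞`. -/
structure BernsteinData where
  a : ℝ
  b : ℝ
  levy : Measure ℝ
  a_nonneg : 0 ≤ a
  b_nonneg : 0 ≤ b
  lintegral_min_lt_top : ∫⁻ s in Ioi (0 : ℝ), ENNReal.ofReal (min s 1) ∂levy < ∞

/-- The Bernstein function `f(x) = a + b x + ∫_{(0,∞)} (1 - e^{-xs}) ν̄(ds)`. -/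
def BernsteinData.fn (D : BernsteinData) (x : ℝ) : ℝ :=
  D.a + D.b * x + ∫ s in Ioi (0 : ℝ), (1 - Real.exp (-(x * s))) ∂D.levy

/-- The tail `ν(s) = a + ν̄(s, ∞)`, for `s > 0`. -/
def BernsteinData.tail (D : BernsteinData) (s : ℝ) : ℝ :=
  D.a + D.levy.real (Ioi s)

/-- `ν̄(0, ∞) = ∞` and the tail is (locally) absolutely continuous on `(0, ∞)`. -/
def BernsteinData.ConditionI (D : BernsteinData) : Prop :=
  D.levy (Ioi 0) = ∞ ∧
    ∀ c d : ℝ, 0 < c → c ≤ d → AbsolutelyContinuousOnInterval D.tail c d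

/-- The generalized Caputo–Djrbashian derivative
`𝒟^f_t u(t) = b u'(t) + ∫_0^t (∂/∂t) u(t - s) ν(s) ds`. -/
def caputoDeriv (D : BernsteinData) (u : ℝ → ℝ) (t : ℝ) : ℝ :=
  D.b * deriv u t + ∫ s in (0 : ℝ)..t, deriv u (t - s) * D.tail s

/-- `𝒟^f_t u(t)` exists at `t > 0` and equals `v`: `u` is absolutely continuous on every `[0, T]`
(the space on which `𝒟^f_t` is defined), the derivative `u'(t)` exists if it occurs (`b ≠ 0`), the
convolution integral converges absolutely, and the value is `v`. -/
def HasCaputoDeriv (D : BernsteinData) (u : ℝ → ℝ) (v : ℝ) (t : ℝ) : Prop :=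
  (∀ T : ℝ, 0 < T → AbsolutelyContinuousOnInterval u 0 T) ∧
  (D.b ≠ 0 → DifferentiableAt ℝ u t) ∧
  IntervalIntegrable (fun s => deriv u (t - s) * D.tail s) volume 0 t ∧
  caputoDeriv D u t = v

/-! ### Processes -/

section Processes

variable {Ω : Type*} [MeasurableSpace Ω]

/-- A process with nondecreasing right-continuous paths, started at `0`, with independent
increments. -/
structure IsIncreasingAdditive {E : Type*} [MeasurableSpace E] [TopologicalSpace E] [Preorder E]
    [Zero E] [Sub E] (X : ℝ≥0 → Ω → E) (P : Measure Ω) : Prop where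
  measurable : ∀ t, Measurable (X t)
  zero : ∀ ω, X 0 ω = 0
  mono : ∀ ω, Monotone fun t => X t ω
  right_cont : ∀ ω t, ContinuousWithinAt (fun s => X s ω) (Ici t) t
  indep_incr : HasIndepIncrements X P

/-- The Poisson process with intensity `lam`. -/
structure IsPoissonProcess (lam : ℝ) (N : ℝ≥0 → Ω → ℕ) (P : Measure Ω) : Prop extends
    IsIncreasingAdditive N P where
  law_incr : ∀ s h : ℝ≥0,
    P.map (fun ω => N (s + h) ω - N s ω) = poissonMeasure (lam.toNNReal * h)

/-- The Gamma process: increments over an interval of length `h` are `Gamma(α h)` distributed with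
rate parameter `β`. -/
structure IsGammaProcess (α β : ℝ) (G : ℝ≥0 → Ω → ℝ≥0) (P : Measure Ω) : Prop extends
    IsIncreasingAdditive G P where
  law_incr : ∀ s h : ℝ≥0, 0 < h →
    P.map (fun ω => ((G (s + h) ω - G s ω : ℝ≥0) : ℝ)) = gammaMeasure (α * h) β

/-- `Ω(k, n) = {(x₁, …, x_k) ∈ ℕ^k : ∑ j x_j = n}`; the index `j : Fin k` stands for `j + 1`. -/
def partitions (k n : ℕ) : Finset (Fin k → ℕ) :=
  (Fintype.piFinset fun _ : Fin k => Finset.range (n + 1)).filter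
    fun x => ∑ j : Fin k, ((j : ℕ) + 1) * x j = n

theorem mem_partitions {k n : ℕ} {x : Fin k → ℕ} :
    x ∈ partitions k n ↔ ∑ j : Fin k, ((j : ℕ) + 1) * x j = n := by
  simp only [partitions, Finset.mem_filter, Fintype.mem_piFinset, Finset.mem_range,
    and_iff_right_iff_imp]
  intro h j
  have h1 : ((j : ℕ) + 1) * x j ≤ ∑ i : Fin k, ((i : ℕ) + 1) * x i :=
    Finset.single_le_sum (f := fun i : Fin k => ((i : ℕ) + 1) * x i)
      (fun _ _ => Nat.zero_le _) (Finset.mem_univ j)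
  nlinarith [Nat.zero_le ((j : ℕ) * x j)]

/-- `Λ = ∑ λ_j`. -/
def totalRate {k : ℕ} (rate : Fin k → ℝ) : ℝ := ∑ j, rate j

/-- `p̃_n(t) = ∑_{Ω(k,n)} ∏_j (λ_j t)^{x_j} / x_j! · e^{-Λ t}`. -/
def gcpProb {k : ℕ} (rate : Fin k → ℝ) (n : ℕ) (t : ℝ) : ℝ :=
  ∑ x ∈ partitions k n,
    (∏ j, (rate j * t) ^ x j / (x j)!) * Real.exp (-(totalRate rate * t))

/-- The generalized counting process with jumps of sizes `1, …, k` and rates `λ₁, …, λ_k`. -/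
structure IsGCP {k : ℕ} (rate : Fin k → ℝ) (M : ℝ≥0 → Ω → ℕ) (P : Measure Ω) : Prop extends
    IsIncreasingAdditive M P where
  law_incr : ∀ (s h : ℝ≥0) (n : ℕ),
    P.real {ω | M (s + h) ω - M s ω = n} = gcpProb rate n h

/-- `e^{-r x}` for `x ∈ [0, ∞]` and `r > 0`, with `e^{-r ∞} = 0`. -/
def expNeg (r : ℝ) (x : ℝ≥0∞) : ℝ :=
  if x = ∞ then 0 else Real.exp (-(r * x.toReal))

/-- A subordinator with Laplace exponent `f`. It takes values in `[0, ∞]` so that `a = f(0+) > 0`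
(killing at rate `a`, the state `∞` being absorbing) is allowed; for `a = 0` it is almost surely
finite and this is a nondecreasing Lévy process. Given the past up to time `s` and
`H(s) < ∞`, the increment `H(s+h) - H(s)` has the law of `H(h)`. -/
structure IsSubordinator (f : ℝ → ℝ) (H : ℝ≥0 → Ω → ℝ≥0∞) (P : Measure Ω) : Prop where
  measurable : ∀ t, Measurable (H t)
  zero : ∀ ω, H 0 ω = 0
  mono : ∀ ω, Monotone fun t => H t ω
  right_cont : ∀ ω t, ContinuousWithinAt (fun s => H s ω) (Ici t) t
  indep_stat_incr : ∀ (s h : ℝ≥0) (A : Set Ω) (B : Set ℝ≥0∞),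
    MeasurableSet[⨆ u : Iic s, MeasurableSpace.comap (H u) inferInstance] A → MeasurableSet B →
    P (A ∩ {ω | H s ω < ∞} ∩ {ω | H (s + h) ω - H s ω ∈ B}) =
      P (A ∩ {ω | H s ω < ∞}) * P {ω | H h ω ∈ B}
  laplace : ∀ (t : ℝ≥0) (r : ℝ), 0 < r →
    ∫ ω, expNeg r (H t ω) ∂P = Real.exp (-(t * f r))

/-- The inverse process `Y(t) = inf {s ≥ 0 : H(s) > t}`. -/
def inverseProcess (H : ℝ≥0 → Ω → ℝ≥0∞) (t : ℝ≥0) (ω : Ω) : ℝ≥0 :=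
  sInf {s : ℝ≥0 | (t : ℝ≥0∞) < H s ω}

/-- `ℓ̃(t, μ) = E e^{-μ Y(t)}`, the Laplace transform of the law of `Y(t)`. -/
def laplaceOf (Y : ℝ≥0 → Ω → ℝ≥0) (P : Measure Ω) (t : ℝ≥0) (μ : ℝ) : ℝ :=
  ∫ ω, Real.exp (-(μ * Y t ω)) ∂P

/-- The compound Poisson–Gamma process `G_N(t) = G(N(t))`. -/
def compoundProcess (G : ℝ≥0 → Ω → ℝ≥0) (N : ℝ≥0 → Ω → ℕ) (t : ℝ≥0) (ω : Ω) : ℝ≥0 :=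
  G (N t ω : ℝ≥0) ω

/-- The time-changed process `M(G_N(Y(t)))`, where `Y` is the inverse of `H`. -/
def timeChanged (M : ℝ≥0 → Ω → ℕ) (G : ℝ≥0 → Ω → ℝ≥0) (N : ℝ≥0 → Ω → ℕ) (H : ℝ≥0 → Ω → ℝ≥0∞)
    (t : ℝ≥0) (ω : Ω) : ℕ :=
  M (compoundProcess G N (inverseProcess H t ω) ω) ω

/-- `P(X(t) = n)`, as a function of the real time `t ≥ 0`. -/
def stateProb (X : ℝ≥0 → Ω → ℕ) (P : Measure Ω) (n : ℕ) (t : ℝ) : ℝ :=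
  P.real {ω | X t.toNNReal ω = n}

/-- The σ-algebra generated by a process. -/
abbrev processSigma {E : Type*} [MeasurableSpace E] (X : ℝ≥0 → Ω → E) : MeasurableSpace Ω :=
  ⨆ t, MeasurableSpace.comap (X t) inferInstance

end Processes

/-- `ψ_GN(u) = λ β^α (β^{-α} - (β + u)^{-α})`. -/
def psiGN (lam α β u : ℝ) : ℝ := lam * β ^ α * (β ^ (-α) - (β + u) ^ (-α))

/-- `ψ_E(u) = λ u / (β + u)`. -/
def psiE (lam β u : ℝ) : ℝ := lam * u / (β + u)

/-- `(-∂_Λ)^z g(Λ)`. -/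
def negDerivPow (z : ℕ) (g : ℝ → ℝ) (L : ℝ) : ℝ := (-1) ^ z * iteratedDeriv z g L

/-- `∑_{Ω(k,n)} ∏_j λ_j^{x_j} / x_j! · (-∂_Λ)^{z_k} g(Λ)`, with `z_k = ∑ x_j`. The derivatives act on
`g` as a function of one variable, evaluated at `Λ = ∑ λ_j`. -/
def probFormula {k : ℕ} (rate : Fin k → ℝ) (n : ℕ) (g : ℝ → ℝ) : ℝ :=
  ∑ x ∈ partitions k n,
    (∏ j, rate j ^ x j / (x j)!) * negDerivPow (∑ j, x j) g (totalRate rate)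

end GenCounting

end

/-! The state probabilities come from conditioning. Put `X = G_N(Y(t))`, which is independent of
`M`. For fixed `x`, `P(M(x) = n)` is a combination of terms `x^z e^{-Λx}`, so `P(M(X) = n)` is the
same combination of `E X^z e^{-ΛX} = (-∂_Λ)^z E e^{-ΛX}`. Conditioning on `Y(t)` gives `E e^{-LX} =
ℓ̃(t, ψ_GN(L))`. Since `X ≥ 0`, the moment generating function of `X` is analytic on the negative
half-line, which gives smoothness and differentiation under the expectation
(`integral_gcpProb_eq_probFormula`).

For the equation, only `Y` is kept random: `p_n(t) = E Φ_n(Y(t))` with `Φ_n(s) = P(M(G_N(s)) = n)`.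
These functions are Poisson mixtures, decay exponentially, and form a family closed under
differentiation: `Φ_n' = λ (∑_m c_m Φ_{n-m} - Φ_n)`, where `c_m` is the probability that `M` reaches
`m` in an independent `Gamma(α, β)` time (`hasDerivAt_poissonMix_gammaProb`). It remains to see that
`𝒟^f` of `E Φ(Y(t))` is `E Φ'(Y(t))`. For `q ≥ 0` let `U_q(dy) = ∫ q(s) P(H(s) ∈ dy) ds`. Then `E
Φ(Y(t)) = Φ(0) + U_{Φ'}[0, t]`, extended linearly in `Φ'`, and the claim reduces to `b u(t) + ∫ ν(t
- y) u(y) dy = E q(Y(t))` for a density `u` of `U_q`.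

Both sides of the last identity have the same Laplace transform, so it holds for almost every `t`;
the difficulty is to have it for every `t > 0` (`hasPotentialDensity`). If `b > 0`, the density is
bounded, so the convolution with `ν` is continuous and the identity itself can serve as the
definition of `u`. If `b = 0`, the case `q(s) = e^{-μs}` is treated first: the resolvent equation
between `r` and `r + 1` writes `(1 - e^{-y}) U(dy)` as a convolution, which yields absolute
continuity of `U` and continuity of the convolution with the tail (`resolvent_convM_eq`). A general
`q` is dominated by a multiple of `e^{-μs}`, and lower semicontinuity of both `ν * U_q` and its
complement transfers the pointwise identity (`convM_eq_of_le`). -/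

namespace GenCounting

/-! ### Laplace transforms of measures on the half-line -/

/-- The Laplace transform `∫ e^{-r y} μ(dy)`, as an extended nonnegative real. -/
noncomputable def laplaceT (μ : Measure ℝ) (r : ℝ) : ℝ≥0∞ :=
  ∫⁻ y, ENNReal.ofReal (Real.exp (-(r * y))) ∂μ

theorem measurable_expKernel (r : ℝ) :
    Measurable fun y : ℝ => ENNReal.ofReal (Real.exp (-(r * y))) := by fun_prop

/-- Polynomials are uniformly dense in the continuous functions on `[0, 1]` (Weierstrass), and both
measures live there. -/
theorem ext_of_moments {μ ν : Measure ℝ} [IsFiniteMeasure μ] [IsFiniteMeasure ν]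
    (hμ : ∀ᵐ x ∂μ, x ∈ Icc (0 : ℝ) 1) (hν : ∀ᵐ x ∂ν, x ∈ Icc (0 : ℝ) 1)
    (h : ∀ n : ℕ, ∫ x, x ^ n ∂μ = ∫ x, x ^ n ∂ν) : μ = ν := by
  have intg : ∀ (ρ : Measure ℝ) [IsFiniteMeasure ρ], (∀ᵐ x ∂ρ, x ∈ Icc (0 : ℝ) 1) →
      ∀ n : ℕ, Integrable (fun x : ℝ => x ^ n) ρ := by
    intro ρ _ hρ n
    refine Integrable.of_bound (by fun_prop) 1 ?_
    filter_upwards [hρ] with x hx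
    rw [Real.norm_eq_abs, abs_of_nonneg (pow_nonneg hx.1 n)]
    exact pow_le_one₀ hx.1 hx.2
  have intp : ∀ (ρ : Measure ℝ) [IsFiniteMeasure ρ], (∀ᵐ x ∂ρ, x ∈ Icc (0 : ℝ) 1) →
      ∀ p : Polynomial ℝ, Integrable (fun x : ℝ => p.eval x) ρ := by
    intro ρ _ hρ p
    simp_rw [Polynomial.eval_eq_sum_range]
    exact integrable_finsetSum _ fun i _ => (intg ρ hρ i).const_mul _
  have hp : ∀ p : Polynomial ℝ, ∫ x, p.eval x ∂μ = ∫ x, p.eval x ∂ν := by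
    intro p
    simp_rw [Polynomial.eval_eq_sum_range]
    rw [integral_finsetSum _ fun i _ => (intg μ hμ i).const_mul _,
      integral_finsetSum _ fun i _ => (intg ν hν i).const_mul _]
    simp_rw [integral_const_mul, h]
  apply ext_of_forall_integral_eq_of_IsFiniteMeasure
  intro f
  have key : ∀ ε > 0, |∫ x, f x ∂μ - ∫ x, f x ∂ν| ≤ ε * (μ.real univ + ν.real univ) := by
    intro ε hε
    obtain ⟨p, hpf⟩ := exists_polynomial_near_of_continuousOn 0 1 f f.continuous.continuousOn ε hε
    have est : ∀ (ρ : Measure ℝ) [IsFiniteMeasure ρ], (∀ᵐ x ∂ρ, x ∈ Icc (0 : ℝ) 1) →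
        |∫ x, f x ∂ρ - ∫ x, p.eval x ∂ρ| ≤ ε * ρ.real univ := by
      intro ρ _ hρ
      rw [← integral_sub (f.integrable ρ) (intp ρ hρ p), ← Real.norm_eq_abs]
      refine norm_integral_le_of_norm_le_const ?_
      filter_upwards [hρ] with x hx
      rw [Real.norm_eq_abs, abs_sub_comm]
      exact (hpf x hx).le
    have h1 := est μ hμ
    have h2 := est ν hν
    rw [hp p] at h1
    rw [abs_le] at *
    constructor <;> nlinarith [h1.1, h1.2, h2.1, h2.2]
  by_contra hne
  have hd : 0 < |∫ x, f x ∂μ - ∫ x, f x ∂ν| := abs_pos.2 (sub_ne_zero.2 hne)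
  set d := |∫ x, f x ∂μ - ∫ x, f x ∂ν|
  set m := μ.real univ + ν.real univ
  have hm : 0 ≤ m := by positivity
  -- With this `ε` the bound `ε m` is at most `d / 2`; the `+ 1` covers total mass zero.
  have := key (d / (2 * (m + 1))) (by positivity)
  rw [div_mul_eq_mul_div, le_div_iff₀ (by positivity)] at this
  nlinarith

/-- A measure on `[0, ∞)` is determined by its (finite) Laplace transform. -/
theorem ext_of_laplaceT {μ ν : Measure ℝ} (hμ : ∀ᵐ x ∂μ, 0 ≤ x) (hν : ∀ᵐ x ∂ν, 0 ≤ x)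
    (hfin : ∀ r : ℝ, 0 < r → laplaceT μ r ≠ ∞)
    (h : ∀ r : ℝ, 0 < r → laplaceT μ r = laplaceT ν r) : μ = ν := by
  -- The measures may be infinite. Tilting by `e^{-y}` makes them finite, and pushing forward by `y
  -- ↦ e^{-y}` moves them to `[0, 1]`, where the `n`-th moment is the Laplace transform at `n + 1`.
  -- Both operations are invertible: the map is injective and the weight is positive and finite.
  set w : ℝ → ℝ≥0∞ := fun y => ENNReal.ofReal (Real.exp (-(1 * y))) with hw
  have hwm : Measurable w := measurable_expKernel 1
  have hw0 : ∀ y, w y ≠ 0 := fun y => by simp [hw, Real.exp_pos]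
  have hwt : ∀ y, w y ≠ ∞ := fun y => by simp [hw]
  have hTm : Measurable fun y : ℝ => Real.exp (-y) := by fun_prop
  have hTe : MeasurableEmbedding fun y : ℝ => Real.exp (-y) :=
    Continuous.measurableEmbedding (by fun_prop) (fun a b hab => by
      simpa using hab)
  have fin : ∀ ρ : Measure ℝ, laplaceT ρ 1 ≠ ∞ → IsFiniteMeasure (ρ.withDensity w) := by
    intro ρ hρ
    exact isFiniteMeasure_withDensity hρ
  have mom : ∀ ρ : Measure ℝ, ∀ n : ℕ,
      ∫ x, x ^ n ∂((ρ.withDensity w).map fun y => Real.exp (-y))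
        = (laplaceT ρ (n + 1)).toReal := by
    intro ρ n
    rw [integral_map hTm.aemeasurable (by fun_prop),
      integral_eq_lintegral_of_nonneg_ae (ae_of_all _ fun x => by positivity) (by fun_prop),
      lintegral_withDensity_eq_lintegral_mul _ hwm (by fun_prop)]
    congr 1
    refine lintegral_congr fun y => ?_
    simp only [hw, Pi.mul_apply]
    rw [← ENNReal.ofReal_mul (Real.exp_pos _).le, ← Real.exp_nat_mul, ← Real.exp_add]
    congr 2; ring
  have supp : ∀ ρ : Measure ℝ, (∀ᵐ x ∂ρ, 0 ≤ x) →
      ∀ᵐ x ∂((ρ.withDensity w).map fun y => Real.exp (-y)), x ∈ Icc (0 : ℝ) 1 := by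
    intro ρ hρ
    refine (ae_map_iff (p := (· ∈ Icc (0 : ℝ) 1)) hTm.aemeasurable measurableSet_Icc).2 ?_
    filter_upwards [(withDensity_absolutelyContinuous ρ w).ae_le hρ] with x hx
    exact ⟨(Real.exp_pos _).le, Real.exp_le_one_iff.2 (by linarith)⟩
  have := fin μ (hfin 1 one_pos)
  have := fin ν (h 1 one_pos ▸ hfin 1 one_pos)
  have e1 : (μ.withDensity w).map (fun y => Real.exp (-y))
      = (ν.withDensity w).map (fun y => Real.exp (-y)) := by
    refine ext_of_moments (supp μ hμ) (supp ν hν) fun n => ?_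
    rw [mom, mom, h _ (by positivity)]
  have e2 : μ.withDensity w = ν.withDensity w := by
    rw [← hTe.comap_map (μ.withDensity w), e1, hTe.comap_map]
  have inv : ∀ ρ : Measure ℝ, (ρ.withDensity w).withDensity w⁻¹ = ρ := fun ρ =>
    withDensity_inv_same hwm (ae_of_all _ hw0) (ae_of_all _ hwt)
  rw [← inv μ, e2, inv ν]

/-! ### Joint measurability and independence -/

/-- If `X_x < a`, right continuity provides a dense time `q > x` with `X_q < a`; hence `a ≤ X_x` is
decided by the countably many conditions `q ≤ x` or `a ≤ X_q`. The σ-algebra on `Ω` is kept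
arbitrary so that this can be used with the one generated by the processes. -/
theorem measurable_uncurry_of_monotone {Ω E : Type*} {m : MeasurableSpace Ω} [LinearOrder E]
    [TopologicalSpace E] [OrderTopology E] [SecondCountableTopology E] [MeasurableSpace E]
    [BorelSpace E] {X : ℝ≥0 → Ω → E} (hX : ∀ t, Measurable (X t))
    (hmono : ∀ ω, Monotone fun t => X t ω)
    (hrc : ∀ ω t, ContinuousWithinAt (fun s => X s ω) (Ici t) t) :
    Measurable fun p : ℝ≥0 × Ω => X p.1 p.2 := by
  refine measurable_of_Ici fun a => ?_
  have hset : (fun p : ℝ≥0 × Ω => X p.1 p.2) ⁻¹' Ici a =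
      ⋂ i : ℕ, ({p | TopologicalSpace.denseSeq ℝ≥0 i ≤ p.1} ∪
        {p | a ≤ X (TopologicalSpace.denseSeq ℝ≥0 i) p.2}) := by
    ext ⟨x, ω⟩
    simp only [mem_preimage, mem_Ici, mem_iInter, mem_union, mem_ofPred_eq]
    constructor
    · intro h i
      rcases le_total (TopologicalSpace.denseSeq ℝ≥0 i) x with h1 | h1
      · exact Or.inl h1
      · exact Or.inr (h.trans (hmono ω h1))
    · intro h
      by_contra! hlt
      have h1 : ∀ᶠ s in 𝓝[≥] x, X s ω < a := (hrc ω x).eventually (eventually_lt_nhds hlt)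
      obtain ⟨u, hu, hsub⟩ := mem_nhdsGE_iff_exists_Ico_subset.1 h1
      obtain ⟨i, hi⟩ := (TopologicalSpace.denseRange_denseSeq ℝ≥0).exists_mem_open isOpen_Ioo
        (nonempty_Ioo.2 hu)
      rcases h i with h2 | h2
      · exact absurd hi.1 (not_lt.2 h2)
      · exact absurd (hsub ⟨hi.1.le, hi.2⟩) (not_lt.2 h2)
  rw [hset]
  refine MeasurableSet.iInter fun i => ?_
  refine MeasurableSet.union (measurableSet_le measurable_const measurable_fst) ?_
  exact ((hX _).comp measurable_snd) measurableSet_Ici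

theorem measurable_processSigma {Ω E : Type*} [MeasurableSpace E] (X : ℝ≥0 → Ω → E) (t : ℝ≥0) :
    Measurable[processSigma X] (X t) :=
  (comap_measurable (X t)).mono (le_iSup (fun t => MeasurableSpace.comap (X t) inferInstance) t)
    le_rfl

theorem processSigma_le {Ω E : Type*} {m0 : MeasurableSpace Ω} [MeasurableSpace E]
    {X : ℝ≥0 → Ω → E} (h : ∀ t, Measurable (X t)) : processSigma X ≤ m0 :=
  iSup_le fun t => (h t).comap_le

/-- Fubini's theorem for independent random variables. -/
theorem _root_.ProbabilityTheory.IndepFun.lintegral_comp_prodMk {Ω S T : Type*}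
    [MeasurableSpace Ω] [MeasurableSpace S] [MeasurableSpace T] {P : Measure Ω}
    [IsProbabilityMeasure P] {X : Ω → S} {Z : Ω → T} (hX : Measurable X) (hZ : Measurable Z)
    (h : IndepFun X Z P) {F : S × T → ℝ≥0∞} (hF : Measurable F) :
    ∫⁻ ω, F (X ω, Z ω) ∂P = ∫⁻ ω, ∫⁻ ω', F (X ω, Z ω') ∂P ∂P := by
  have hprod := (indepFun_iff_map_prod_eq_prod_map_map hX.aemeasurable hZ.aemeasurable).1 h
  have := Measure.isProbabilityMeasure_map (μ := P) hZ.aemeasurable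
  rw [← lintegral_map hF (hX.prodMk hZ), hprod, lintegral_prod _ hF.aemeasurable,
    lintegral_map hF.lintegral_prod_right' hX]
  exact lintegral_congr fun ω => lintegral_map (hF.comp measurable_prodMk_left) hZ

/-- Fubini's theorem for independent σ-algebras. -/
theorem lintegral_indep {Ω S : Type*} {m1 m2 : MeasurableSpace Ω} {m0 : MeasurableSpace Ω}
    [MeasurableSpace S] {P : Measure Ω} [IsProbabilityMeasure P] (h1 : m1 ≤ m0)
    (h2 : m2 ≤ m0) (hind : Indep m2 m1 P) {X : Ω → S} (hX : Measurable[m2] X)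
    {F : S × Ω → ℝ≥0∞} (hF : Measurable[Prod.instMeasurableSpace (m₂ := m1)] F) :
    ∫⁻ ω, F (X ω, ω) ∂P = ∫⁻ ω, ∫⁻ ω', F (X ω, ω') ∂P ∂P := by
  -- The identity, as a map into `(Ω, m1)`, is the second random variable.
  have hI : @IndepFun Ω S Ω m0 _ m1 X id P := by
    refine (@IndepFun_iff_Indep Ω S Ω m0 _ m1 X id P).2 ?_
    rw [@MeasurableSpace.comap_id]
    exact indep_of_indep_of_le_left hind hX.comap_le
  exact @IndepFun.lintegral_comp_prodMk Ω S Ω m0 _ m1 P _ X id (hX.mono h2 le_rfl)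
    (measurable_id'' h1) hI F hF

/-- By monotonicity, `Y < c` can be tested on dense times `q < c` with `H_q > t`. The second set in
the union records the paths that never exceed `t`, where the infimum of the empty set is `0`. -/
theorem measurable_inverseProcess {Ω : Type*} {m : MeasurableSpace Ω} {H : ℝ≥0 → Ω → ℝ≥0∞}
    (hH : ∀ t, Measurable (H t)) (hmono : ∀ ω, Monotone fun t => H t ω)
    (t : ℝ≥0) : Measurable (inverseProcess H t) := by
  refine measurable_of_Iio fun c => ?_
  have hset : inverseProcess H t ⁻¹' Iio c =
      (⋃ i : ℕ, {ω | TopologicalSpace.denseSeq ℝ≥0 i < c} ∩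
        {ω | (t : ℝ≥0∞) < H (TopologicalSpace.denseSeq ℝ≥0 i) ω}) ∪
      ({ω | 0 < c} ∩ ⋂ i : ℕ, {ω | H (i : ℝ≥0) ω ≤ t}) := by
    ext ω
    simp only [mem_preimage, mem_Iio, mem_union, mem_iUnion, mem_inter_iff, mem_ofPred_eq,
      mem_iInter, inverseProcess]
    by_cases hne : {s : ℝ≥0 | (t : ℝ≥0∞) < H s ω}.Nonempty
    · constructor
      · intro h
        left
        obtain ⟨s, hs, hsc⟩ := exists_lt_of_csInf_lt hne h
        obtain ⟨i, hi⟩ := (TopologicalSpace.denseRange_denseSeq ℝ≥0).exists_mem_open isOpen_Ioo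
          (nonempty_Ioo.2 hsc)
        exact ⟨i, hi.2, lt_of_lt_of_le hs (hmono ω hi.1.le)⟩
      · rintro (⟨i, hi, hi2⟩ | ⟨_, h⟩)
        · exact lt_of_le_of_lt (csInf_le (OrderBot.bddBelow _) hi2) hi
        · exfalso
          obtain ⟨s, hs⟩ := hne
          obtain ⟨n, hn⟩ := exists_nat_ge s
          exact absurd (lt_of_lt_of_le hs (hmono ω hn)) (not_lt.2 (h n))
    · have hall : ∀ s, H s ω ≤ t := fun s => not_lt.1 fun hs => hne ⟨s, hs⟩
      rw [not_nonempty_iff_eq_empty.1 hne, NNReal.sInf_empty]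
      constructor
      · exact fun h => Or.inr ⟨h, fun i => hall i⟩
      · rintro (⟨i, hi, hi2⟩ | ⟨h, _⟩)
        · exact absurd hi2 (not_lt.2 (hall _))
        · exact h
  rw [hset]
  refine MeasurableSet.union (MeasurableSet.iUnion fun i => ?_) ?_
  · exact (MeasurableSet.const _).inter ((hH _) measurableSet_Ioi)
  · exact (MeasurableSet.const _).inter (MeasurableSet.iInter fun i => (hH _) measurableSet_Iic)

/-! ### Gamma moments, counting probabilities and Poisson mixtures -/

theorem integral_pow_mul_exp_gammaMeasure {a β L : ℝ} (ha : 0 < a) (hβ : 0 < β) (hL : 0 < β + L)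
    (z : ℕ) :
    ∫ x, x ^ z * Real.exp (-(L * x)) ∂(gammaMeasure a β) =
      β ^ a / Real.Gamma a * ((1 / (β + L)) ^ (a + z) * Real.Gamma (a + z)) := by
  rw [gammaMeasure, integral_withDensity_eq_integral_toReal_smul
    (f := gammaPDF a β) (measurable_gammaPDFReal a β).ennreal_ofReal
    (ae_of_all _ fun x => by simp [gammaPDF])]
  have h1 : ∀ x, (gammaPDF a β x).toReal • (x ^ z * Real.exp (-(L * x))) =
      (Ici (0 : ℝ)).indicator (fun x => β ^ a / Real.Gamma a * x ^ (a - 1) *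
        Real.exp (-(β * x)) * (x ^ z * Real.exp (-(L * x)))) x := by
    intro x
    rw [gammaPDF, ENNReal.toReal_ofReal (gammaPDFReal_nonneg ha hβ x), gammaPDFReal, smul_eq_mul]
    by_cases hx : 0 ≤ x
    · rw [if_pos hx, indicator_of_mem (mem_Ici.2 hx)]
    · rw [if_neg hx, indicator_of_notMem (by simpa using hx), zero_mul]
  simp_rw [h1]
  rw [integral_indicator measurableSet_Ici, integral_Ici_eq_integral_Ioi,
    ← Real.integral_rpow_mul_exp_neg_mul_Ioi (by positivity) hL, ← integral_const_mul]
  refine setIntegral_congr_fun measurableSet_Ioi fun x hx => ?_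
  have hx' : 0 < x := hx
  have e1 : x ^ (a + z - 1) = x ^ (a - 1) * x ^ z := by
    rw [show a + (z : ℝ) - 1 = (a - 1) + z by ring, Real.rpow_add hx', Real.rpow_natCast]
  have e2 : Real.exp (-((β + L) * x)) = Real.exp (-(β * x)) * Real.exp (-(L * x)) := by
    rw [← Real.exp_add]; ring_nf
  simp only [e1, e2]
  ring

/-- The bound comes from one term of the exponential series, `(L x)^z / z! ≤ e^{Lx}`. -/
theorem integrable_pow_mul_exp_of_nonneg {Ω : Type*} [MeasurableSpace Ω] {P : Measure Ω}
    [IsFiniteMeasure P] {X : Ω → ℝ} (hX : AEMeasurable X P) (h0 : ∀ᵐ ω ∂P, 0 ≤ X ω) {L : ℝ}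
    (hL : 0 < L) (z : ℕ) : Integrable (fun ω => X ω ^ z * Real.exp (-(L * X ω))) P := by
  refine Integrable.of_bound (by fun_prop) (z ! / L ^ z) ?_
  filter_upwards [h0] with ω hω
  rw [Real.norm_eq_abs, abs_of_nonneg (by positivity), Real.exp_neg, ← div_eq_mul_inv,
    div_le_div_iff₀ (Real.exp_pos _) (by positivity), mul_comm, ← mul_pow]
  have := Real.pow_div_factorial_le_exp (L * X ω) (by positivity) z
  rw [div_le_iff₀ (by positivity)] at this
  linarith

/-! ### One-dimensional laws of the generalized counting process. -/

section Gcp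

variable {k : ℕ} (rate : Fin k → ℝ)

/-- Separates the powers of the rates, which stay fixed, from the factor `t^z e^{-Λt}`, the only one
that the derivative in `Λ` has to produce. -/
theorem gcpProb_eq (n : ℕ) (t : ℝ) :
    gcpProb rate n t = ∑ x ∈ partitions k n, (∏ j, rate j ^ x j / (x j)!) *
      (t ^ (∑ j, x j) * Real.exp (-(totalRate rate * t))) := by
  refine Finset.sum_congr rfl fun x _ => ?_
  rw [← mul_assoc]
  congr 1
  simp_rw [mul_pow, mul_div_right_comm]
  rw [Finset.prod_mul_distrib, Finset.prod_pow_eq_pow_sum]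

@[fun_prop]
theorem continuous_gcpProb (n : ℕ) : Continuous (gcpProb rate n) := by
  unfold gcpProb
  fun_prop

theorem gcpProb_nonneg (hrate : ∀ j, 0 < rate j) (n : ℕ) {t : ℝ} (ht : 0 ≤ t) :
    0 ≤ gcpProb rate n t :=
  Finset.sum_nonneg fun x _ => mul_nonneg
    (Finset.prod_nonneg fun j _ => by have := (hrate j).le; positivity) (Real.exp_pos _).le

/-- Half of the exponent `Λ t` absorbs the powers of `t`; the other half remains as decay. -/
theorem exists_gcpProb_le (hrate : ∀ j, 0 < rate j) (hk : 0 < totalRate rate) (n : ℕ) :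
    ∃ C, 0 ≤ C ∧ ∀ t, 0 ≤ t → gcpProb rate n t ≤ C * Real.exp (-(totalRate rate / 2 * t)) := by
  set Λ := totalRate rate
  refine ⟨∑ x ∈ partitions k n, (∏ j, rate j ^ x j / (x j)!) *
    ((∑ j, x j)! / (Λ / 2) ^ (∑ j, x j)), ?_, ?_⟩
  · refine Finset.sum_nonneg fun x _ => mul_nonneg
      (Finset.prod_nonneg fun j _ => by have := (hrate j).le; positivity) (by positivity)
  · intro t ht
    rw [gcpProb_eq, Finset.sum_mul]
    refine Finset.sum_le_sum fun x _ => ?_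
    rw [mul_assoc]
    refine mul_le_mul_of_nonneg_left ?_
      (Finset.prod_nonneg fun j _ => by have := (hrate j).le; positivity)
    have e : Real.exp (-(Λ * t)) = Real.exp (-(Λ / 2 * t)) * Real.exp (-(Λ / 2 * t)) := by
      rw [← Real.exp_add]; ring_nf
    rw [show totalRate rate = Λ from rfl, e, ← mul_assoc]
    refine mul_le_mul_of_nonneg_right ?_ (Real.exp_pos _).le
    rw [Real.exp_neg, ← div_eq_mul_inv,
      div_le_div_iff₀ (Real.exp_pos _) (by positivity), mul_comm, ← mul_pow]
    have := Real.pow_div_factorial_le_exp (Λ / 2 * t) (by positivity) (∑ j, x j)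
    rw [div_le_iff₀ (by positivity)] at this
    linarith

variable {Ω : Type*} [MeasurableSpace Ω] {P : Measure Ω} {M : ℝ≥0 → Ω → ℕ}

theorem IsGCP.law (hM : IsGCP rate M P) (h : ℝ≥0) (n : ℕ) :
    P.real {ω | M h ω = n} = gcpProb rate n h := by
  have := hM.law_incr 0 h n
  simpa [hM.zero] using this

/-- Chapman–Kolmogorov, read off from the stationary independent increments of `M`; no manipulation
of the sums over partitions is needed. -/
theorem IsGCP.gcpProb_add [IsProbabilityMeasure P] (hM : IsGCP rate M P) (s h : ℝ≥0) (n : ℕ) :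
    gcpProb rate n (s + h) =
      ∑ p ∈ Finset.HasAntidiagonal.antidiagonal n, gcpProb rate p.1 s * gcpProb rate p.2 h := by
  have h1 := hM.law rate (s + h) n
  rw [NNReal.coe_add] at h1
  have hmono : ∀ ω, M s ω ≤ M (s + h) ω := fun ω => hM.mono ω (by simp)
  have hI : IndepFun (M s) (fun ω => M (s + h) ω - M s ω) P := by
    have h2 := hM.indep_incr.indepFun_sub_sub (zero_le (a := s)) (le_self_add : s ≤ s + h)
    refine h2.congr (ae_of_all _ fun ω => ?_) (ae_of_all _ fun ω => ?_)
    · simp [hM.zero]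
    · simp
  have hms : ∀ t j, MeasurableSet {ω | M t ω = j} := fun t j =>
    hM.measurable t (measurableSet_singleton j)
  have hmd : ∀ j, MeasurableSet {ω | M (s + h) ω - M s ω = j} := fun j =>
    ((hM.measurable (s + h)).sub (hM.measurable s)) (measurableSet_singleton j)
  have hset : {ω | M (s + h) ω = n} = ⋃ p ∈ Finset.HasAntidiagonal.antidiagonal n,
      ({ω | M s ω = p.1} ∩ {ω | M (s + h) ω - M s ω = p.2}) := by
    ext ω
    simp only [mem_ofPred_eq, mem_iUnion, Finset.HasAntidiagonal.mem_antidiagonal, mem_inter_iff,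
      exists_prop]
    constructor
    · intro hn
      exact ⟨(M s ω, n - M s ω), by have := hmono ω; omega, rfl, by rw [hn]⟩
    · rintro ⟨p, hp, h2, h3⟩
      have := hmono ω
      omega
  rw [← h1, hset, measureReal_biUnion_finset]
  · refine Finset.sum_congr rfl fun p _ => ?_
    rw [← hM.law rate s, ← hM.law_incr s h, measureReal_def, measureReal_def, measureReal_def,
      ← ENNReal.toReal_mul]
    congr 1
    exact hI.measure_inter_preimage_eq_mul _ _ (measurableSet_singleton p.1)
      (measurableSet_singleton p.2)
  · intro p _ q _ hpq
    rw [Function.onFun, Set.disjoint_left]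
    rintro ω ⟨h2, h3⟩ ⟨h4, h5⟩
    simp only [mem_ofPred_eq] at h2 h3 h4 h5
    exact hpq (Prod.ext (h2.symm.trans h4) (h3.symm.trans h5))
  · exact fun p _ => (hms _ _).inter (hmd _)

end Gcp

/-- The Poisson mixture `∑ e^{-λ s} (λ s)^k / k! a(k)`. -/
noncomputable def poissonMix (lam : ℝ) (a : ℕ → ℝ) (s : ℝ) : ℝ :=
  Real.exp (-(lam * s)) * ∑' k : ℕ, (lam * s) ^ k / k ! * a k

theorem summable_pow_div_factorial_mul {a : ℕ → ℝ} {C : ℝ} (ha : ∀ k, |a k| ≤ C) (x : ℝ) :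
    Summable fun k : ℕ => x ^ k / k ! * a k := by
  refine Summable.of_norm_bounded ((Real.summable_pow_div_factorial |x|).mul_right C) fun k => ?_
  rw [norm_mul, norm_div, norm_pow, Real.norm_eq_abs, Real.norm_eq_abs, Real.norm_eq_abs,
    Nat.abs_cast]
  gcongr
  exact ha k

theorem hasDerivAt_tsum_pow_div_factorial {a : ℕ → ℝ} {C : ℝ} (ha : ∀ k, |a k| ≤ C) (x : ℝ) :
    HasDerivAt (fun y : ℝ => ∑' k : ℕ, y ^ k / k ! * a k)
      (∑' k : ℕ, x ^ k / k ! * a (k + 1)) x := by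
  have hC : 0 ≤ C := (abs_nonneg _).trans (ha 0)
  set R : ℝ := |x| + 1
  -- Dominates the differentiated terms on `(-R, R)`, an interval containing both `x` and the base
  -- point `0`. The truncated exponent `k - 1` is harmless at `k = 0`, where the factor `k`
  -- vanishes.
  have hsum : Summable fun k : ℕ => (k : ℝ) * R ^ (k - 1) / k ! * C := by
    rw [← summable_nat_add_iff 1]
    refine ((Real.summable_pow_div_factorial R).mul_right C).congr fun k => ?_
    rw [Nat.factorial_succ, Nat.add_sub_cancel]
    push_cast
    field_simp
  have hd : ∀ (k : ℕ) (y : ℝ), HasDerivAt (fun y : ℝ => y ^ k / k ! * a k)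
      ((k : ℝ) * y ^ (k - 1) / k ! * a k) y := fun k y =>
    ((hasDerivAt_pow k y).div_const _).mul_const _
  have key := hasDerivAt_tsum_of_isPreconnected (𝕜 := ℝ) (F := ℝ)
    (g := fun (k : ℕ) (y : ℝ) => y ^ k / k ! * a k)
    (g' := fun (k : ℕ) (y : ℝ) => (k : ℝ) * y ^ (k - 1) / k ! * a k)
    (t := Ioo (-R) R) (y₀ := 0) (y := x) hsum isOpen_Ioo isPreconnected_Ioo
    (fun k y _ => hd k y) ?_ ?_ (summable_pow_div_factorial_mul ha 0) ?_
  · convert! key using 1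
    have hs' : Summable fun k : ℕ => (k : ℝ) * x ^ (k - 1) / k ! * a k := by
      rw [← summable_nat_add_iff 1]
      refine (summable_pow_div_factorial_mul (a := fun k => a (k + 1)) (fun k => ha _) x).congr
        fun k => ?_
      rw [Nat.factorial_succ, Nat.add_sub_cancel]
      push_cast
      field_simp
    rw [hs'.tsum_eq_zero_add]
    simp only [Nat.cast_zero, zero_mul, zero_div, zero_add]
    refine tsum_congr fun k => ?_
    rw [Nat.factorial_succ, Nat.add_sub_cancel]
    push_cast
    field_simp
  · intro k y hy
    rw [norm_mul, norm_div, norm_mul, norm_pow, Real.norm_eq_abs, Real.norm_eq_abs,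
      Real.norm_eq_abs, Real.norm_eq_abs, Nat.abs_cast, Nat.abs_cast]
    have hy' : |y| ≤ R := (abs_lt.2 hy).le
    gcongr
    exact ha k
  · have : 0 < R := by positivity
    exact ⟨by linarith, this⟩
  · have := abs_le.1 (le_refl |x|)
    constructor <;> simp only [R] <;> linarith

/-- Kolmogorov's equation for the Poisson process: a jump at rate `lam` shifts the coefficient
sequence by one. -/
theorem hasDerivAt_poissonMix (lam : ℝ) {a : ℕ → ℝ} {C : ℝ} (ha : ∀ k, |a k| ≤ C) (s : ℝ) :
    HasDerivAt (poissonMix lam a)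
      (lam * (poissonMix lam (fun k => a (k + 1)) s - poissonMix lam a s)) s := by
  have h1 : HasDerivAt (fun s : ℝ => lam * s) lam s := by
    simpa using (hasDerivAt_id s).const_mul lam
  have h2 := (hasDerivAt_tsum_pow_div_factorial ha (lam * s)).comp s h1
  have h3 := h1.neg.exp.mul h2
  refine h3.congr_deriv ?_
  simp only [poissonMix, Function.comp_apply, Pi.neg_apply]
  ring

theorem hasSum_pow_div_factorial (x : ℝ) : HasSum (fun k : ℕ => x ^ k / k !) (Real.exp x) := by
  rw [Real.exp_eq_exp_ℝ]
  exact NormedSpace.expSeries_div_hasSum_exp x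

/-- With `ρ = (β / (β + L))^α`, the Laplace transform of one Gamma jump, the exponent is `ψ_GN(L)`.
-/
theorem poissonMix_pow (lam ρ C s : ℝ) :
    poissonMix lam (fun k => C * ρ ^ k) s = C * Real.exp (-(lam * (1 - ρ) * s)) := by
  have h := (hasSum_pow_div_factorial (lam * s * ρ)).tsum_eq
  have : ∀ k : ℕ, (lam * s) ^ k / k ! * (C * ρ ^ k) = C * ((lam * s * ρ) ^ k / k !) := by
    intro k; rw [mul_pow (lam * s) ρ]; ring
  simp only [poissonMix, this, tsum_mul_left, h]
  rw [mul_left_comm, ← Real.exp_add]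
  ring_nf

theorem poissonMix_nonneg {lam : ℝ} (hlam : 0 < lam) {a : ℕ → ℝ} (ha : ∀ k, 0 ≤ a k) {s : ℝ}
    (hs : 0 ≤ s) : 0 ≤ poissonMix lam a s :=
  mul_nonneg (Real.exp_pos _).le (tsum_nonneg fun k => mul_nonneg (by positivity) (ha k))

/-- Turns geometric decay in the number of Poisson jumps into exponential decay in time. -/
theorem poissonMix_le {lam : ℝ} (hlam : 0 < lam) {a : ℕ → ℝ} {C ρ : ℝ} (h0 : ∀ k, 0 ≤ a k)
    (hρ0 : 0 ≤ ρ) (hρ1 : ρ ≤ 1) (ha : ∀ k, a k ≤ C * ρ ^ k) {s : ℝ} (hs : 0 ≤ s) :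
    poissonMix lam a s ≤ C * Real.exp (-(lam * (1 - ρ) * s)) := by
  have hC : 0 ≤ C := by simpa using (h0 0).trans (ha 0)
  rw [← poissonMix_pow]
  have hb : ∀ k : ℕ, C * ρ ^ k ≤ C := fun k => mul_le_of_le_one_right hC (pow_le_one₀ hρ0 hρ1)
  refine mul_le_mul_of_nonneg_left ?_ (Real.exp_pos _).le
  refine Summable.tsum_le_tsum (fun k => mul_le_mul_of_nonneg_left (ha k) (by positivity))
    (summable_pow_div_factorial_mul (C := C) (fun k => ?_) _)
    (summable_pow_div_factorial_mul (C := C) (fun k => ?_) _)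
  · rw [abs_of_nonneg (h0 k)]; exact (ha k).trans (hb k)
  · rw [abs_of_nonneg (by positivity)]; exact hb k

/-! ### The compound Poisson–Gamma time change -/

theorem IsGammaProcess.law {Ω : Type*} [MeasurableSpace Ω] {P : Measure Ω} {α β : ℝ}
    {G : ℝ≥0 → Ω → ℝ≥0} (hG : IsGammaProcess α β G P) {h : ℝ≥0} (hh : 0 < h) :
    P.map (fun ω => (G h ω : ℝ)) = gammaMeasure (α * h) β := by
  have := hG.law_incr 0 h hh
  simpa [hG.zero] using this

theorem IsPoissonProcess.law {Ω : Type*} [MeasurableSpace Ω] {P : Measure Ω} {lam : ℝ}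
    {N : ℝ≥0 → Ω → ℕ} (hN : IsPoissonProcess lam N P) (h : ℝ≥0) :
    P.map (N h) = poissonMeasure (lam.toNNReal * h) := by
  have := hN.law_incr 0 h
  simpa [hN.zero] using this

theorem IsGammaProcess.integral_exp_neg {Ω : Type*} [MeasurableSpace Ω] {P : Measure Ω}
    [IsProbabilityMeasure P] {α β : ℝ} (hα : 0 < α) (hβ : 0 < β)
    {G : ℝ≥0 → Ω → ℝ≥0} (hG : IsGammaProcess α β G P) {L : ℝ} (hL : 0 ≤ L) (k : ℕ) :
    ∫ ω, Real.exp (-(L * G k ω)) ∂P = ((β / (β + L)) ^ α) ^ k := by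
  -- At `k = 0` the Gamma law is degenerate and is not supplied by `law_incr`; there `G 0 = 0` is
  -- used directly.
  rcases Nat.eq_zero_or_pos k with rfl | hk
  · simp [hG.zero]
  have hk' : (0 : ℝ) < k := by exact_mod_cast hk
  have hak : 0 < α * k := by positivity
  have h1 := integral_pow_mul_exp_gammaMeasure hak hβ (by linarith : 0 < β + L) 0
  have h2 : P.map (fun ω => (G (k : ℝ≥0) ω : ℝ)) = gammaMeasure (α * k) β := by
    simpa using hG.law (h := (k : ℝ≥0)) (by exact_mod_cast hk)
  rw [← h2, integral_map (by have := hG.measurable k; fun_prop) (by fun_prop)] at h1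
  simp only [pow_zero, one_mul, Nat.cast_zero, add_zero] at h1
  rw [h1, ← Real.rpow_natCast, ← Real.rpow_mul (by positivity), div_eq_mul_one_div β,
    Real.mul_rpow hβ.le (by positivity)]
  have := (Real.Gamma_pos_of_pos hak).ne'
  field_simp

section Coef

variable {k : ℕ} (rate : Fin k → ℝ) (α β : ℝ)

/-- The probability that the counting process evaluated at an independent `Gamma(α, β)` time
equals `m`. -/
noncomputable def gammaCoef (m : ℕ) : ℝ := ∫ x, gcpProb rate m x ∂(gammaMeasure α β)

theorem gammaMeasure_ae_nonneg (a r : ℝ) : ∀ᵐ x ∂(gammaMeasure a r), 0 ≤ x := by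
  rw [gammaMeasure,
    ae_withDensity_iff (f := gammaPDF a r) (measurable_gammaPDFReal a r).ennreal_ofReal]
  refine ae_of_all _ fun x hx => ?_
  by_contra! h
  exact hx (gammaPDF_of_neg h)

/-- Each term is a Gamma integral. Multiplied by `λ`, the result is the coefficient of `p̃_{n-m}` in
the governing equation. -/
theorem gammaCoef_eq (hα : 0 < α) (hβ : 0 < β) (hΛ : 0 < totalRate rate) (m : ℕ) :
    gammaCoef rate α β m = β ^ α / ((totalRate rate + β) ^ α * Real.Gamma α) *
      ∑ x ∈ partitions k m, Real.Gamma (((∑ j, x j : ℕ) : ℝ) + α) /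
        (totalRate rate + β) ^ (∑ j, x j) * (∏ j, rate j ^ x j / (x j)!) := by
  have := isProbabilityMeasure_gammaMeasure hα hβ
  simp only [gammaCoef, gcpProb_eq]
  rw [integral_finsetSum _ fun x _ => (integrable_pow_mul_exp_of_nonneg (X := fun y : ℝ => y)
    aemeasurable_id (gammaMeasure_ae_nonneg α β) hΛ _).const_mul _, Finset.mul_sum]
  refine Finset.sum_congr rfl fun x _ => ?_
  have hp : 0 < β + totalRate rate := by positivity
  rw [integral_const_mul, integral_pow_mul_exp_gammaMeasure hα hβ hp, one_div,
    Real.inv_rpow hp.le, Real.rpow_add hp, Real.rpow_natCast, add_comm β, add_comm α]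
  have := (Real.Gamma_pos_of_pos hα).ne'
  have : totalRate rate + β ≠ 0 := by positivity
  have h3 : (totalRate rate + β) ^ α ≠ 0 := by positivity
  field_simp

variable {α β} {Ω : Type*} [MeasurableSpace Ω] {P : Measure Ω} [IsProbabilityMeasure P]
  {M : ℝ≥0 → Ω → ℕ} {G : ℝ≥0 → Ω → ℝ≥0}

theorem integrable_gcpProb_comp (hrate : ∀ j, 0 < rate j) (hΛ : 0 < totalRate rate)
    {X : Ω → ℝ} (hX : AEMeasurable X P) (h0 : ∀ᵐ ω ∂P, 0 ≤ X ω) (n : ℕ) :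
    Integrable (fun ω => gcpProb rate n (X ω)) P := by
  obtain ⟨C, hC, hb⟩ := exists_gcpProb_le rate hrate hΛ n
  refine Integrable.of_bound
    ((continuous_gcpProb rate n).measurable.comp_aemeasurable hX).aestronglyMeasurable C ?_
  filter_upwards [h0] with ω hω
  rw [Real.norm_eq_abs, abs_of_nonneg (gcpProb_nonneg rate hrate n hω)]
  refine (hb _ hω).trans (mul_le_of_le_one_right hC (Real.exp_le_one_iff.2 ?_))
  have : 0 ≤ totalRate rate / 2 * X ω := by positivity
  linarith

/-- `P(M(G(k)) = n)`. -/
noncomputable def gammaProb (P : Measure Ω) (G : ℝ≥0 → Ω → ℝ≥0) (n l : ℕ) : ℝ :=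
  ∫ ω, gcpProb rate n (G l ω) ∂P

/-- The increment `G(l+1) - G(l)` is an independent `Gamma(α, β)` time, so the semigroup property
`gcpProb_add` turns one more Gamma jump into a convolution with the weights `gammaCoef`. -/
theorem gammaProb_succ (hrate : ∀ j, 0 < rate j) (hΛ : 0 < totalRate rate)
    (hM : IsGCP rate M P) (hG : IsGammaProcess α β G P) (n l : ℕ) :
    gammaProb rate P G n (l + 1) = ∑ p ∈ Finset.HasAntidiagonal.antidiagonal n,
      gammaProb rate P G p.1 l * gammaCoef rate α β p.2 := by
  have hm : ∀ t, Measurable fun ω => (G t ω : ℝ) := fun t => (hG.measurable t).coe_nnreal_real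
  set D : Ω → ℝ≥0 := fun ω => G (l + 1) ω - G l ω
  have hD : Measurable D := (hG.measurable _).sub (hG.measurable _)
  have hadd : ∀ ω, G (l + 1) ω = G l ω + D ω := fun ω =>
    (add_tsub_cancel_of_le (hG.mono ω (by simp : (l : ℝ≥0) ≤ l + 1))).symm
  have hI : IndepFun (G l) D P := by
    have h2 := hG.indep_incr.indepFun_sub_sub (zero_le (a := (l : ℝ≥0)))
      (le_self_add : (l : ℝ≥0) ≤ l + 1)
    refine h2.congr (ae_of_all _ fun ω => ?_) (ae_of_all _ fun ω => ?_)
    · simp [hG.zero]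
    · simp [D]
  have hDlaw : P.map (fun ω => (D ω : ℝ)) = gammaMeasure α β := by
    simpa using hG.law_incr l 1 one_pos
  have hcomp : ∀ n m, IndepFun (fun ω => gcpProb rate n (G l ω))
      (fun ω => gcpProb rate m (D ω)) P :=
    fun n m => hI.comp
      (by fun_prop : Measurable fun x : ℝ≥0 => gcpProb rate n x)
      (by fun_prop : Measurable fun x : ℝ≥0 => gcpProb rate m x)
  have hi1 : ∀ n, Integrable (fun ω => gcpProb rate n (G l ω)) P := fun n =>
    integrable_gcpProb_comp rate hrate hΛ (hm _).aemeasurable (ae_of_all _ fun ω => by simp) n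
  have hi2 : ∀ n, Integrable (fun ω => gcpProb rate n (D ω)) P := fun n =>
    integrable_gcpProb_comp rate hrate hΛ hD.coe_nnreal_real.aemeasurable
      (ae_of_all _ fun ω => by simp) n
  have e : ∀ ω, gcpProb rate n (G ((l + 1 : ℕ) : ℝ≥0) ω) =
      ∑ p ∈ Finset.HasAntidiagonal.antidiagonal n,
        gcpProb rate p.1 (G l ω) * gcpProb rate p.2 (D ω) := by
    intro ω
    rw [Nat.cast_succ, hadd, NNReal.coe_add]
    exact hM.gcpProb_add rate _ _ n
  simp only [gammaProb, e]
  rw [integral_finsetSum _ fun p _ => (hcomp p.1 p.2).integrable_mul (hi1 _) (hi2 _)]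
  refine Finset.sum_congr rfl fun p _ => ?_
  rw [(hcomp p.1 p.2).integral_fun_mul_eq_mul_integral (hi1 _).1 (hi2 _).1]
  congr 1
  rw [gammaCoef, ← hDlaw, integral_map hD.coe_nnreal_real.aemeasurable (by fun_prop)]

theorem gammaProb_nonneg {Ω : Type*} [MeasurableSpace Ω] (P : Measure Ω) (G : ℝ≥0 → Ω → ℝ≥0)
    (hrate : ∀ j, 0 < rate j) (n l : ℕ) : 0 ≤ gammaProb rate P G n l :=
  integral_nonneg fun ω => gcpProb_nonneg rate hrate n (by simp)

/-- The bound `C e^{-Λx/2}` on `gcpProb` integrates to the Laplace transform of `G(l)` at `Λ/2`,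
which is geometric in `l`. -/
theorem exists_gammaProb_le (hrate : ∀ j, 0 < rate j) (hΛ : 0 < totalRate rate) (hα : 0 < α)
    (hβ : 0 < β) (hG : IsGammaProcess α β G P) (n : ℕ) :
    ∃ C, 0 ≤ C ∧ ∀ l, gammaProb rate P G n l ≤
      C * ((β / (β + totalRate rate / 2)) ^ α) ^ l := by
  obtain ⟨C, hC, hb⟩ := exists_gcpProb_le rate hrate hΛ n
  refine ⟨C, hC, fun l => ?_⟩
  have hm : Measurable fun ω => (G l ω : ℝ) := (hG.measurable l).coe_nnreal_real
  rw [← hG.integral_exp_neg hα hβ (by positivity : 0 ≤ totalRate rate / 2), ← integral_const_mul]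
  refine integral_mono
    (integrable_gcpProb_comp rate hrate hΛ hm.aemeasurable (ae_of_all _ fun ω => by simp) n)
    (Integrable.const_mul ?_ C) fun ω => hb _ (by simp)
  simpa using integrable_pow_mul_exp_of_nonneg (P := P) hm.aemeasurable
    (ae_of_all _ fun ω => by simp) (by positivity : 0 < totalRate rate / 2) 0

end Coef

/-! ### Conditioning on the Poisson clock and on the inverse subordinator. -/

section Composition

variable {Ω : Type*} {m0 : MeasurableSpace Ω} {P : Measure Ω} [IsProbabilityMeasure P]
  {α β lam : ℝ} {N : ℝ≥0 → Ω → ℕ} {G : ℝ≥0 → Ω → ℝ≥0} {H : ℝ≥0 → Ω → ℝ≥0∞}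

/-- The law of `G(N(s))` is a Poisson mixture of the laws of `G(k)`. -/
theorem lintegral_gamma_poisson (hlam : 0 < lam) (hN : IsPoissonProcess lam N P)
    (hG : IsGammaProcess α β G P) (hNG : Indep (processSigma N) (processSigma G) P)
    {u : ℝ≥0 → ℝ≥0∞} (hu : Measurable u) (s : ℝ≥0) :
    ∫⁻ ω, u (G (N s ω) ω) ∂P = ∑' l : ℕ,
      ENNReal.ofReal (Real.exp (-(lam * s)) * ((lam * s) ^ l / l !)) * ∫⁻ ω, u (G l ω) ∂P := by
  have hF : Measurable[Prod.instMeasurableSpace (m₂ := processSigma G)]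
      fun p : ℕ × Ω => u (G (p.1 : ℝ≥0) p.2) :=
    @measurable_from_prod_countable_right _ _ _ _ (processSigma G) _ _ _ _ fun l =>
      hu.comp (measurable_processSigma G l)
  rw [lintegral_indep (m1 := processSigma G) (m2 := processSigma N)
    (processSigma_le hG.measurable) (processSigma_le hN.measurable) hNG
    (X := N s) (measurable_processSigma N s) hF]
  rw [← lintegral_map (f := fun l : ℕ => ∫⁻ ω', u (G l ω') ∂P) (measurable_of_countable _)
    (hN.measurable s),
    lintegral_countable', hN.law]
  refine tsum_congr fun l => ?_
  rw [poissonMeasure_singleton, mul_comm]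
  congr 2
  simp only [NNReal.coe_mul, Real.coe_toNNReal _ hlam.le]
  ring

/-- `Y(t)` is a functional of `H` alone, hence independent of `(N, G)`; freezing it reduces the
claim to the law of `G(N(s))` at a deterministic `s`. -/
theorem lintegral_compound_inverse (hlam : 0 < lam) (hN : IsPoissonProcess lam N P)
    (hG : IsGammaProcess α β G P) (hHm : ∀ t, Measurable (H t))
    (hHmono : ∀ ω, Monotone fun t => H t ω)
    (hNG : Indep (processSigma N) (processSigma G) P)
    (hH : Indep (processSigma H) (processSigma N ⊔ processSigma G) P)
    {u : ℝ≥0 → ℝ≥0∞} (hu : Measurable u) (t : ℝ≥0) :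
    ∫⁻ ω, u (compoundProcess G N (inverseProcess H t ω) ω) ∂P = ∫⁻ ω, ∑' l : ℕ,
      ENNReal.ofReal (Real.exp (-(lam * inverseProcess H t ω)) *
        ((lam * inverseProcess H t ω) ^ l / l !)) * ∫⁻ ω', u (G l ω') ∂P ∂P := by
  have hF : Measurable[Prod.instMeasurableSpace (m₂ := processSigma N ⊔ processSigma G)]
      fun p : ℝ≥0 × Ω => u (compoundProcess G N p.1 p.2) := by
    have h1 := @measurable_uncurry_of_monotone Ω ℕ (processSigma N ⊔ processSigma G) _ _ _ _ _ _ N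
      (fun t => (measurable_processSigma N t).mono le_sup_left le_rfl) hN.mono hN.right_cont
    have h2 := @measurable_uncurry_of_monotone Ω ℝ≥0 (processSigma N ⊔ processSigma G) _ _ _ _ _ _ G
      (fun t => (measurable_processSigma G t).mono le_sup_right le_rfl) hG.mono hG.right_cont
    have h3 : Measurable fun n : ℕ => (n : ℝ≥0) := by fun_prop
    exact hu.comp (h2.comp ((h3.comp h1).prodMk measurable_snd))
  rw [lintegral_indep (m1 := processSigma N ⊔ processSigma G) (m2 := processSigma H)
    (sup_le (processSigma_le hN.measurable) (processSigma_le hG.measurable))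
    (processSigma_le hHm) hH (X := inverseProcess H t)
    (measurable_inverseProcess (fun t => measurable_processSigma H t) hHmono t) hF]
  exact lintegral_congr fun ω => lintegral_gamma_poisson hlam hN hG hNG hu _

end Composition

/-! ### State probabilities and derivatives of Laplace transforms -/

section LaplaceDerivatives

variable {Ω : Type*} [MeasurableSpace Ω] {P : Measure Ω} [IsProbabilityMeasure P] {X : Ω → ℝ}

/-- Places `-L` where the moment generating function is analytic and may be differentiated under the
expectation. -/
theorem neg_mem_interior_integrableExpSet (hX : Measurable X) (h0 : ∀ ω, 0 ≤ X ω) {L : ℝ}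
    (hL : 0 < L) : -L ∈ interior (integrableExpSet X P) := by
  refine interior_maximal (t := Iio 0) (fun s hs => ?_) isOpen_Iio (by simpa using hL)
  have := integrable_pow_mul_exp_of_nonneg (P := P) hX.aemeasurable (ae_of_all _ h0)
    (neg_pos.2 hs) 0
  simpa [integrableExpSet] using this

theorem contDiffAt_of_eventuallyEq_laplace (hX : Measurable X) (h0 : ∀ ω, 0 ≤ X ω) {L : ℝ}
    (hL : 0 < L) {g : ℝ → ℝ} (hg : g =ᶠ[𝓝 L] fun L => ∫ ω, Real.exp (-(L * X ω)) ∂P) :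
    ContDiffAt ℝ ((⊤ : ℕ∞) : WithTop ℕ∞) g L := by
  have hA := analyticAt_mgf (neg_mem_interior_integrableExpSet (P := P) hX h0 hL)
  have h1 : ContDiffAt ℝ ((⊤ : ℕ∞) : WithTop ℕ∞) (fun L => mgf X P (-L)) L :=
    ContDiffAt.comp (g := mgf X P) (f := fun L : ℝ => -L) L hA.contDiffAt contDiffAt_id.neg
  refine h1.congr_of_eventuallyEq (hg.trans (Eventually.of_forall fun L => ?_))
  simp [mgf]

theorem negDerivPow_of_eventuallyEq_laplace (hX : Measurable X) (h0 : ∀ ω, 0 ≤ X ω) {L : ℝ}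
    (hL : 0 < L) {g : ℝ → ℝ} (hg : g =ᶠ[𝓝 L] fun L => ∫ ω, Real.exp (-(L * X ω)) ∂P) (z : ℕ) :
    negDerivPow z g L = ∫ ω, X ω ^ z * Real.exp (-(L * X ω)) ∂P := by
  have hg' : g =ᶠ[𝓝 L] fun L => mgf X P (-L) :=
    hg.trans (Eventually.of_forall fun L => by simp [mgf])
  -- The reflection `L ↦ -L` contributes a second factor `(-1)^z`, which cancels the one in
  -- `negDerivPow`.
  rw [negDerivPow, hg'.iteratedDeriv_eq, iteratedDeriv_comp_neg,
    iteratedDeriv_mgf (neg_mem_interior_integrableExpSet hX h0 hL), smul_eq_mul, ← mul_assoc,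
    ← mul_pow]
  simp

/-- Only the germ of `g` at `Λ` matters, so `g` need not agree with the Laplace transform away from
`Λ`. -/
theorem integral_gcpProb_eq_probFormula {k : ℕ} (rate : Fin k → ℝ) (hΛ : 0 < totalRate rate)
    (hX : Measurable X) (h0 : ∀ ω, 0 ≤ X ω) {g : ℝ → ℝ}
    (hg : g =ᶠ[𝓝 (totalRate rate)] fun L => ∫ ω, Real.exp (-(L * X ω)) ∂P) (n : ℕ) :
    ∫ ω, gcpProb rate n (X ω) ∂P = probFormula rate n g := by
  simp only [gcpProb_eq, probFormula]
  rw [integral_finsetSum _ fun x _ => (integrable_pow_mul_exp_of_nonneg hX.aemeasurable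
    (ae_of_all _ h0) hΛ _).const_mul _]
  refine Finset.sum_congr rfl fun x _ => ?_
  rw [integral_const_mul, negDerivPow_of_eventuallyEq_laplace hX h0 hΛ hg]

end LaplaceDerivatives

theorem psiGN_eq {lam α β u : ℝ} (hβ : 0 < β) (hu : 0 ≤ u) :
    psiGN lam α β u = lam * (1 - (β / (β + u)) ^ α) := by
  have : 0 < β + u := by linarith
  rw [psiGN, Real.div_rpow hβ.le this.le, Real.rpow_neg hβ.le, Real.rpow_neg this.le]
  have := (Real.rpow_pos_of_pos hβ α).ne'
  field_simp

/-! ### Real-valued conditioning and the state probabilities of the composed process. -/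

section Composition

variable {Ω : Type*} {m0 : MeasurableSpace Ω} {P : Measure Ω} [IsProbabilityMeasure P]
  {α β lam : ℝ} {N : ℝ≥0 → Ω → ℕ} {G : ℝ≥0 → Ω → ℝ≥0} {H : ℝ≥0 → Ω → ℝ≥0∞}

theorem integral_compound_inverse (hlam : 0 < lam) (hN : IsPoissonProcess lam N P)
    (hG : IsGammaProcess α β G P) (hHm : ∀ t, Measurable (H t))
    (hHmono : ∀ ω, Monotone fun t => H t ω)
    (hNG : Indep (processSigma N) (processSigma G) P)
    (hH : Indep (processSigma H) (processSigma N ⊔ processSigma G) P)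
    (hXm : ∀ t, Measurable fun ω => compoundProcess G N (inverseProcess H t ω) ω)
    {u : ℝ≥0 → ℝ} (hu : Measurable u) (hu0 : ∀ x, 0 ≤ u x) {C : ℝ} (huC : ∀ x, u x ≤ C)
    (t : ℝ≥0) :
    ∫ ω, u (compoundProcess G N (inverseProcess H t ω) ω) ∂P =
      ∫ ω, poissonMix lam (fun l => ∫ ω', u (G l ω') ∂P) (inverseProcess H t ω) ∂P := by
  have hi : ∀ l : ℕ, Integrable (fun ω => u (G l ω)) P := fun l =>
    Integrable.of_bound (hu.comp (hG.measurable l)).aestronglyMeasurable C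
      (ae_of_all _ fun ω => by rw [Real.norm_eq_abs, abs_of_nonneg (hu0 _)]; exact huC _)
  have ha0 : ∀ l : ℕ, 0 ≤ ∫ ω', u (G l ω') ∂P := fun l => integral_nonneg fun ω => hu0 _
  have haC : ∀ l : ℕ, |∫ ω', u (G l ω') ∂P| ≤ C := fun l => by
    rw [abs_of_nonneg (ha0 l)]
    simpa using integral_mono (hi l) (integrable_const C) fun ω => huC _
  have hmix : Measurable (poissonMix lam (fun l => ∫ ω', u (G l ω') ∂P)) :=
    (continuous_iff_continuousAt.2 fun s =>
      (hasDerivAt_poissonMix lam haC s).continuousAt).measurable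
  have hY := measurable_inverseProcess hHm hHmono t
  rw [integral_eq_lintegral_of_nonneg_ae (ae_of_all _ fun ω => hu0 _)
      (hu.comp (hXm t)).aestronglyMeasurable,
    integral_eq_lintegral_of_nonneg_ae (ae_of_all _ fun ω => poissonMix_nonneg hlam ha0 (by simp))
      (hmix.comp hY.coe_nnreal_real).aestronglyMeasurable,
    lintegral_compound_inverse hlam hN hG hHm hHmono hNG hH hu.ennreal_ofReal]
  congr 1
  refine lintegral_congr fun ω => ?_
  rw [poissonMix, ← tsum_mul_left, ENNReal.ofReal_tsum_of_nonneg]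
  · refine tsum_congr fun l => ?_
    rw [← ofReal_integral_eq_lintegral_ofReal (hi l) (ae_of_all _ fun ω => hu0 _),
      ← ENNReal.ofReal_mul (by positivity), mul_assoc]
  · intro l
    have := ha0 l
    positivity
  · exact (summable_pow_div_factorial_mul haC _).mul_left _

theorem measurable_compound_inverse {m : MeasurableSpace Ω} (hNm : ∀ t, Measurable (N t))
    (hNmono : ∀ ω, Monotone fun t => N t ω)
    (hNrc : ∀ ω t, ContinuousWithinAt (fun s => N s ω) (Ici t) t) (hGm : ∀ t, Measurable (G t))
    (hGmono : ∀ ω, Monotone fun t => G t ω)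
    (hGrc : ∀ ω t, ContinuousWithinAt (fun s => G s ω) (Ici t) t) (hHm : ∀ t, Measurable (H t))
    (hHmono : ∀ ω, Monotone fun t => H t ω) (t : ℝ≥0) :
    Measurable fun ω => compoundProcess G N (inverseProcess H t ω) ω := by
  have h1 := measurable_uncurry_of_monotone hNm hNmono hNrc
  have h2 := measurable_uncurry_of_monotone hGm hGmono hGrc
  have h3 : Measurable fun n : ℕ => (n : ℝ≥0) := by fun_prop
  have hY := measurable_inverseProcess hHm hHmono t
  exact h2.comp ((h3.comp (h1.comp (hY.prodMk measurable_id))).prodMk measurable_id)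

variable {k : ℕ} {rate : Fin k → ℝ} {M : ℝ≥0 → Ω → ℕ}

/-- The random time is measurable with respect to `(N, G, H)` and hence independent of `M`, so it
can be frozen inside the probability. -/
theorem stateProb_timeChanged (hM : IsGCP rate M P) (hN : IsPoissonProcess lam N P)
    (hG : IsGammaProcess α β G P) (hHm : ∀ t, Measurable (H t))
    (hHmono : ∀ ω, Monotone fun t => H t ω) (hrate : ∀ j, 0 < rate j)
    (hind : Indep (processSigma N ⊔ processSigma G ⊔ processSigma H) (processSigma M) P)
    (n : ℕ) (t : ℝ) :
    stateProb (timeChanged M G N H) P n t =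
      ∫ ω, gcpProb rate n (compoundProcess G N (inverseProcess H t.toNNReal ω) ω) ∂P := by
  have hle : (processSigma N ⊔ processSigma G ⊔ processSigma H) ≤ m0 :=
    sup_le (sup_le (processSigma_le hN.measurable) (processSigma_le hG.measurable)) (processSigma_le hHm)
  set X : Ω → ℝ≥0 := fun ω => compoundProcess G N (inverseProcess H t.toNNReal ω) ω
  have hX : Measurable[processSigma N ⊔ processSigma G ⊔ processSigma H] X :=
    @measurable_compound_inverse Ω N G H
    (processSigma N ⊔ processSigma G ⊔ processSigma H)
    (fun t => (measurable_processSigma N t).mono (le_sup_left.trans le_sup_left) le_rfl)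
    hN.mono hN.right_cont
    (fun t => (measurable_processSigma G t).mono (le_sup_right.trans le_sup_left) le_rfl)
    hG.mono hG.right_cont
    (fun t => (measurable_processSigma H t).mono le_sup_right le_rfl) hHmono _
  have hX0 : Measurable X := hX.mono hle le_rfl
  have hMu := @measurable_uncurry_of_monotone Ω ℕ (processSigma M) _ _ _ _ _ _ M
    (measurable_processSigma M) hM.mono hM.right_cont
  have hF : Measurable[Prod.instMeasurableSpace (m₂ := processSigma M)]
      fun p : ℝ≥0 × Ω => ({n} : Set ℕ).indicator (fun _ => (1 : ℝ≥0∞)) (M p.1 p.2) :=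
    (measurable_of_countable (({n} : Set ℕ).indicator (fun _ => (1 : ℝ≥0∞)))).comp hMu
  have key := lintegral_indep (processSigma_le hM.measurable) hle hind hX hF
  have hMX : MeasurableSet {ω | M (X ω) ω = n} :=
    ((measurable_uncurry_of_monotone hM.measurable hM.mono hM.right_cont).comp
      (hX0.prodMk measurable_id)) (measurableSet_singleton n)
  have hnn : ∀ x : ℝ≥0, 0 ≤ gcpProb rate n x := fun x => gcpProb_nonneg rate hrate n x.2
  have e : ∀ {S : Ω → ℕ}, MeasurableSet {ω | S ω = n} →
      ∫⁻ ω, ({n} : Set ℕ).indicator (fun _ => (1 : ℝ≥0∞)) (S ω) ∂P = P {ω | S ω = n} := by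
    intro S hS
    rw [← lintegral_indicator_one hS]
    exact lintegral_congr fun ω => by simp [indicator]
  have hleft : ∫⁻ ω, ({n} : Set ℕ).indicator (fun _ => (1 : ℝ≥0∞)) (M (X ω) ω) ∂P =
      P {ω | M (X ω) ω = n} := e hMX
  have hright : ∀ ω, ∫⁻ ω', ({n} : Set ℕ).indicator (fun _ => (1 : ℝ≥0∞)) (M (X ω) ω') ∂P =
      ENNReal.ofReal (gcpProb rate n (X ω)) := fun ω => by
    rw [e ((hM.measurable (X ω)) (measurableSet_singleton n)), ← hM.law rate,
      measureReal_def, ENNReal.ofReal_toReal (measure_ne_top _ _)]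
  simp only [hleft, hright] at key
  rw [integral_eq_lintegral_of_nonneg_ae (ae_of_all _ fun ω => hnn _)
    ((continuous_gcpProb rate n).measurable.comp hX0.coe_nnreal_real).aestronglyMeasurable, ← key]
  rfl

end Composition

/-! ### Bernstein functions -/

namespace BernsteinData

variable (D : BernsteinData)

/-- The measure `ν̄` on `(0, ∞)`. -/
noncomputable def levyPos : Measure ℝ := D.levy.restrict (Ioi 0)

theorem lintegral_levyPos_lt_top : ∫⁻ s, ENNReal.ofReal (min s 1) ∂D.levyPos < ∞ :=
  D.lintegral_min_lt_top

/-- Markov's inequality for `s ∧ 1`. -/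
theorem mul_levy_Ioi_le {s : ℝ} (hs : 0 < s) :
    ENNReal.ofReal (min s 1) * D.levy (Ioi s) ≤ ∫⁻ s, ENNReal.ofReal (min s 1) ∂D.levyPos := by
  have h1 : D.levy (Ioi s) = D.levyPos (Ioi s) := by
    rw [levyPos, Measure.restrict_apply measurableSet_Ioi, inter_eq_left.2 (Ioi_subset_Ioi hs.le)]
  rw [h1, ← setLIntegral_const]
  refine (setLIntegral_mono (by fun_prop) fun x hx => ?_).trans (setLIntegral_le_lintegral _ _)
  have : s < x := hx
  exact ENNReal.ofReal_le_ofReal (by gcongr)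

/-- Finiteness guarantees that the real-valued `tail` is the true tail and not the default value `0`
of an infinite measure. -/
theorem levy_Ioi_lt_top {s : ℝ} (hs : 0 < s) : D.levy (Ioi s) < ∞ := by
  by_contra! h
  have h1 := D.mul_levy_Ioi_le hs
  have h2 : ENNReal.ofReal (min s 1) ≠ 0 := by simpa using hs
  rw [top_le_iff.1 h, ENNReal.mul_top h2] at h1
  exact absurd D.lintegral_levyPos_lt_top (not_lt.2 h1)

theorem tail_nonneg (s : ℝ) : 0 ≤ D.tail s := add_nonneg D.a_nonneg measureReal_nonneg

theorem tail_anti {s t : ℝ} (hs : 0 < s) (hst : s ≤ t) : D.tail t ≤ D.tail s := by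
  unfold tail
  gcongr
  exact (D.levy_Ioi_lt_top hs).ne

variable {D}

theorem ConditionI.continuousOn_tail (hD : D.ConditionI) : ContinuousOn D.tail (Ioi 0) := by
  intro s hs
  have hs' : (0 : ℝ) < s := hs
  have h := (hD.2 (s / 2) (s + 1) (by positivity) (by linarith)).continuousOn
  rw [uIcc_of_le (by linarith)] at h
  exact (h.continuousAt (Icc_mem_nhds (by linarith) (by linarith))).continuousWithinAt

variable (D)

/-- The tail `ν` as an extended nonnegative function, extended by `0` to `(-∞, 0]`. -/
noncomputable def etail : ℝ → ℝ≥0∞ := (Ioi 0).indicator fun s => ENNReal.ofReal (D.tail s)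

variable {D}

theorem etail_of_pos {s : ℝ} (hs : 0 < s) : D.etail s = ENNReal.ofReal (D.tail s) :=
  indicator_of_mem (mem_Ioi.2 hs) _

theorem etail_of_nonpos {s : ℝ} (hs : s ≤ 0) : D.etail s = 0 :=
  indicator_of_notMem (by simpa using hs) _

theorem measurable_etail : Measurable D.etail := by
  have hanti : AntitoneOn D.tail (Ioi 0) := fun s hs t _ hst => D.tail_anti hs hst
  have h2 : Antitone fun s : Ioi (0 : ℝ) => D.tail s := fun s t hst => hanti s.2 t.2 hst
  refine measurable_of_restrict_of_restrict_compl measurableSet_Ioi (s := Ioi 0) ?_ ?_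
  · have e : (Ioi (0 : ℝ)).domRestrict D.etail =
        fun s : Ioi (0 : ℝ) => ENNReal.ofReal (D.tail s) := funext fun s => etail_of_pos s.2
    rw [e]
    exact h2.measurable.ennreal_ofReal
  · have e : (Ioi (0 : ℝ))ᶜ.domRestrict D.etail = fun _ => 0 :=
      funext fun s => etail_of_nonpos (by simpa using s.2)
    rw [e]
    exact measurable_const

theorem ConditionI.continuousAt_etail (hD : D.ConditionI) {s : ℝ} (hs : s ≠ 0) :
    ContinuousAt D.etail s := by
  rcases lt_or_gt_of_ne hs with h | h
  · have : D.etail =ᶠ[𝓝 s] fun _ => 0 := by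
      filter_upwards [Iio_mem_nhds h] with x hx
      exact etail_of_nonpos (le_of_lt hx)
    exact continuousAt_const.congr this.symm
  · have : D.etail =ᶠ[𝓝 s] fun x => ENNReal.ofReal (D.tail x) := by
      filter_upwards [Ioi_mem_nhds h] with x hx
      exact etail_of_pos hx
    refine ContinuousAt.congr ?_ this.symm
    exact ENNReal.continuous_ofReal.continuousAt.comp
      (hD.continuousOn_tail.continuousAt (Ioi_mem_nhds h))

theorem one_sub_exp_le {r s : ℝ} (hs : 0 < s) :
    1 - Real.exp (-(r * s)) ≤ max r 1 * min s 1 := by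
  rcases le_total s 1 with h | h
  · rw [min_eq_left h]
    have := Real.add_one_le_exp (-(r * s))
    nlinarith [le_max_left r 1]
  · rw [min_eq_right h]
    have := Real.exp_pos (-(r * s))
    nlinarith [le_max_right r 1]

theorem integrable_one_sub_exp {r : ℝ} (hr : 0 < r) :
    Integrable (fun s => 1 - Real.exp (-(r * s))) D.levyPos := by
  have hpos : ∀ᵐ s ∂D.levyPos, 0 < s := ae_restrict_mem measurableSet_Ioi
  have h1 : Integrable (fun s : ℝ => min s 1) D.levyPos := by
    refine ⟨by fun_prop, ?_⟩
    rw [hasFiniteIntegral_iff_ofReal]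
    · exact D.lintegral_levyPos_lt_top
    · filter_upwards [hpos] with s hs
      exact le_min (le_of_lt hs) zero_le_one
  refine (h1.const_mul (max r 1)).mono' (by fun_prop) ?_
  filter_upwards [hpos] with s hs
  rw [Real.norm_eq_abs, abs_of_nonneg]
  · exact one_sub_exp_le hs
  · have : Real.exp (-(r * s)) ≤ 1 := Real.exp_le_one_iff.2 (by nlinarith)
    linarith

theorem fn_eq (r : ℝ) : D.fn r = D.a + D.b * r + ∫ s, (1 - Real.exp (-(r * s))) ∂D.levyPos := rfl

theorem integral_one_sub_exp_nonneg {r : ℝ} (hr : 0 < r) :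
    0 ≤ᵐ[D.levyPos] fun s => 1 - Real.exp (-(r * s)) := by
  filter_upwards [ae_restrict_mem (μ := D.levy) (measurableSet_Ioi (a := (0 : ℝ)))] with s hs
  have hs' : (0 : ℝ) < s := hs
  have : Real.exp (-(r * s)) ≤ 1 := Real.exp_le_one_iff.2 (by nlinarith)
  simpa using this

/-- Infinite mass of `ν̄` on `(0, ∞)` makes the integral part strictly positive even when `a = b =
0`. -/
theorem ConditionI.fn_pos (hD : D.ConditionI) {r : ℝ} (hr : 0 < r) : 0 < D.fn r := by
  have h1 : 0 < ∫ s, (1 - Real.exp (-(r * s))) ∂D.levyPos := by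
    rw [integral_pos_iff_support_of_nonneg_ae (integral_one_sub_exp_nonneg hr)
      (integrable_one_sub_exp hr)]
    have : D.levyPos (Ioi 0) ≠ 0 := by
      rw [levyPos, Measure.restrict_apply_self, hD.1]
      simp
    refine (pos_iff_ne_zero.2 this).trans_le (measure_mono fun s hs => ?_)
    have hs' : (0 : ℝ) < s := hs
    have : Real.exp (-(r * s)) < 1 := Real.exp_lt_one_iff.2 (by nlinarith)
    exact (sub_pos.2 this).ne'
  rw [fn_eq]
  have := D.a_nonneg
  have := D.b_nonneg
  positivity

theorem fn_nonneg {r : ℝ} (hr : 0 < r) : 0 ≤ D.fn r := by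
  rw [fn_eq]
  have := D.a_nonneg
  have := D.b_nonneg
  have := integral_nonneg_of_ae (integral_one_sub_exp_nonneg (D := D) hr)
  positivity

theorem lintegral_exp_neg_Ioi {r : ℝ} (hr : 0 < r) :
    ∫⁻ s in Ioi (0 : ℝ), ENNReal.ofReal (Real.exp (-(r * s))) = ENNReal.ofReal (1 / r) := by
  have h := integral_exp_mul_Ioi (neg_lt_zero.2 hr) 0
  have hi := integrableOn_exp_mul_Ioi (neg_lt_zero.2 hr) 0
  simp only [neg_mul] at h hi
  rw [← ofReal_integral_eq_lintegral_ofReal hi (ae_of_all _ fun s => (Real.exp_pos _).le), h]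
  simp

/-- The Laplace transform of the tail is `(f(r) - b r) / r`. -/
theorem lintegral_exp_mul_etail {r : ℝ} (hr : 0 < r) :
    ∫⁻ s, ENNReal.ofReal (Real.exp (-(r * s))) * D.etail s =
      ENNReal.ofReal ((D.fn r - D.b * r) / r) := by
  have h0 : ∀ s, ENNReal.ofReal (Real.exp (-(r * s))) * D.etail s = (Ioi (0 : ℝ)).indicator
      (fun s => ENNReal.ofReal (D.a) * ENNReal.ofReal (Real.exp (-(r * s))) +
        D.levyPos {x | s < x} * ENNReal.ofReal (Real.exp (-(r * s)))) s := by
    intro s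
    rcases le_or_gt s 0 with hs | hs
    · rw [etail_of_nonpos hs, indicator_of_notMem (by simpa using hs), mul_zero]
    · have h1 : D.levyPos {x | s < x} = D.levy (Ioi s) := by
        refine (Measure.restrict_apply measurableSet_Ioi).trans ?_
        exact congrArg _ (inter_eq_left.2 (Ioi_subset_Ioi hs.le))
      rw [etail_of_pos hs, indicator_of_mem (mem_Ioi.2 hs), tail,
        ENNReal.ofReal_add D.a_nonneg measureReal_nonneg, measureReal_def,
        ENNReal.ofReal_toReal (D.levy_Ioi_lt_top hs).ne, h1]
      ring
  simp_rw [h0]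
  rw [lintegral_indicator measurableSet_Ioi, lintegral_add_left (by fun_prop),
    lintegral_const_mul _ (by fun_prop), lintegral_exp_neg_Ioi hr]
  -- Layer cake formula: `∫ e^{-rs} ν̄(s, ∞) ds` is the `ν̄`-integral of the primitive `(1 -
  -- e^{-rx}) / r`.
  have hlayer := lintegral_comp_eq_lintegral_meas_lt_mul D.levyPos (f := fun x => x)
    (g := fun s => Real.exp (-(r * s)))
    (by filter_upwards [ae_restrict_mem (μ := D.levy) (measurableSet_Ioi (a := (0 : ℝ)))] with s hs
        using le_of_lt hs) aemeasurable_id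
    (fun t _ => Continuous.intervalIntegrable (by fun_prop) _ _)
    (ae_of_all _ fun t => (Real.exp_pos _).le)
  have hint : ∀ x : ℝ, ∫ s in (0 : ℝ)..x, Real.exp (-(r * s)) =
      1 / r * (1 - Real.exp (-(r * x))) := by
    intro x
    rw [intervalIntegral.integral_eq_sub_of_hasDerivAt
      (f := fun s => -(1 / r) * Real.exp (-(r * s)))]
    · simp; ring
    · intro s _
      have h2 : HasDerivAt (fun s => -(r * s)) (-r) s := by
        simpa using! ((hasDerivAt_id s).const_mul r).neg
      refine (h2.exp.const_mul (-(1 / r))).congr_deriv ?_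
      field_simp
    · exact Continuous.intervalIntegrable (by fun_prop) _ _
  rw [← hlayer]
  simp_rw [hint]
  rw [← ofReal_integral_eq_lintegral_ofReal ((integrable_one_sub_exp hr).const_mul _)
      (by filter_upwards [integral_one_sub_exp_nonneg (D := D) hr] with s hs
          exact mul_nonneg (by positivity) hs),
    integral_const_mul, ← ENNReal.ofReal_mul D.a_nonneg, ← ENNReal.ofReal_add
      (mul_nonneg D.a_nonneg (by positivity))
      (mul_nonneg (by positivity) (integral_nonneg_of_ae (integral_one_sub_exp_nonneg hr))), fn_eq]
  congr 1
  field_simp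
  ring

/-- The finite measure `(1 - e^{-s}) ν̄(ds)`. -/
noncomputable def temperedLevy (D : BernsteinData) : Measure ℝ :=
  D.levyPos.withDensity fun s => ENNReal.ofReal (1 - Real.exp (-s))

theorem ae_nonneg_temperedLevy : ∀ᵐ s ∂D.temperedLevy, 0 ≤ s := by
  refine (withDensity_absolutelyContinuous _ _).ae_le ?_
  filter_upwards [ae_restrict_mem (μ := D.levy) (measurableSet_Ioi (a := (0 : ℝ)))] with s hs
  exact le_of_lt hs

instance : IsFiniteMeasure D.temperedLevy := by
  refine isFiniteMeasure_withDensity_ofReal ?_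
  simpa using (integrable_one_sub_exp (D := D) one_pos).2

/-- `(1 - e^{-s}) e^{-rs}` is the difference of the integrands of `f(r+1)` and `f(r)`; the constant
`a` cancels and there is no drift. -/
theorem laplaceT_temperedLevy (hb : D.b = 0) {r : ℝ} (hr : 0 < r) :
    laplaceT D.temperedLevy r = ENNReal.ofReal (D.fn (r + 1) - D.fn r) := by
  rw [laplaceT, temperedLevy, lintegral_withDensity_eq_lintegral_mul _ (by fun_prop) (by fun_prop)]
  have h1 := integrable_one_sub_exp (D := D) hr
  have h2 := integrable_one_sub_exp (D := D) (by linarith : 0 < r + 1)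
  have e : D.fn (r + 1) - D.fn r =
      ∫ s, ((1 - Real.exp (-((r + 1) * s))) - (1 - Real.exp (-(r * s)))) ∂D.levyPos := by
    rw [integral_sub h2 h1, fn_eq, fn_eq, hb]
    ring
  have e2 : ∀ s, (1 - Real.exp (-((r + 1) * s))) - (1 - Real.exp (-(r * s))) =
      (1 - Real.exp (-s)) * Real.exp (-(r * s)) := by
    intro s
    have : Real.exp (-((r + 1) * s)) = Real.exp (-s) * Real.exp (-(r * s)) := by
      rw [← Real.exp_add]; ring_nf
    rw [this]; ring
  have h3 : Integrable (fun s => (1 - Real.exp (-((r + 1) * s))) - (1 - Real.exp (-(r * s))))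
      D.levyPos := h2.sub h1
  rw [e, ofReal_integral_eq_lintegral_ofReal h3]
  · refine lintegral_congr fun s => ?_
    rw [e2, ENNReal.ofReal_mul' (Real.exp_pos _).le]
    rfl
  · filter_upwards [ae_restrict_mem (μ := D.levy) (measurableSet_Ioi (a := (0 : ℝ)))] with s hs
    have hs' : (0 : ℝ) < s := hs
    have : Real.exp (-s) ≤ 1 := Real.exp_le_one_iff.2 (by linarith)
    rw [e2]
    exact mul_nonneg (by linarith) (Real.exp_pos _).le

/-- `(1 - e^{-s}) ν(s)` is bounded. -/
theorem exists_one_sub_exp_mul_tail_le (D : BernsteinData) :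
    ∃ C, 0 ≤ C ∧ ∀ s, 0 < s → (1 - Real.exp (-s)) * D.tail s ≤ C := by
  set I := (∫⁻ s, ENNReal.ofReal (min s 1) ∂D.levyPos).toReal
  refine ⟨D.a + I, add_nonneg D.a_nonneg ENNReal.toReal_nonneg, fun s hs => ?_⟩
  have h1 : min s 1 * D.levy.real (Ioi s) ≤ I := by
    have := ENNReal.toReal_mono D.lintegral_levyPos_lt_top.ne (D.mul_levy_Ioi_le hs)
    rwa [ENNReal.toReal_mul, ENNReal.toReal_ofReal (by positivity)] at this
  have h2 : 1 - Real.exp (-s) ≤ min s 1 := by simpa using one_sub_exp_le (r := 1) hs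
  have h3 : 1 - Real.exp (-s) ≤ 1 := h2.trans (min_le_right _ _)
  have h4 : 0 ≤ D.levy.real (Ioi s) := measureReal_nonneg
  have := D.a_nonneg
  rw [tail, mul_add]
  nlinarith

/-- Since `ν̄(0, ∞) = ∞`, the tail explodes at `0`. This is what forbids an atom of the resolvent at
the origin. -/
theorem ConditionI.exists_lt_tail (hD : D.ConditionI) (C : ℝ) : ∃ δ > 0, ∀ s, 0 < s → s ≤ δ →
    C < D.tail s := by
  have hU : (⋃ n : ℕ, Ioi (1 / ((n : ℝ) + 1))) = Ioi 0 := by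
    ext x
    simp only [mem_iUnion, mem_Ioi]
    exact ⟨fun ⟨n, hn⟩ => lt_trans (by positivity) hn, fun hx => exists_nat_one_div_lt hx⟩
  have hm : Monotone fun n : ℕ => Ioi (1 / ((n : ℝ) + 1)) := fun n m hnm =>
    Ioi_subset_Ioi (one_div_le_one_div_of_le (by positivity) (by gcongr))
  have ht := tendsto_measure_iUnion_atTop (μ := D.levy) hm
  rw [hU, hD.1] at ht
  obtain ⟨n, hn⟩ := (ht.eventually (eventually_gt_nhds
    (show ENNReal.ofReal C < ∞ by simp))).exists
  refine ⟨1 / ((n : ℝ) + 1), by positivity, fun s hs hsn => ?_⟩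
  refine lt_of_lt_of_le ?_ (D.tail_anti hs hsn)
  have h1 : C < D.levy.real (Ioi (1 / ((n : ℝ) + 1))) := by
    rw [measureReal_def]
    by_contra! h
    exact absurd hn (not_lt.2 (ENNReal.le_ofReal_iff_toReal_le
      (D.levy_Ioi_lt_top (by positivity)).ne (ENNReal.toReal_nonneg.trans h) |>.2 h))
  rw [tail]
  linarith [D.a_nonneg]

theorem levy_Ioc {x y : ℝ} (hx : 0 < x) (hxy : x ≤ y) :
    D.levy (Ioc x y) = ENNReal.ofReal (D.tail x - D.tail y) := by
  have h1 : Ioc x y = Ioi x \ Ioi y := by ext; simp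
  have hy := D.levy_Ioi_lt_top (hx.trans_le hxy)
  rw [h1, measure_sdiff (Ioi_subset_Ioi hxy) measurableSet_Ioi.nullMeasurableSet hy.ne, tail, tail,
    add_sub_add_left_eq_sub, ENNReal.ofReal_sub _ measureReal_nonneg, measureReal_def,
    measureReal_def, ENNReal.ofReal_toReal hy.ne, ENNReal.ofReal_toReal (D.levy_Ioi_lt_top hx).ne]

/-- The fundamental theorem of calculus for the absolutely continuous tail identifies both measures
on half-open intervals; `-ν'` is the Lévy density. -/
theorem ConditionI.levy_restrict_Ioc (hD : D.ConditionI) {c d : ℝ} (hc : 0 < c) (hcd : c ≤ d) :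
    D.levy.restrict (Ioc c d) =
      (volume.restrict (Ioc c d)).withDensity fun s => ENNReal.ofReal (-deriv D.tail s) := by
  have hfin : IsFiniteMeasure (D.levy.restrict (Ioc c d)) :=
    ⟨by rw [Measure.restrict_apply_univ, levy_Ioc hc hcd]; exact ENNReal.ofReal_lt_top⟩
  refine Measure.ext_of_Ioc _ _ fun x y _ => ?_
  rw [withDensity_apply _ measurableSet_Ioc, Measure.restrict_apply measurableSet_Ioc,
    Measure.restrict_restrict measurableSet_Ioc, Ioc_inter_Ioc]
  set x' := x ⊔ c
  set y' := y ⊓ d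
  rcases le_or_gt x' y' with h | h
  swap
  · simp [Ioc_eq_empty_of_le h.le]
  have hx' : 0 < x' := hc.trans_le le_sup_right
  have hac := hD.2 x' y' hx' h
  have hnn : ∀ᵐ s ∂volume.restrict (Ioc x' y'), 0 ≤ -deriv D.tail s := by
    filter_upwards [ae_restrict_mem measurableSet_Ioc] with s hs
    have hanti : AntitoneOn D.tail (Ioi 0) := fun s hs t _ hst => D.tail_anti hs hst
    have := hanti.derivWithin_nonpos (x := s)
    rw [derivWithin_of_mem_nhds (Ioi_mem_nhds (hx'.trans hs.1))] at this
    linarith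
  have hi : IntegrableOn (fun s => -deriv D.tail s) (Ioc x' y') :=
    ((intervalIntegrable_iff_integrableOn_Ioc_of_le h).1 hac.intervalIntegrable_deriv).neg
  rw [levy_Ioc hx' h, ← ofReal_integral_eq_lintegral_ofReal hi hnn, integral_neg,
    ← intervalIntegral.integral_of_le h, hac.integral_deriv_eq_sub, neg_sub]

/-- If the tail is locally absolutely continuous, then so is the Lévy measure. -/
theorem ConditionI.levyPos_absolutelyContinuous (hD : D.ConditionI) : D.levyPos ≪ volume := by
  refine Measure.AbsolutelyContinuous.mk fun s hs h0 => ?_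
  have hU : s ∩ Ioi 0 ⊆ ⋃ n : ℕ, s ∩ Ioc (1 / ((n : ℝ) + 1)) (n + 2) := by
    rintro x ⟨hxs, hx⟩
    obtain ⟨n, hn⟩ := exists_nat_one_div_lt (show (0 : ℝ) < x from hx)
    obtain ⟨m, hm⟩ := exists_nat_ge x
    refine mem_iUnion.2 ⟨max n m, hxs, lt_of_le_of_lt ?_ hn, hm.trans ?_⟩
    · refine one_div_le_one_div_of_le (by positivity) ?_
      push_cast
      gcongr
      exact le_max_left _ _
    · push_cast
      linarith [le_max_right (n : ℝ) m]
  rw [levyPos, Measure.restrict_apply hs]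
  refine measure_mono_null hU (measure_iUnion_null fun n => ?_)
  have hle : 1 / ((n : ℝ) + 1) ≤ n + 2 := by
    rw [div_le_iff₀ (by positivity)]
    have : (0 : ℝ) ≤ n := by positivity
    nlinarith
  rw [← Measure.restrict_apply hs, hD.levy_restrict_Ioc (by positivity) hle]
  exact withDensity_absolutelyContinuous _ _
    (Measure.absolutelyContinuous_of_le Measure.restrict_le_self h0)

end BernsteinData

/-! ### Convolution with the tail -/

/-- The restriction of `p` to `(0, ∞)`, as an extended nonnegative function. -/
noncomputable def posPart (p : ℝ → ℝ) : ℝ → ℝ≥0∞ := (Ioi 0).indicator fun t => ENNReal.ofReal (p t)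

theorem posPart_of_pos (p : ℝ → ℝ) {t : ℝ} (ht : 0 < t) : posPart p t = ENNReal.ofReal (p t) :=
  indicator_of_mem (mem_Ioi.2 ht) _

theorem posPart_of_nonpos (p : ℝ → ℝ) {t : ℝ} (ht : t ≤ 0) : posPart p t = 0 :=
  indicator_of_notMem (by simpa using ht) _

theorem measurable_posPart {p : ℝ → ℝ} (hp : ContinuousOn p (Ioi 0)) : Measurable (posPart p) := by
  refine measurable_of_restrict_of_restrict_compl measurableSet_Ioi (s := Ioi 0) ?_ ?_
  · have e : (Ioi (0 : ℝ)).domRestrict (posPart p) =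
        fun s : Ioi (0 : ℝ) => ENNReal.ofReal (p s) := funext fun s => posPart_of_pos p s.2
    rw [e]
    exact (continuousOn_iff_continuous_domRestrict.1 hp).measurable.ennreal_ofReal
  · have e : (Ioi (0 : ℝ))ᶜ.domRestrict (posPart p) = fun _ => 0 :=
      funext fun s => posPart_of_nonpos p (by simpa using s.2)
    rw [e]
    exact measurable_const

theorem continuousAt_posPart {p : ℝ → ℝ} (hp : ContinuousOn p (Ioi 0)) {t : ℝ} (ht : t ≠ 0) :
    ContinuousAt (posPart p) t := by
  rcases lt_or_gt_of_ne ht with h | h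
  · have : posPart p =ᶠ[𝓝 t] fun _ => 0 := by
      filter_upwards [Iio_mem_nhds h] with x hx
      exact posPart_of_nonpos p (le_of_lt hx)
    exact continuousAt_const.congr this.symm
  · have : posPart p =ᶠ[𝓝 t] fun x => ENNReal.ofReal (p x) := by
      filter_upwards [Ioi_mem_nhds h] with x hx
      exact posPart_of_pos p hx
    refine ContinuousAt.congr ?_ this.symm
    exact ENNReal.continuous_ofReal.continuousAt.comp (hp.continuousAt (Ioi_mem_nhds h))

/-- The convolution `∫ g(t - y) U(dy)`. -/
noncomputable def convM (g : ℝ → ℝ≥0∞) (U : Measure ℝ) (t : ℝ) : ℝ≥0∞ := ∫⁻ y, g (t - y) ∂U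

theorem measurable_convM {g : ℝ → ℝ≥0∞} (hg : Measurable g) (U : Measure ℝ) [SFinite U] :
    Measurable (convM g U) :=
  Measurable.lintegral_prod_right' (f := fun p : ℝ × ℝ => g (p.1 - p.2)) (by fun_prop)

theorem convM_of_nonpos {g : ℝ → ℝ≥0∞} (hg : ∀ s, s ≤ 0 → g s = 0) {U : Measure ℝ}
    (hU : ∀ᵐ y ∂U, 0 ≤ y) {t : ℝ} (ht : t ≤ 0) : convM g U t = 0 := by
  rw [convM, lintegral_congr_ae (g := fun _ => 0), lintegral_zero]
  filter_upwards [hU] with y hy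
  exact hg _ (by linarith)

/-- Continuity of the convolution of a bounded function, continuous off `0`, with a finite measure
without atoms. -/
theorem continuousAt_convM {g : ℝ → ℝ≥0∞} (hg : Measurable g) {C : ℝ≥0∞} (hC : C ≠ ∞)
    (hgC : ∀ s, g s ≤ C) (hgc : ∀ s, s ≠ 0 → ContinuousAt g s) {U : Measure ℝ} [IsFiniteMeasure U]
    {t : ℝ} (hU : U {t} = 0) : ContinuousAt (convM g U) t := by
  refine tendsto_lintegral_filter_of_dominated_convergence (fun _ => C)
    (Eventually.of_forall fun s => by fun_prop)
    (Eventually.of_forall fun s => ae_of_all _ fun y => hgC _) ?_ ?_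
  · rw [lintegral_const]
    exact ENNReal.mul_ne_top hC (measure_ne_top _ _)
  · have : ∀ᵐ y ∂U, y ≠ t := by
      rw [ae_iff]
      simpa using hU
    filter_upwards [this] with y hy
    have h1 : ContinuousAt g (t - y) := hgc _ (sub_ne_zero.2 hy.symm)
    exact h1.tendsto.comp (tendsto_id.sub_const y)

/-- Tonelli and translation invariance of Lebesgue measure: convolution becomes a product. -/
theorem laplaceT_convM {g : ℝ → ℝ≥0∞} (hg : Measurable g) (U : Measure ℝ) [SFinite U] (r : ℝ) :
    laplaceT (volume.withDensity (convM g U)) r =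
      (∫⁻ s, ENNReal.ofReal (Real.exp (-(r * s))) * g s) * laplaceT U r := by
  rw [laplaceT, lintegral_withDensity_eq_lintegral_mul _ (measurable_convM hg U) (by fun_prop)]
  have h1 : ∀ t, (convM g U * fun t => ENNReal.ofReal (Real.exp (-(r * t)))) t =
      ∫⁻ y, ENNReal.ofReal (Real.exp (-(r * t))) * g (t - y) ∂U := by
    intro t
    rw [lintegral_const_mul _ (by fun_prop), mul_comm]
    rfl
  simp_rw [h1]
  rw [lintegral_lintegral_swap (by fun_prop), laplaceT, ← lintegral_const_mul _ (by fun_prop)]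
  refine lintegral_congr fun y => ?_
  rw [← lintegral_add_right_eq_self _ y, mul_comm, ← lintegral_const_mul _ (by fun_prop)]
  refine lintegral_congr fun s => ?_
  rw [add_sub_cancel_right, ← mul_assoc, ← ENNReal.ofReal_mul (Real.exp_pos _).le, ← Real.exp_add]
  ring_nf

theorem laplaceT_add (μ ν : Measure ℝ) (r : ℝ) :
    laplaceT (μ + ν) r = laplaceT μ r + laplaceT ν r := lintegral_add_measure _ _ _

theorem laplaceT_smul (c : ℝ≥0∞) (μ : Measure ℝ) (r : ℝ) :
    laplaceT (c • μ) r = c * laplaceT μ r := lintegral_smul_measure _ _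

theorem laplaceT_withDensity {w : ℝ → ℝ≥0∞} (hw : Measurable w) (μ : Measure ℝ) (r : ℝ) :
    laplaceT (μ.withDensity w) r = ∫⁻ s, ENNReal.ofReal (Real.exp (-(r * s))) * w s ∂μ := by
  rw [laplaceT, lintegral_withDensity_eq_lintegral_mul _ hw (by fun_prop)]
  exact lintegral_congr fun s => mul_comm _ _

theorem laplaceT_conv (μ ν : Measure ℝ) [SFinite μ] [SFinite ν] (r : ℝ) :
    laplaceT (μ ∗ ν) r = laplaceT μ r * laplaceT ν r := by
  rw [laplaceT, Measure.lintegral_conv (by fun_prop)]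
  simp_rw [mul_add, neg_add, Real.exp_add, ENNReal.ofReal_mul (Real.exp_pos _).le]
  simp_rw [lintegral_const_mul _ (measurable_expKernel r)]
  rw [lintegral_mul_const _ (measurable_expKernel r)]
  rfl

theorem laplaceT_ne_top {U : Measure ℝ} [IsFiniteMeasure U] (hU : ∀ᵐ y ∂U, 0 ≤ y) {r : ℝ}
    (hr : 0 < r) : laplaceT U r ≠ ∞ := by
  refine ne_top_of_le_ne_top (measure_ne_top U univ) ?_
  rw [← lintegral_one]
  refine lintegral_mono_ae ?_
  filter_upwards [hU] with y hy
  exact ENNReal.ofReal_le_one.2 (Real.exp_le_one_iff.2 (by nlinarith))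

namespace BernsteinData

variable {D : BernsteinData}

theorem tail_laplace_nonneg {r : ℝ} (hr : 0 < r) : 0 ≤ D.fn r - D.b * r := by
  rw [fn_eq]
  have := D.a_nonneg
  have := integral_nonneg_of_ae (integral_one_sub_exp_nonneg (D := D) hr)
  linarith

/-- `b U(dt) + (∫ ν(t - y) U(dy)) dt = p(t) dt`, if the Laplace transforms agree. -/
theorem smul_add_withDensity_convM {U : Measure ℝ} [IsFiniteMeasure U] (hU : ∀ᵐ y ∂U, 0 ≤ y)
    {p : ℝ → ℝ} (hp : Measurable (posPart p))
    (hLT : ∀ r, 0 < r → ENNReal.ofReal (D.fn r) * laplaceT U r =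
      ENNReal.ofReal r * ∫⁻ t, ENNReal.ofReal (Real.exp (-(r * t))) * posPart p t) :
    ENNReal.ofReal D.b • U + volume.withDensity (convM D.etail U) =
      volume.withDensity (posPart p) := by
  have hmh := measurable_convM (measurable_etail (D := D)) U
  -- The tail has Laplace transform `(f(r) - b r) / r`; adding the drift `b` leaves exactly `f(r) /
  -- r`.
  have key : ∀ r : ℝ, 0 < r →
      laplaceT (ENNReal.ofReal D.b • U + volume.withDensity (convM D.etail U)) r =
        ENNReal.ofReal (D.fn r / r) * laplaceT U r := by
    intro r hr
    rw [laplaceT_add, laplaceT_smul, laplaceT_convM measurable_etail, lintegral_exp_mul_etail hr,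
      ← add_mul, ← ENNReal.ofReal_add D.b_nonneg (div_nonneg (tail_laplace_nonneg hr) hr.le)]
    congr 2
    field_simp
    ring
  refine ext_of_laplaceT ?_ ?_ (fun r hr => ?_) fun r hr => ?_
  · rw [ae_add_measure_iff]
    refine ⟨Measure.ae_smul_measure hU _, ?_⟩
    rw [ae_withDensity_iff hmh]
    refine ae_of_all _ fun t ht => ?_
    by_contra! h
    exact ht (convM_of_nonpos (fun s hs => etail_of_nonpos hs) hU h.le)
  · rw [ae_withDensity_iff hp]
    refine ae_of_all _ fun t ht => ?_
    by_contra! h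
    exact ht (posPart_of_nonpos p h.le)
  · rw [key r hr]
    exact ENNReal.mul_ne_top ENNReal.ofReal_ne_top (laplaceT_ne_top hU hr)
  · rw [key r hr, laplaceT_withDensity hp]
    have h0 : ENNReal.ofReal r ≠ 0 := by simpa using hr
    rw [← (ENNReal.mul_right_inj h0 ENNReal.ofReal_ne_top), ← hLT r hr, ← mul_assoc,
      ← ENNReal.ofReal_mul hr.le]
    congr 2
    field_simp

end BernsteinData

/-! ### The resolvent of a driftless subordinator -/

namespace BernsteinData

variable {D : BernsteinData}

/-- Without drift the identity compares two measures with densities, so the densities agree almost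
everywhere, and at this stage only so. -/
theorem convM_ae_eq {U : Measure ℝ} [IsFiniteMeasure U] (hb : D.b = 0) (hU : ∀ᵐ y ∂U, 0 ≤ y)
    {p : ℝ → ℝ} (hp : Measurable (posPart p))
    (hLT : ∀ r, 0 < r → ENNReal.ofReal (D.fn r) * laplaceT U r =
      ENNReal.ofReal r * ∫⁻ t, ENNReal.ofReal (Real.exp (-(r * t))) * posPart p t) :
    convM D.etail U =ᵐ[volume] posPart p := by
  have h := smul_add_withDensity_convM hU hp hLT
  rw [hb, ENNReal.ofReal_zero, zero_smul, zero_add] at h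
  exact (withDensity_eq_iff_of_sigmaFinite
    (measurable_convM measurable_etail U).aemeasurable hp.aemeasurable).1 h

/-- The weight `e^{-y}`. -/
noncomputable def expWeight (y : ℝ) : ℝ≥0∞ := ENNReal.ofReal (Real.exp (-y))

theorem continuous_expWeight : Continuous expWeight :=
  ENNReal.continuous_ofReal.comp (by fun_prop)

theorem measurable_expWeight : Measurable expWeight := continuous_expWeight.measurable

/-- The weight `1 - e^{-y}`. -/
noncomputable def coexpWeight (y : ℝ) : ℝ≥0∞ := ENNReal.ofReal (1 - Real.exp (-y))

theorem continuous_coexpWeight : Continuous coexpWeight :=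
  ENNReal.continuous_ofReal.comp (by fun_prop)

theorem measurable_coexpWeight : Measurable coexpWeight := continuous_coexpWeight.measurable

theorem expWeight_add (x y : ℝ) : expWeight (x + y) = expWeight x * expWeight y := by
  rw [expWeight, neg_add, Real.exp_add, ENNReal.ofReal_mul (Real.exp_pos _).le]
  rfl

theorem coexpWeight_add {x y : ℝ} (hx : 0 ≤ x) (hy : 0 ≤ y) :
    coexpWeight (x + y) = coexpWeight x + expWeight x * coexpWeight y := by
  have h1 : Real.exp (-x) ≤ 1 := Real.exp_le_one_iff.2 (by linarith)
  have h2 : Real.exp (-y) ≤ 1 := Real.exp_le_one_iff.2 (by linarith)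
  have h3 := Real.exp_pos (-x)
  rw [coexpWeight, coexpWeight, coexpWeight, expWeight, ← ENNReal.ofReal_mul h3.le,
    ← ENNReal.ofReal_add (by linarith) (mul_nonneg h3.le (by linarith)), neg_add, Real.exp_add]
  congr 1
  ring

theorem isFiniteMeasure_withDensity_expWeight {U : Measure ℝ} [IsFiniteMeasure U]
    (hU : ∀ᵐ y ∂U, 0 ≤ y) : IsFiniteMeasure (U.withDensity expWeight) := by
  refine isFiniteMeasure_withDensity (ne_top_of_le_ne_top (measure_ne_top U univ) ?_)
  rw [← lintegral_one]
  refine lintegral_mono_ae ?_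
  filter_upwards [hU] with y hy
  exact ENNReal.ofReal_le_one.2 (Real.exp_le_one_iff.2 (by linarith))

/-- `(1 - e^{-y}) U(dy)` is the convolution of `e^{-y} U(dy)`, `U` and `(1 - e^{-s}) ν̄(ds)`. -/
theorem resolvent_withDensity_coexpWeight (hD : D.ConditionI) (hb : D.b = 0) {U : Measure ℝ}
    [IsFiniteMeasure U] (hU : ∀ᵐ y ∂U, 0 ≤ y) {μ : ℝ} (hμ : 0 < μ)
    (hLap : ∀ r, 0 < r → laplaceT U r = ENNReal.ofReal (1 / (μ + D.fn r))) :
    U.withDensity coexpWeight = (U ∗ D.temperedLevy) ∗ U.withDensity expWeight := by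
  have hfE := isFiniteMeasure_withDensity_expWeight hU
  have hE : ∀ r, laplaceT (U.withDensity expWeight) r = laplaceT U (r + 1) := by
    intro r
    rw [laplaceT_withDensity measurable_expWeight]
    refine lintegral_congr fun s => ?_
    rw [expWeight, ← ENNReal.ofReal_mul (Real.exp_pos _).le, ← Real.exp_add]
    ring_nf
  have hsum : ∀ r, 0 < r → laplaceT (U.withDensity coexpWeight) r + laplaceT U (r + 1) =
      laplaceT U r := by
    intro r _
    rw [← hE, laplaceT_withDensity measurable_expWeight,
      laplaceT_withDensity measurable_coexpWeight,
      ← lintegral_add_left (by have := measurable_coexpWeight; fun_prop)]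
    refine lintegral_congr_ae ?_
    filter_upwards [hU] with s hs
    rw [← mul_add, coexpWeight, expWeight, ← ENNReal.ofReal_add _ (Real.exp_pos _).le,
      sub_add_cancel, ENNReal.ofReal_one, mul_one]
    have : Real.exp (-s) ≤ 1 := Real.exp_le_one_iff.2 (by linarith)
    linarith
  have hLconv : ∀ r, 0 < r → laplaceT ((U ∗ D.temperedLevy) ∗ U.withDensity expWeight) r =
      laplaceT U r * ENNReal.ofReal (D.fn (r + 1) - D.fn r) * laplaceT U (r + 1) := by
    intro r hr
    rw [laplaceT_conv, laplaceT_conv, hE, laplaceT_temperedLevy hb hr]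
  have hmono : ∀ r, 0 < r → D.fn r ≤ D.fn (r + 1) := by
    intro r hr
    rw [fn_eq, fn_eq, hb, zero_mul, zero_mul]
    refine add_le_add_right (integral_mono_ae (integrable_one_sub_exp hr)
      (integrable_one_sub_exp (by linarith)) ?_) _
    filter_upwards [ae_restrict_mem (μ := D.levy) (measurableSet_Ioi (a := (0 : ℝ)))] with s hs
    have hs' : (0 : ℝ) < s := hs
    simp only [sub_le_sub_iff_left, Real.exp_le_exp]
    nlinarith
  have ae0 : ∀ᵐ y ∂(U.withDensity expWeight), 0 ≤ y :=
    (withDensity_absolutelyContinuous _ _).ae_le hU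
  have aeconv : ∀ {μ ν : Measure ℝ} [SFinite μ] [SFinite ν], (∀ᵐ y ∂μ, 0 ≤ y) →
      (∀ᵐ y ∂ν, 0 ≤ y) → ∀ᵐ y ∂(μ ∗ ν), 0 ≤ y := by
    intro μ ν _ _ h1 h2
    rw [Measure.conv, ae_map_iff (by fun_prop) measurableSet_Ici]
    filter_upwards [Measure.quasiMeasurePreserving_fst.ae h1,
      Measure.quasiMeasurePreserving_snd.ae h2] with x hx hy
    exact add_nonneg hx hy
  refine ext_of_laplaceT ((withDensity_absolutelyContinuous _ _).ae_le hU)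
    (aeconv (aeconv hU ae_nonneg_temperedLevy) ae0) (fun r hr => ?_) fun r hr => ?_
  · refine ne_top_of_le_ne_top (laplaceT_ne_top hU hr) ?_
    rw [← hsum r hr]
    exact le_self_add
  · have hr1 : 0 < r + 1 := by linarith
    have h1 := hD.fn_pos hr
    have h2 := hD.fn_pos hr1
    -- This is the resolvent equation `1/(μ+f(r)) - 1/(μ+f(r+1)) = (f(r+1)-f(r)) /
    -- ((μ+f(r))(μ+f(r+1)))`, with the finite transform at `r + 1` added to both sides to avoid
    -- subtraction in `ℝ≥0∞`.
    rw [hLconv r hr, ← ENNReal.add_left_inj (laplaceT_ne_top hU hr1), hsum r hr, hLap r hr,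
      hLap _ hr1, ← ENNReal.ofReal_mul (by positivity),
      ← ENNReal.ofReal_mul (mul_nonneg (by positivity) (sub_nonneg.2 (hmono r hr))),
      ← ENNReal.ofReal_add (mul_nonneg (mul_nonneg (by positivity) (sub_nonneg.2 (hmono r hr)))
        (by positivity)) (by positivity)]
    congr 1
    field_simp
    ring

/-- Away from `0`, the convolution formula for `(1 - e^{-y}) U(dy)` has the factor `(1 - e^{-s})
ν̄(ds)`, which has a density. An atom at `0` would give `ν(t) U{0} ≤ p(t) ≤ 1` for almost every
small `t`, against the explosion of the tail. -/
theorem resolvent_absolutelyContinuous (hD : D.ConditionI) (hb : D.b = 0) {U : Measure ℝ}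
    [IsFiniteMeasure U] (hU : ∀ᵐ y ∂U, 0 ≤ y) {μ : ℝ} (hμ : 0 < μ)
    (hLap : ∀ r, 0 < r → laplaceT U r = ENNReal.ofReal (1 / (μ + D.fn r)))
    {p : ℝ → ℝ} (hp : Measurable (posPart p)) (hp1 : ∀ t, p t ≤ 1)
    (hLT : ∀ r, 0 < r → ENNReal.ofReal (D.fn r) * laplaceT U r =
      ENNReal.ofReal r * ∫⁻ t, ENNReal.ofReal (Real.exp (-(r * t))) * posPart p t) :
    U ≪ volume := by
  have hfE := isFiniteMeasure_withDensity_expWeight hU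
  have h0 : U {0} = 0 := by
    by_contra hne
    obtain ⟨δ, hδ, htail⟩ := hD.exists_lt_tail (1 / (U {0}).toReal)
    have hpos : 0 < (U {0}).toReal := ENNReal.toReal_pos hne (measure_ne_top _ _)
    have hae := convM_ae_eq hb hU hp hLT
    have hfalse : ∀ᵐ t ∂(volume.restrict (Ioc 0 δ)), False := by
      filter_upwards [ae_restrict_of_ae hae, ae_restrict_mem measurableSet_Ioc] with t ht htm
      have h1 : D.etail t * U {0} ≤ convM D.etail U t := by
        have : ∫⁻ y in {0}, D.etail (t - y) ∂U = D.etail t * U {0} := by simp [mul_comm]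
        rw [← this]
        exact setLIntegral_le_lintegral _ _
      rw [ht, posPart_of_pos p htm.1, etail_of_pos htm.1] at h1
      have h2 := ENNReal.toReal_mono ENNReal.ofReal_ne_top h1
      rw [ENNReal.toReal_mul, ENNReal.toReal_ofReal (D.tail_nonneg t)] at h2
      have h3 := htail t htm.1 htm.2
      rw [div_lt_iff₀ hpos] at h3
      have h4 : (ENNReal.ofReal (p t)).toReal ≤ 1 := by
        rw [ENNReal.toReal_ofReal']
        exact max_le (hp1 t) zero_le_one
      linarith
    rw [ae_iff] at hfalse
    simp at hfalse
    linarith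
  have h1 : U.withDensity coexpWeight ≪ volume := by
    rw [resolvent_withDensity_coexpWeight hD hb hU hμ hLap, Measure.conv_comm]
    refine Measure.conv_absolutelyContinuous (Measure.conv_absolutelyContinuous ?_)
    exact (withDensity_absolutelyContinuous _ _).trans hD.levyPos_absolutelyContinuous
  refine Measure.AbsolutelyContinuous.mk fun s hs hs0 => ?_
  have h2 := h1 hs0
  rw [withDensity_apply _ hs, lintegral_eq_zero_iff measurable_coexpWeight] at h2
  rw [measure_eq_zero_iff_ae_notMem]
  have h3 : ∀ᵐ y ∂U, y ≠ 0 := by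
    rw [ae_iff]; simpa using h0
  filter_upwards [hU, h3, (ae_restrict_iff' hs).1 h2] with y hy hy0 hys hmem
  have := hys hmem
  simp only [coexpWeight, Pi.zero_apply, ENNReal.ofReal_eq_zero, sub_nonpos,
    Real.one_le_exp_iff] at this
  exact hy0 (le_antisymm (by linarith) hy)

/-- For a driftless subordinator with locally absolutely continuous tail, the renewal-type identity
`∫ ν(t - y) U(dy) = p(t)` holds for every `t > 0`. -/
theorem resolvent_convM_eq (hD : D.ConditionI) (hb : D.b = 0) {U : Measure ℝ}
    [IsFiniteMeasure U] (hU : ∀ᵐ y ∂U, 0 ≤ y) {μ : ℝ} (hμ : 0 < μ)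
    (hLap : ∀ r, 0 < r → laplaceT U r = ENNReal.ofReal (1 / (μ + D.fn r)))
    {p : ℝ → ℝ} (hp : ContinuousOn p (Ioi 0)) (hp1 : ∀ t, p t ≤ 1)
    (hLT : ∀ r, 0 < r → ENNReal.ofReal (D.fn r) * laplaceT U r =
      ENNReal.ofReal r * ∫⁻ t, ENNReal.ofReal (Real.exp (-(r * t))) * posPart p t) {t : ℝ}
    (ht : 0 < t) : convM D.etail U t = ENNReal.ofReal (p t) := by
  have hpm := measurable_posPart hp
  have hfE := isFiniteMeasure_withDensity_expWeight hU
  have hac := resolvent_absolutelyContinuous hD hb hU hμ hLap hpm hp1 hLT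
  have hae := convM_ae_eq hb hU hpm hLT
  have hme := measurable_etail (D := D)
  have hmw := measurable_expWeight
  have hmc := measurable_coexpWeight
  set W := U ∗ D.temperedLevy
  have hW : W ≪ volume := Measure.conv_absolutelyContinuous
    ((withDensity_absolutelyContinuous _ _).trans hD.levyPos_absolutelyContinuous)
  -- The singularity of `ν` at `0` is removed by splitting `1 - e^{-t} = (1 - e^{-(t-y)}) +
  -- e^{-(t-y)}(1 - e^{-y})`. The first part leaves the bounded kernel `g1`. In the second, `(1 -
  -- e^{-y}) U(dy)` is replaced by its convolution formula, so that `ν * U` reappears only under an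
  -- integral against `W`.
  set g1 : ℝ → ℝ≥0∞ := fun s => coexpWeight s * D.etail s
  set g2 : ℝ → ℝ≥0∞ := fun s => expWeight s * posPart p s
  have key : ∀ t, 0 < t → coexpWeight t * convM D.etail U t = convM g1 U t + convM g2 W t := by
    intro t ht
    have e1 : coexpWeight t * convM D.etail U t = convM g1 U t +
        ∫⁻ y, expWeight (t - y) * D.etail (t - y) ∂(U.withDensity coexpWeight) := by
      rw [lintegral_withDensity_eq_lintegral_mul _ hmc (by fun_prop), convM, convM,
        ← lintegral_const_mul _ (by fun_prop), ← lintegral_add_left (by fun_prop)]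
      refine lintegral_congr_ae ?_
      filter_upwards [hU] with y hy
      rcases le_or_gt (t - y) 0 with h | h
      · simp [g1, etail_of_nonpos h]
      · have := coexpWeight_add h.le hy
        rw [sub_add_cancel] at this
        rw [this]
        simp only [g1, Pi.mul_apply]
        ring
    rw [e1, resolvent_withDensity_coexpWeight hD hb hU hμ hLap,
      Measure.lintegral_conv (by fun_prop)]
    congr 1
    have e2 : ∀ z, ∫⁻ y, expWeight (t - (z + y)) * D.etail (t - (z + y))
        ∂(U.withDensity expWeight) = expWeight (t - z) * convM D.etail U (t - z) := by
      intro z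
      rw [lintegral_withDensity_eq_lintegral_mul _ hmw (by fun_prop), convM,
        ← lintegral_const_mul _ (by fun_prop)]
      refine lintegral_congr fun y => ?_
      have h1 : expWeight (t - z) = expWeight y * expWeight (t - (z + y)) := by
        rw [← expWeight_add]; ring_nf
      rw [Pi.mul_apply, h1, mul_assoc, sub_add_eq_sub_sub]
    simp_rw [e2]
    -- Because `W` has a density, the almost everywhere identity `ν * U = p` suffices here, although
    -- the result is wanted at the given `t`.
    refine lintegral_congr_ae (hW.ae_le ?_)
    have hq : Measure.QuasiMeasurePreserving (fun z : ℝ => t - z) volume volume :=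
      quasiMeasurePreserving_sub_left volume t
    filter_upwards [hq.ae hae] with z hz
    rw [hz]
  obtain ⟨C, hC, hCb⟩ := D.exists_one_sub_exp_mul_tail_le
  have hc1 : ∀ t, ContinuousAt (convM g1 U) t := by
    intro t
    refine continuousAt_convM (by fun_prop) (C := ENNReal.ofReal C) ENNReal.ofReal_ne_top
      (fun s => ?_) (fun s hs => ?_) (hac (by simp))
    · rcases le_or_gt s 0 with h | h
      · simp [g1, etail_of_nonpos h]
      · simp only [g1]
        rw [etail_of_pos h, coexpWeight, ← ENNReal.ofReal_mul' (D.tail_nonneg s)]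
        exact ENNReal.ofReal_le_ofReal (hCb s h)
    · refine ENNReal.Tendsto.mul ?_ (Or.inr ?_) (hD.continuousAt_etail hs) (Or.inr ?_)
      · exact continuous_coexpWeight.tendsto s
      · rcases le_or_gt s 0 with h | h
        · simp [etail_of_nonpos h]
        · simp [etail_of_pos h]
      · simp [coexpWeight]
  have hc2 : ∀ t, ContinuousAt (convM g2 W) t := by
    intro t
    refine continuousAt_convM (by fun_prop) (C := 1) ENNReal.one_ne_top
      (fun s => ?_) (fun s hs => ?_) (hW (by simp))
    · rcases le_or_gt s 0 with h | h
      · simp [g2, posPart_of_nonpos p h]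
      · simp only [g2]
        refine mul_le_one' ?_ ?_
        · exact ENNReal.ofReal_le_one.2 (Real.exp_le_one_iff.2 (by linarith))
        · rw [posPart_of_pos p h]
          exact ENNReal.ofReal_le_one.2 (hp1 s)
    · refine ENNReal.Tendsto.mul ?_ (Or.inr ?_) (continuousAt_posPart hp hs) (Or.inr ?_)
      · exact continuous_expWeight.tendsto s
      · rcases le_or_gt s 0 with h | h
        · simp [posPart_of_nonpos p h]
        · simp [posPart_of_pos p h]
      · simp [expWeight]
  have hcc : ContinuousOn (fun t => coexpWeight t * posPart p t) (Ioi 0) := by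
    intro s hs
    refine ContinuousAt.continuousWithinAt ?_
    refine ENNReal.Tendsto.mul ?_ (Or.inr ?_) (continuousAt_posPart hp (ne_of_gt hs)) (Or.inr ?_)
    · exact continuous_coexpWeight.tendsto s
    · simp [posPart_of_pos p hs]
    · simp [coexpWeight]
  -- Both sides are continuous on `(0, ∞)`, as convolutions of bounded kernels with atomless finite
  -- measures on the left; hence almost everywhere equality becomes equality everywhere.
  have heq : EqOn (fun t => convM g1 U t + convM g2 W t)
      (fun t => coexpWeight t * posPart p t) (Ioi 0) := by
    refine Measure.eqOn_open_of_ae_eq (μ := volume) ?_ isOpen_Ioi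
      (fun s _ => ((hc1 s).add (hc2 s)).continuousWithinAt) hcc
    filter_upwards [ae_restrict_of_ae hae, ae_restrict_mem measurableSet_Ioi] with s hs hs0
    rw [← key s hs0, hs]
  have hfin := heq ht
  simp only [← key t ht] at hfin
  have hne : coexpWeight t ≠ 0 := by
    simp only [coexpWeight, ne_eq, ENNReal.ofReal_eq_zero, sub_nonpos, Real.one_le_exp_iff]
    linarith
  rw [ENNReal.mul_right_inj hne (by simp [coexpWeight]), posPart_of_pos p ht] at hfin
  exact hfin

end BernsteinData

/-! ### Potential densities -/

namespace BernsteinData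

variable {D : BernsteinData}

/-- `U` has a density `u` for which `b u(t) + ∫ ν(t - y) u(y) dy = p(t)` for every `t > 0`, and
which is continuous if `b ≠ 0`. -/
def HasPotentialDensity (D : BernsteinData) (U : Measure ℝ) (p : ℝ → ℝ) : Prop :=
  ∃ u : ℝ → ℝ, Measurable u ∧ (∀ t, 0 ≤ u t) ∧ (∀ t, t ≤ 0 → u t = 0) ∧
    U = volume.withDensity (fun t => ENNReal.ofReal (u t)) ∧
    (D.b ≠ 0 → ContinuousOn u (Ioi 0)) ∧
    ∀ t, 0 < t → ENNReal.ofReal (D.b * u t) + convM D.etail U t = ENNReal.ofReal (p t)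

/-- Fatou's lemma. At the only discontinuity `t = y` the kernel `etail` is `0`, so it is lower
semicontinuous. -/
theorem convM_etail_le_liminf (hD : D.ConditionI) (U : Measure ℝ) [SFinite U] {x : ℕ → ℝ} {t : ℝ}
    (hx : Tendsto x atTop (𝓝 t)) :
    convM D.etail U t ≤ liminf (fun n => convM D.etail U (x n)) atTop := by
  have hme := measurable_etail (D := D)
  refine le_trans (lintegral_mono fun y => ?_) (lintegral_liminf_le fun n => by fun_prop)
  rcases eq_or_ne (t - y) 0 with h | h
  · simp [h, etail_of_nonpos le_rfl]
  · have h1 : Tendsto (fun n => D.etail (x n - y)) atTop (𝓝 (D.etail (t - y))) :=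
      (hD.continuousAt_etail h).tendsto.comp (hx.sub_const y)
    exact h1.liminf_eq.ge

theorem exists_seq_of_ae {Q : ℝ → Prop} (hQ : ∀ᵐ s, Q s) {t : ℝ} (ht : 0 < t) :
    ∃ x : ℕ → ℝ, (∀ n, Q (x n)) ∧ (∀ n, 0 < x n) ∧ Tendsto x atTop (𝓝 t) := by
  have hd : Dense {s | Q s} := Measure.dense_of_ae hQ
  have hmem : t ∈ closure ({s | Q s} ∩ Ioi 0) := by
    have := hd.open_subset_closure_inter (isOpen_Ioi (a := (0 : ℝ))) ht
    rwa [inter_comm] at this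
  obtain ⟨x, hx, hxt⟩ := mem_closure_iff_seq_limit.1 hmem
  exact ⟨x, fun n => (hx n).1, fun n => (hx n).2, hxt⟩

/-- With `W = V - U`, both `ν * U` and `ν * W` are lower semicontinuous, so their values at `t` are
at most the limits `p(t)` and `q(t) - p(t)` along a sequence of good points. Their sum is exactly
`q(t)`, so neither inequality can be strict. -/
theorem convM_eq_of_le (hD : D.ConditionI) {U V : Measure ℝ} [IsFiniteMeasure U]
    [IsFiniteMeasure V] (hUV : U ≤ V) {p q : ℝ → ℝ} (hp : ContinuousOn p (Ioi 0))
    (hq : ContinuousOn q (Ioi 0)) (hU : convM D.etail U =ᵐ[volume] posPart p)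
    (hV : ∀ t, 0 < t → convM D.etail V t = ENNReal.ofReal (q t)) {t : ℝ} (ht : 0 < t) :
    convM D.etail U t = ENNReal.ofReal (p t) := by
  set W := V - U
  have hWV : W + U = V := Measure.sub_add_cancel_of_le hUV
  have hsum : ∀ s, convM D.etail W s + convM D.etail U s = convM D.etail V s := by
    intro s
    rw [← hWV, convM, convM, convM, lintegral_add_measure]
  obtain ⟨x, hx, hx0, hxt⟩ := exists_seq_of_ae hU ht
  have hxU : ∀ n, convM D.etail U (x n) = ENNReal.ofReal (p (x n)) := fun n => by
    rw [hx n, posPart_of_pos p (hx0 n)]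
  have hp' : Tendsto (fun n => ENNReal.ofReal (p (x n))) atTop (𝓝 (ENNReal.ofReal (p t))) :=
    (ENNReal.continuous_ofReal.continuousAt.comp
      (hp.continuousAt (Ioi_mem_nhds ht))).tendsto.comp hxt
  have hq' : Tendsto (fun n => ENNReal.ofReal (q (x n))) atTop (𝓝 (ENNReal.ofReal (q t))) :=
    (ENNReal.continuous_ofReal.continuousAt.comp
      (hq.continuousAt (Ioi_mem_nhds ht))).tendsto.comp hxt
  have hpq : ENNReal.ofReal (p t) ≤ ENNReal.ofReal (q t) := by
    refine le_of_tendsto_of_tendsto' hp' hq' fun n => ?_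
    rw [← hxU, ← hV _ (hx0 n), ← hsum]
    exact le_add_self
  have h1 : convM D.etail U t ≤ ENNReal.ofReal (p t) := by
    refine (convM_etail_le_liminf hD U hxt).trans ?_
    simp_rw [hxU]
    exact hp'.liminf_eq.le
  have h2 : convM D.etail W t ≤ ENNReal.ofReal (q t) - ENNReal.ofReal (p t) := by
    refine (convM_etail_le_liminf hD W hxt).trans ?_
    have hW : ∀ n, convM D.etail W (x n) =
        ENNReal.ofReal (q (x n)) - ENNReal.ofReal (p (x n)) := by
      intro n
      refine ENNReal.eq_sub_of_add_eq ENNReal.ofReal_ne_top ?_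
      rw [← hxU, hsum, hV _ (hx0 n)]
    simp_rw [hW]
    exact (ENNReal.Tendsto.sub hq' hp' (Or.inl ENNReal.ofReal_ne_top)).liminf_eq.le
  refine le_antisymm h1 ?_
  have h3 := hsum t
  rw [hV t ht] at h3
  have h4 : ENNReal.ofReal (q t) ≤ ENNReal.ofReal (q t) - ENNReal.ofReal (p t) +
      convM D.etail U t := by
    rw [← h3]
    rw [← h3] at h2
    gcongr
  have h5 := tsub_le_iff_left.2 h4
  rwa [ENNReal.sub_sub_cancel ENNReal.ofReal_ne_top hpq] at h5

theorem hasPotentialDensity_of_zero (hb : D.b = 0) {U : Measure ℝ} [IsFiniteMeasure U]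
    (hac : U ≪ volume) (hU : ∀ᵐ y ∂U, 0 ≤ y) {p : ℝ → ℝ}
    (h : ∀ t, 0 < t → convM D.etail U t = ENNReal.ofReal (p t)) :
    D.HasPotentialDensity U p := by
  refine ⟨(Ioi 0).indicator fun t => (U.rnDeriv volume t).toReal,
    (Measure.measurable_rnDeriv _ _).ennreal_toReal.indicator measurableSet_Ioi,
    fun t => indicator_nonneg (fun _ _ => ENNReal.toReal_nonneg) t,
    fun t ht => indicator_of_notMem (by simpa using ht) _, ?_, fun hne => absurd hb hne,
    fun t ht => by rw [hb, zero_mul, ENNReal.ofReal_zero, zero_add, h t ht]⟩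
  have h1 : U = U.restrict (Ioi 0) := by
    refine (Measure.restrict_eq_self_of_ae_mem ?_).symm
    have h2 : ∀ᵐ y ∂U, y ≠ 0 := by
      rw [ae_iff]
      exact hac (by simp)
    filter_upwards [hU, h2] with y hy hy0
    exact lt_of_le_of_ne hy hy0.symm
  conv_lhs => rw [h1, ← Measure.withDensity_rnDeriv_eq U volume hac,
    restrict_withDensity measurableSet_Ioi, ← withDensity_indicator measurableSet_Ioi]
  refine withDensity_congr_ae ?_
  filter_upwards [U.rnDeriv_lt_top volume] with t ht
  by_cases h3 : t ∈ Ioi (0 : ℝ)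
  · simp only [indicator_of_mem h3, ENNReal.ofReal_toReal ht.ne]
  · simp only [indicator_of_notMem h3, ENNReal.ofReal_zero]

theorem setLIntegral_etail_lt_top : ∫⁻ s in Iic 1, D.etail s < ∞ := by
  have h1 := lintegral_exp_mul_etail (D := D) one_pos
  have hme := measurable_etail (D := D)
  have h2 : ENNReal.ofReal (Real.exp (-1)) * ∫⁻ s in Iic 1, D.etail s ≤
      ENNReal.ofReal ((D.fn 1 - D.b * 1) / 1) := by
    rw [← h1, ← lintegral_const_mul _ hme]
    refine (setLIntegral_mono (by fun_prop) fun s hs => ?_).trans (setLIntegral_le_lintegral _ _)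
    have hs' : s ≤ 1 := hs
    gcongr
    linarith
  by_contra! h
  rw [top_le_iff.1 h, ENNReal.mul_top (by simp [Real.exp_pos])] at h2
  exact absurd ENNReal.ofReal_lt_top (not_lt.2 h2)

/-- Truncating `ν` gives continuous convolutions. The error is at most `K ∫_0^ε ν`, uniformly in the
point, and `ν` is integrable near `0`; continuity passes to the uniform limit. -/
theorem continuousAt_convM_etail (hD : D.ConditionI) {U : Measure ℝ} [IsFiniteMeasure U]
    {K : ℝ≥0∞} (hK : K ≠ ∞) (hUK : U ≤ K • volume) (t : ℝ) :
    convM D.etail U t ≠ ∞ ∧ ContinuousAt (fun s => (convM D.etail U s).toReal) t := by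
  have hme := measurable_etail (D := D)
  have hac : U ≪ volume := (Measure.absolutelyContinuous_of_le hUK).trans
    Measure.smul_absolutelyContinuous
  have approx : ∀ η : ℝ≥0∞, 0 < η → ∃ g : ℝ → ℝ≥0∞, (∀ s, convM g U s ≠ ∞) ∧
      (∀ s, ContinuousAt (convM g U) s) ∧ (∀ s, convM g U s ≤ convM D.etail U s) ∧
      ∀ s, convM D.etail U s ≤ convM g U s + K * η := by
    intro η hη
    obtain ⟨δ, hδ, hsmall⟩ := exists_pos_setLIntegral_lt_of_measure_lt
      (setLIntegral_etail_lt_top (D := D)).ne hη.ne'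
    obtain ⟨ε, hε0, hε1, hεδ⟩ : ∃ ε : ℝ, 0 < ε ∧ ε ≤ 1 ∧ ENNReal.ofReal ε < δ := by
      rcases eq_or_ne δ ∞ with rfl | hδt
      · exact ⟨1, one_pos, le_rfl, by simp⟩
      · have := ENNReal.toReal_pos hδ.ne' hδt
        refine ⟨min 1 (δ.toReal / 2), by positivity, min_le_left _ _, ?_⟩
        rw [ENNReal.ofReal_lt_iff_lt_toReal (by positivity) hδt]
        exact (min_le_right _ _).trans_lt (by linarith)
    have hint : ∫⁻ s, (Iic ε).indicator D.etail s ≤ η := by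
      have h1 : ∀ s, (Iic ε).indicator D.etail s = (Ioc 0 ε).indicator D.etail s := by
        intro s
        by_cases h : s ∈ Iic ε
        · rcases le_or_gt s 0 with h0 | h0
          · rw [indicator_of_mem h, etail_of_nonpos h0,
              indicator_of_notMem fun h' => h'.1.not_ge h0]
          · rw [indicator_of_mem h, indicator_of_mem (show s ∈ Ioc 0 ε from ⟨h0, h⟩)]
        · rw [indicator_of_notMem h, indicator_of_notMem fun h' => h h'.2]
      simp_rw [h1]
      rw [lintegral_indicator measurableSet_Ioc]
      have hsub : Ioc 0 ε ⊆ Iic 1 := fun x hx => hx.2.trans hε1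
      have := hsmall (Ioc 0 ε) (by
        rw [Measure.restrict_apply measurableSet_Ioc, inter_eq_left.2 hsub]
        simpa using hεδ)
      rw [Measure.restrict_restrict measurableSet_Ioc, inter_eq_left.2 hsub] at this
      exact this.le
    -- As the tail decreases, cutting at the height `ν(ε)` changes it only on `(0, ε]`.
    set C := ENNReal.ofReal (D.tail ε)
    have hgb : ∀ s, min (D.etail s) C ≤ C := fun s => min_le_right _ _
    refine ⟨fun s => min (D.etail s) C, fun s => ?_, fun s => ?_, fun s => ?_, fun s => ?_⟩
    · refine ne_top_of_le_ne_top (ENNReal.mul_ne_top ENNReal.ofReal_ne_top (measure_ne_top U univ))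
        ((lintegral_mono fun y => hgb _).trans_eq (lintegral_const C))
    · exact continuousAt_convM (by fun_prop) ENNReal.ofReal_ne_top hgb
        (fun s hs => (hD.continuousAt_etail hs).min continuousAt_const) (hac (by simp))
    · exact lintegral_mono fun y => min_le_left _ _
    · have hle : ∀ y, D.etail y ≤ min (D.etail y) C + (Iic ε).indicator D.etail y := by
        intro y
        by_cases h : y ∈ Iic ε
        · rw [indicator_of_mem h]
          exact le_add_self
        · have h' : ε < y := by simpa using h
          rw [indicator_of_notMem h, add_zero, min_eq_left]
          rw [etail_of_pos (hε0.trans h')]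
          exact ENNReal.ofReal_le_ofReal (D.tail_anti hε0 h'.le)
      refine (lintegral_mono fun y => hle (s - y)).trans ?_
      rw [lintegral_add_left (by fun_prop)]
      refine add_le_add le_rfl ((lintegral_mono' hUK le_rfl).trans ?_)
      rw [lintegral_smul_measure, smul_eq_mul,
        lintegral_sub_left_eq_self (fun y => (Iic ε).indicator D.etail y) s]
      gcongr
  have hfin : ∀ s, convM D.etail U s ≠ ∞ := by
    intro s
    obtain ⟨g, hg1, _, _, hg2⟩ := approx 1 one_pos
    exact ne_top_of_le_ne_top (ENNReal.add_ne_top.2 ⟨hg1 s, by simpa using hK⟩) (hg2 s)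
  refine ⟨hfin t, continuousAt_of_locally_uniform_approx_of_continuousAt fun w hw => ?_⟩
  obtain ⟨ε, hε, hεw⟩ := Metric.mem_uniformity_dist.1 hw
  have hK1 : 0 < K.toReal + 1 := by positivity
  -- Makes the error `K η` at most `ε / 2`; the `+ 1` allows `K = 0`.
  obtain ⟨g, hg1, hg2, hg3, hg4⟩ := approx (ENNReal.ofReal (ε / 2 / (K.toReal + 1)))
    (by simp; positivity)
  refine ⟨univ, univ_mem, fun s => (convM g U s).toReal,
    (ENNReal.continuousAt_toReal (hg1 t)).comp (hg2 t), fun s _ => hεw ?_⟩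
  have h1 := ENNReal.toReal_mono (hfin s) (hg3 s)
  have hKη : K * ENNReal.ofReal (ε / 2 / (K.toReal + 1)) ≠ ∞ :=
    ENNReal.mul_ne_top hK ENNReal.ofReal_ne_top
  have h2 := ENNReal.toReal_mono (ENNReal.add_ne_top.2 ⟨hg1 s, hKη⟩) (hg4 s)
  rw [ENNReal.toReal_add (hg1 s) hKη, ENNReal.toReal_mul, ENNReal.toReal_ofReal (by positivity)]
    at h2
  have h3 : K.toReal * (ε / 2 / (K.toReal + 1)) ≤ ε / 2 := by
    rw [mul_div_assoc', div_le_iff₀ hK1]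
    nlinarith
  rw [Real.dist_eq, abs_of_nonneg (by linarith)]
  linarith

/-- In `b U(dt) + (ν * U)(t) dt = p(t) dt` the second term is nonnegative, so `b U ≤ C dt`. -/
theorem le_smul_volume_of_pos (hb : 0 < D.b) {U : Measure ℝ} [IsFiniteMeasure U]
    (hU : ∀ᵐ y ∂U, 0 ≤ y) {p : ℝ → ℝ} (hp : Measurable (posPart p)) {C : ℝ} (hpC : ∀ t, p t ≤ C)
    (hLT : ∀ r, 0 < r → ENNReal.ofReal (D.fn r) * laplaceT U r =
      ENNReal.ofReal r * ∫⁻ t, ENNReal.ofReal (Real.exp (-(r * t))) * posPart p t) :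
    U ≤ ENNReal.ofReal (C / D.b) • volume := by
  have h := smul_add_withDensity_convM hU hp hLT
  refine Measure.le_iff.2 fun s hs => ?_
  have h1 : ENNReal.ofReal D.b * U s ≤ ENNReal.ofReal C * volume s := by
    have h2 := congrArg (fun m : Measure ℝ => m s) h
    simp only [Measure.add_apply, Measure.smul_apply, smul_eq_mul] at h2
    refine le_self_add.trans (h2.le.trans ?_)
    rw [withDensity_apply _ hs, ← setLIntegral_const]
    refine lintegral_mono fun t => ?_
    rcases le_or_gt t 0 with ht | ht
    · rw [posPart_of_nonpos p ht]
      exact zero_le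
    · rw [posPart_of_pos p ht]
      exact ENNReal.ofReal_le_ofReal (hpC t)
  rw [Measure.smul_apply, smul_eq_mul, ENNReal.ofReal_div_of_pos hb, div_eq_mul_inv,
    mul_right_comm, ← div_eq_mul_inv,
    ENNReal.le_div_iff_mul_le (Or.inl (by simpa using hb)) (Or.inl ENNReal.ofReal_ne_top), mul_comm]
  exact h1

/-- The version `u = (p - ν * U) / b` satisfies the identity at every `t > 0` by construction and is
continuous because `ν * U` is. Nonnegativity at every point, not just almost every one, comes from
lower semicontinuity. -/
theorem hasPotentialDensity_of_pos (hD : D.ConditionI) (hb : 0 < D.b) {U : Measure ℝ}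
    [IsFiniteMeasure U] (hU : ∀ᵐ y ∂U, 0 ≤ y) {p : ℝ → ℝ} (hp : ContinuousOn p (Ioi 0)) {C : ℝ}
    (hp0 : ∀ t, 0 ≤ p t) (hpC : ∀ t, p t ≤ C)
    (hLT : ∀ r, 0 < r → ENNReal.ofReal (D.fn r) * laplaceT U r =
      ENNReal.ofReal r * ∫⁻ t, ENNReal.ofReal (Real.exp (-(r * t))) * posPart p t) :
    D.HasPotentialDensity U p := by
  have hpm := measurable_posPart hp
  have hle := le_smul_volume_of_pos hb hU hpm hpC hLT
  have hac : U ≪ volume := (Measure.absolutelyContinuous_of_le hle).trans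
    Measure.smul_absolutelyContinuous
  have hid := smul_add_withDensity_convM hU hpm hLT
  have hcont := fun t => continuousAt_convM_etail hD ENNReal.ofReal_ne_top hle t
  have hmh := measurable_convM (measurable_etail (D := D)) U
  have hbne : ENNReal.ofReal D.b ≠ 0 := by simpa using hb
  set u : ℝ → ℝ := (Ioi 0).indicator fun t => (p t - (convM D.etail U t).toReal) / D.b
  have hae : ∀ᵐ t, ENNReal.ofReal D.b * U.rnDeriv volume t + convM D.etail U t = posPart p t := by
    have h1 : volume.withDensity (fun t => ENNReal.ofReal D.b * U.rnDeriv volume t +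
        convM D.etail U t) = volume.withDensity (posPart p) := by
      rw [← hid]
      have h2 := withDensity_add_left (μ := (volume : Measure ℝ))
        ((Measure.measurable_rnDeriv U volume).const_mul (ENNReal.ofReal D.b)) (convM D.etail U)
      refine h2.trans ?_
      congr 1
      refine (withDensity_smul (ENNReal.ofReal D.b) (Measure.measurable_rnDeriv U volume)).trans ?_
      rw [Measure.withDensity_rnDeriv_eq U volume hac]
    have hm : Measurable fun t => ENNReal.ofReal D.b * U.rnDeriv volume t + convM D.etail U t :=
      ((Measure.measurable_rnDeriv U volume).const_mul _).add hmh
    exact (withDensity_eq_iff_of_sigmaFinite hm.aemeasurable hpm.aemeasurable).1 h1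
  have hle' : ∀ t, 0 < t → convM D.etail U t ≤ ENNReal.ofReal (p t) := by
    intro t ht
    obtain ⟨x, hx, hx0, hxt⟩ := exists_seq_of_ae hae ht
    refine (convM_etail_le_liminf hD U hxt).trans ?_
    have h1 : Tendsto (fun n => ENNReal.ofReal (p (x n))) atTop (𝓝 (ENNReal.ofReal (p t))) :=
      (ENNReal.continuous_ofReal.continuousAt.comp
        (hp.continuousAt (Ioi_mem_nhds ht))).tendsto.comp hxt
    rw [← h1.liminf_eq]
    refine liminf_le_liminf (Eventually.of_forall fun n => ?_)
    rw [← posPart_of_pos p (hx0 n), ← hx n]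
    exact le_add_self
  have hle'' : ∀ t, 0 < t → (convM D.etail U t).toReal ≤ p t := fun t ht =>
    ENNReal.toReal_le_of_le_ofReal (hp0 t) (hle' t ht)
  have hu0 : ∀ t, 0 ≤ u t := fun t =>
    indicator_nonneg (fun s hs => div_nonneg (sub_nonneg.2 (hle'' s hs)) hb.le) t
  have heq : ∀ t, 0 < t → ENNReal.ofReal (D.b * u t) + convM D.etail U t =
      ENNReal.ofReal (p t) := by
    intro t ht
    simp only [u, indicator_of_mem (mem_Ioi.2 ht)]
    rw [mul_div_cancel₀ _ hb.ne', ← ENNReal.ofReal_toReal (hcont t).1,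
      ← ENNReal.ofReal_add, ENNReal.toReal_ofReal ENNReal.toReal_nonneg, sub_add_cancel]
    · rw [ENNReal.toReal_ofReal ENNReal.toReal_nonneg]
      exact sub_nonneg.2 (hle'' t ht)
    · exact ENNReal.toReal_nonneg
  have huc : ContinuousOn u (Ioi 0) := by
    have h1 : ContinuousOn (fun t => (p t - (convM D.etail U t).toReal) / D.b) (Ioi 0) :=
      (hp.sub fun t _ => (hcont t).2.continuousWithinAt).div_const _
    exact h1.congr fun t ht => indicator_of_mem ht _
  have hum : Measurable u := by
    have h1 : ∀ t, u t = (posPart p t - convM D.etail U t).toReal / D.b := by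
      intro t
      rcases le_or_gt t 0 with ht | ht
      · simp only [u]
        rw [indicator_of_notMem (by simpa using ht), posPart_of_nonpos p ht]
        simp
      · simp only [u]
        rw [indicator_of_mem (mem_Ioi.2 ht), posPart_of_pos p ht,
          ENNReal.toReal_sub_of_le (hle' t ht) ENNReal.ofReal_ne_top,
          ENNReal.toReal_ofReal (hp0 t)]
    rw [funext h1]
    exact (hpm.sub hmh).ennreal_toReal.div_const _
  refine ⟨u, hum, hu0, fun t ht => indicator_of_notMem (by simpa using ht) _, ?_,
    fun _ => huc, heq⟩
  conv_lhs => rw [← Measure.withDensity_rnDeriv_eq U volume hac]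
  refine withDensity_congr_ae ?_
  filter_upwards [hae] with t ht
  rcases le_or_gt t 0 with h0 | h0
  · rw [posPart_of_nonpos p h0, add_eq_zero] at ht
    simp only [u]
    rw [indicator_of_notMem (by simpa using h0), ENNReal.ofReal_zero]
    exact (mul_eq_zero.1 ht.1).resolve_left hbne
  · rw [posPart_of_pos p h0, ← heq t h0, ENNReal.ofReal_mul hb.le] at ht
    exact (ENNReal.mul_right_inj hbne ENNReal.ofReal_ne_top).1
      ((ENNReal.add_left_inj (hcont t).1).1 ht)

end BernsteinData

/-! ### Generalized Caputo–Djrbashian derivatives -/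

theorem _root_.AbsolutelyContinuousOnInterval.congr {f g : ℝ → ℝ} {a b : ℝ}
    (hf : AbsolutelyContinuousOnInterval f a b) (h : EqOn f g (uIcc a b)) :
    AbsolutelyContinuousOnInterval g a b := by
  rw [absolutelyContinuousOnInterval_iff] at hf ⊢
  intro ε hε
  obtain ⟨δ, hδ, H⟩ := hf ε hε
  refine ⟨δ, hδ, fun E hE hlt => ?_⟩
  convert! H E hE hlt using 1
  refine Finset.sum_congr rfl fun i hi => ?_
  rw [h (hE.1 i hi).1, h (hE.1 i hi).2]

theorem _root_.AbsolutelyContinuousOnInterval.fun_sum {ι : Type*} (S : Finset ι) {f : ι → ℝ → ℝ}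
    {a b : ℝ} (hf : ∀ i ∈ S, AbsolutelyContinuousOnInterval (f i) a b) :
    AbsolutelyContinuousOnInterval (fun t => ∑ i ∈ S, f i t) a b := by
  classical
  induction S using Finset.induction_on with
  | empty =>
    rw [absolutelyContinuousOnInterval_iff]
    intro ε hε
    exact ⟨1, one_pos, fun E _ _ => by simpa using hε⟩
  | insert i S hi ih =>
    simp_rw [Finset.sum_insert hi]
    exact (hf i (Finset.mem_insert_self i S)).fun_add
      (ih fun j hj => hf j (Finset.mem_insert_of_mem hj))

namespace BernsteinData

variable {D : BernsteinData}

/-- The distribution function of `U` is the primitive of `u`. Lebesgue differentiation gives the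
derivative almost everywhere, which is enough inside the convolution; for `b ≠ 0` continuity of `u`
gives it at every `t > 0`. -/
theorem HasPotentialDensity.exists_deriv {U : Measure ℝ} [IsFiniteMeasure U] {p : ℝ → ℝ}
    (h : D.HasPotentialDensity U p) (hp : ∀ t, 0 < t → 0 ≤ p t) :
    ∃ u : ℝ → ℝ, (∀ T, AbsolutelyContinuousOnInterval (fun t => U.real (Iic t)) 0 T) ∧
      (∀ᵐ s, HasDerivAt (fun t => U.real (Iic t)) (u s) s) ∧
      (D.b ≠ 0 → ∀ t, 0 < t → HasDerivAt (fun t => U.real (Iic t)) (u t) t) ∧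
      ∀ t, 0 < t → IntervalIntegrable (fun s => u (t - s) * D.tail s) volume 0 t ∧
        D.b * u t + ∫ s in (0 : ℝ)..t, u (t - s) * D.tail s = p t := by
  obtain ⟨u, hum, hu0, huz, hUu, huc, hid⟩ := h
  have hui : Integrable u := by
    refine ⟨hum.aestronglyMeasurable, ?_⟩
    rw [hasFiniteIntegral_iff_ofReal (ae_of_all _ hu0)]
    have := measure_lt_top U univ
    rwa [hUu, withDensity_apply _ MeasurableSet.univ, setLIntegral_univ] at this
  have hF : (fun t => U.real (Iic t)) = fun t => ∫ s in (0 : ℝ)..t, u s := by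
    funext t
    have h1 : U.real (Iic t) = ∫ s in Iic t, u s := by
      rw [integral_eq_lintegral_of_nonneg_ae (ae_of_all _ hu0) hum.aestronglyMeasurable,
        measureReal_def, hUu, withDensity_apply _ measurableSet_Iic]
    have h2 : ∫ s in Iic (0 : ℝ), u s = 0 := by
      rw [setIntegral_congr_fun (g := fun _ => 0) measurableSet_Iic fun s hs => huz s hs]
      simp
    rw [h1, ← intervalIntegral.integral_Iic_sub_Iic hui.integrableOn hui.integrableOn, h2, sub_zero]
  rw [hF]
  refine ⟨u, fun T => ?_, ?_, fun hb t ht => ?_, fun t ht => ?_⟩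
  · exact hui.intervalIntegrable.absolutelyContinuousOnInterval_intervalIntegral (by simp)
  · have := LocallyIntegrable.ae_hasDerivAt_integral hui.locallyIntegrable
    filter_upwards [this] with s hs using hs 0
  · exact intervalIntegral.integral_hasDerivAt_right hui.intervalIntegrable
      hum.stronglyMeasurable.stronglyMeasurableAtFilter
      ((huc hb).continuousAt (Ioi_mem_nhds ht))
  · have hme := measurable_etail (D := D)
    have hconv : convM D.etail U t =
        ∫⁻ s in Ioc 0 t, ENNReal.ofReal (u (t - s) * D.tail s) := by
      rw [convM, hUu, lintegral_withDensity_eq_lintegral_mul _ (by fun_prop) (by fun_prop),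
        ← lintegral_indicator measurableSet_Ioc, ← lintegral_sub_left_eq_self _ t]
      refine lintegral_congr fun s => ?_
      simp only [Pi.mul_apply, sub_sub_cancel]
      rcases le_or_gt s 0 with hs | hs
      · rw [etail_of_nonpos hs, mul_zero, indicator_of_notMem fun h' => h'.1.not_ge hs]
      · rcases le_or_gt s t with hst | hst
        · rw [indicator_of_mem (show s ∈ Ioc 0 t from ⟨hs, hst⟩), etail_of_pos hs,
            ENNReal.ofReal_mul (hu0 _)]
        · rw [indicator_of_notMem fun h' => h'.2.not_gt hst, huz _ (by linarith)]
          simp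
    have hnn : ∀ s, 0 ≤ u (t - s) * D.tail s := fun s => mul_nonneg (hu0 _) (D.tail_nonneg s)
    have hlt : convM D.etail U t < ∞ := by
      refine lt_of_le_of_lt ?_ (ENNReal.ofReal_lt_top (r := p t))
      rw [← hid t ht]
      exact le_add_self
    have hmeas : AEStronglyMeasurable (fun s => u (t - s) * D.tail s)
        (volume.restrict (Ioc 0 t)) := by
      refine (hum.comp (measurable_const.sub measurable_id)).aestronglyMeasurable.mul ?_
      have h1 : AEMeasurable D.tail (volume.restrict (Ioc 0 t)) :=
        aemeasurable_restrict_of_antitoneOn measurableSet_Ioc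
          fun x hx y _ hxy => D.tail_anti hx.1 hxy
      exact h1.aestronglyMeasurable
    have hi : IntegrableOn (fun s => u (t - s) * D.tail s) (Ioc 0 t) := by
      refine ⟨hmeas, ?_⟩
      rw [hasFiniteIntegral_iff_ofReal (ae_of_all _ hnn), ← hconv]
      exact hlt
    refine ⟨(intervalIntegrable_iff_integrableOn_Ioc_of_le ht.le).2 hi, ?_⟩
    have h1 := hid t ht
    rw [hconv, ← ofReal_integral_eq_lintegral_ofReal hi (ae_of_all _ hnn), ← ENNReal.ofReal_add
      (mul_nonneg D.b_nonneg (hu0 t)) (integral_nonneg hnn)] at h1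
    rw [intervalIntegral.integral_of_le ht.le]
    exact (ENNReal.ofReal_eq_ofReal_iff (add_nonneg (mul_nonneg D.b_nonneg (hu0 t))
      (integral_nonneg hnn)) (hp t ht)).1 h1

/-- The generalized Caputo–Djrbashian derivative of a combination of potentials. -/
theorem hasCaputoDeriv_of_sum {ι : Type*} (S : Finset ι) (κ : ι → ℝ) {U : ι → Measure ℝ}
    (hfin : ∀ i ∈ S, IsFiniteMeasure (U i)) {p : ι → ℝ → ℝ}
    (hU : ∀ i ∈ S, D.HasPotentialDensity (U i) (p i)) (hp : ∀ i ∈ S, ∀ t, 0 < t → 0 ≤ p i t)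
    {v : ℝ → ℝ} {v0 : ℝ} (hv : ∀ t, 0 ≤ t → v t = v0 + ∑ i ∈ S, κ i * (U i).real (Iic t))
    {t : ℝ} (ht : 0 < t) : HasCaputoDeriv D v (∑ i ∈ S, κ i * p i t) t := by
  have hex : ∀ i, ∃ u : ℝ → ℝ, i ∈ S →
      ((∀ T, AbsolutelyContinuousOnInterval (fun t => (U i).real (Iic t)) 0 T) ∧
      (∀ᵐ s, HasDerivAt (fun t => (U i).real (Iic t)) (u s) s) ∧
      (D.b ≠ 0 → ∀ t, 0 < t → HasDerivAt (fun t => (U i).real (Iic t)) (u t) t) ∧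
      ∀ t, 0 < t → IntervalIntegrable (fun s => u (t - s) * D.tail s) volume 0 t ∧
        D.b * u t + ∫ s in (0 : ℝ)..t, u (t - s) * D.tail s = p i t) := by
    intro i
    by_cases hi : i ∈ S
    · have := hfin i hi
      obtain ⟨u, hu⟩ := (hU i hi).exists_deriv (hp i hi)
      exact ⟨u, fun _ => hu⟩
    · exact ⟨0, fun h => absurd h hi⟩
  choose u hu using hex
  have hvd : ∀ s, 0 < s → (∀ i ∈ S, HasDerivAt (fun t => (U i).real (Iic t)) (u i s) s) →
      HasDerivAt v (∑ i ∈ S, κ i * u i s) s := by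
    intro s hs hd
    have h1 : HasDerivAt (fun t => v0 + ∑ i ∈ S, κ i * (U i).real (Iic t))
        (∑ i ∈ S, κ i * u i s) s :=
      (HasDerivAt.fun_sum fun i hi => (hd i hi).const_mul (κ i)).const_add v0
    refine h1.congr_of_eventuallyEq ?_
    filter_upwards [Ioi_mem_nhds hs] with x hx using hv x (le_of_lt hx)
  have hae : ∀ᵐ s, 0 < s → deriv v s = ∑ i ∈ S, κ i * u i s := by
    have h1 : ∀ᵐ s, ∀ i ∈ S, HasDerivAt (fun t => (U i).real (Iic t)) (u i s) s :=
      (ae_ball_iff S.countable_toSet).2 fun i hi => (hu i hi).2.1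
    filter_upwards [h1] with s hs hs0 using (hvd s hs0 hs).deriv
  have hae' : ∀ᵐ s, s ∈ uIoc (0 : ℝ) t →
      (∑ i ∈ S, κ i * (u i (t - s) * D.tail s)) = deriv v (t - s) * D.tail s := by
    -- The derivative of `v` is identified only at positive arguments, and `t - s` vanishes at `s =
    -- t`.
    have hne : ∀ᵐ s : ℝ, s ≠ t := by
      rw [ae_iff]; simp
    filter_upwards [(quasiMeasurePreserving_sub_left volume t).ae hae, hne] with s hs hst hmem
    rw [uIoc_of_le ht.le] at hmem
    rw [hs (sub_pos.2 (lt_of_le_of_ne hmem.2 hst)), Finset.sum_mul]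
    exact Finset.sum_congr rfl fun i _ => (mul_assoc _ _ _).symm
  have hii : IntervalIntegrable (fun s => ∑ i ∈ S, κ i * (u i (t - s) * D.tail s)) volume 0 t := by
    have h1 := IntervalIntegrable.sum (f := fun i s => κ i * (u i (t - s) * D.tail s)) S
      fun i hi => ((hu i hi).2.2.2 t ht).1.const_mul (κ i)
    have e : (∑ i ∈ S, fun s => κ i * (u i (t - s) * D.tail s)) =
        fun s => ∑ i ∈ S, κ i * (u i (t - s) * D.tail s) := by
      funext s
      simp [Finset.sum_apply]
    rwa [e] at h1
  refine ⟨fun T hT => ?_, fun hb => ?_, ?_, ?_⟩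
  · have h1 : AbsolutelyContinuousOnInterval (fun t => ∑ i ∈ S, κ i * (U i).real (Iic t)) 0 T :=
      AbsolutelyContinuousOnInterval.fun_sum S fun i hi => ((hu i hi).1 T).const_mul (κ i)
    have h2 : AbsolutelyContinuousOnInterval (fun _ : ℝ => v0) 0 T := by
      rw [absolutelyContinuousOnInterval_iff]
      exact fun ε hε => ⟨1, one_pos, fun E _ _ => by simpa using hε⟩
    refine (h2.fun_add h1).congr fun x hx => ?_
    rw [uIcc_of_le hT.le] at hx
    exact (hv x hx.1).symm
  · exact (hvd t ht fun i hi => (hu i hi).2.2.1 hb t ht).differentiableAt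
  · refine hii.congr_ae ?_
    rw [Filter.EventuallyEq, ae_restrict_iff' measurableSet_uIoc]
    exact hae'
  · have h1 : D.b * deriv v t = ∑ i ∈ S, κ i * (D.b * u i t) := by
      -- Without drift `v` need not be differentiable at `t`; the factor `b` kills that term.
      by_cases hb : D.b = 0
      · simp [hb]
      · rw [(hvd t ht fun i hi => (hu i hi).2.2.1 hb t ht).deriv, Finset.mul_sum]
        exact Finset.sum_congr rfl fun i _ => by ring
    have h2 : ∫ s in (0 : ℝ)..t, deriv v (t - s) * D.tail s =
        ∑ i ∈ S, κ i * ∫ s in (0 : ℝ)..t, u i (t - s) * D.tail s := by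
      rw [← intervalIntegral.integral_congr_ae hae', intervalIntegral.integral_finsetSum
        fun i hi => ((hu i hi).2.2.2 t ht).1.const_mul (κ i)]
      simp_rw [intervalIntegral.integral_const_mul]
    rw [caputoDeriv, h1, h2, ← Finset.sum_add_distrib]
    refine Finset.sum_congr rfl fun i hi => ?_
    rw [← ((hu i hi).2.2.2 t ht).2]
    ring

end BernsteinData

/-! ### Potential measures of a subordinator -/

/-- Continuous functions with `0 ≤ q(s) ≤ C e^{-μ s}` on `[0, ∞)`. -/
structure ExpDecay (μ : ℝ) (q : ℝ → ℝ) : Prop where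
  continuous : Continuous q
  nonneg : ∀ s, 0 ≤ s → 0 ≤ q s
  bound : ∃ C, 0 ≤ C ∧ ∀ s, 0 ≤ s → q s ≤ C * Real.exp (-(μ * s))

theorem ExpDecay.integrableOn {μ : ℝ} (hμ : 0 < μ) {q : ℝ → ℝ} (hq : ExpDecay μ q) {c : ℝ}
    (hc : 0 ≤ c) : IntegrableOn (fun s => q s * Real.exp (-(s * c))) (Ioi 0) := by
  obtain ⟨C, hC, hb⟩ := hq.bound
  have h1 := integrableOn_exp_mul_Ioi (neg_lt_zero.2 hμ) 0
  have hcont := hq.continuous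
  refine (h1.const_mul C).mono' (by fun_prop) ?_
  filter_upwards [ae_restrict_mem measurableSet_Ioi] with s hs
  have hs' : (0 : ℝ) < s := hs
  rw [Real.norm_eq_abs, abs_of_nonneg (mul_nonneg (hq.nonneg s hs'.le) (Real.exp_pos _).le),
    neg_mul]
  exact (mul_le_of_le_one_right (hq.nonneg s hs'.le)
    (Real.exp_le_one_iff.2 (neg_nonpos.2 (by positivity)))).trans (hb s hs'.le)

theorem ExpDecay.integrableOn' {μ : ℝ} (hμ : 0 < μ) {q : ℝ → ℝ} (hq : ExpDecay μ q) :
    IntegrableOn q (Ioi 0) := by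
  simpa using hq.integrableOn hμ le_rfl

section Potential

variable {Ω : Type*} [MeasurableSpace Ω]

/-- The potential measure `∫_0^∞ q(s) P(H(s) ∈ dy) ds` on `[0, ∞)`. -/
noncomputable def potential (P : Measure Ω) (H : ℝ≥0 → Ω → ℝ≥0∞) (q : ℝ → ℝ) : Measure ℝ :=
  ((((volume.restrict (Ioi 0)).withDensity fun s => ENNReal.ofReal (q s)).prod P).restrict
    {x | H x.1.toNNReal x.2 < ∞}).map fun x => (H x.1.toNNReal x.2).toReal

variable {P : Measure Ω} {H : ℝ≥0 → Ω → ℝ≥0∞} {f : ℝ → ℝ}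

namespace IsSubordinator

theorem measurable_uncurry (hH : IsSubordinator f H P) :
    Measurable fun x : ℝ × Ω => H x.1.toNNReal x.2 :=
  (measurable_uncurry_of_monotone hH.measurable hH.mono hH.right_cont).comp
    ((measurable_real_toNNReal.comp measurable_fst).prodMk measurable_snd)

theorem ae_nonneg_potential (hH : IsSubordinator f H P) (q : ℝ → ℝ) :
    ∀ᵐ y ∂(potential P H q), 0 ≤ y := by
  rw [potential]
  exact (ae_map_iff (p := fun y : ℝ => 0 ≤ y) hH.measurable_uncurry.ennreal_toReal.aemeasurable
    measurableSet_Ici).2 (ae_of_all _ fun x => ENNReal.toReal_nonneg)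

variable [IsProbabilityMeasure P]

theorem lintegral_potential (hH : IsSubordinator f H P) {q : ℝ → ℝ} (hq : Measurable q)
    {g : ℝ → ℝ≥0∞} (hg : Measurable g) :
    ∫⁻ y, g y ∂(potential P H q) = ∫⁻ s in Ioi (0 : ℝ), ENNReal.ofReal (q s) *
      ∫⁻ ω, {ω | H s.toNNReal ω < ∞}.indicator (fun ω => g (H s.toNNReal ω).toReal) ω ∂P := by
  have hm := hH.measurable_uncurry
  have hset : MeasurableSet {x : ℝ × Ω | H x.1.toNNReal x.2 < ∞} := hm measurableSet_Iio
  have hF : Measurable ({x : ℝ × Ω | H x.1.toNNReal x.2 < ∞}.indicator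
      fun x => g (H x.1.toNNReal x.2).toReal) :=
    (hg.comp hm.ennreal_toReal).indicator hset
  rw [potential, lintegral_map hg hm.ennreal_toReal, ← lintegral_indicator hset,
    lintegral_prod _ hF.aemeasurable, lintegral_withDensity_eq_lintegral_mul _ (by fun_prop)
      hF.lintegral_prod_right']
  rfl

theorem potential_apply (hH : IsSubordinator f H P) {q : ℝ → ℝ} (hq : Measurable q) {s : Set ℝ}
    (hs : MeasurableSet s) : potential P H q s = ∫⁻ x in Ioi (0 : ℝ), ENNReal.ofReal (q x) *
      ∫⁻ ω, {ω | H x.toNNReal ω < ∞}.indicator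
        (fun ω => s.indicator 1 (H x.toNNReal ω).toReal) ω ∂P := by
  rw [← lintegral_indicator_one hs, hH.lintegral_potential hq (measurable_one.indicator hs)]

theorem lintegral_exp (hH : IsSubordinator f H P) {r : ℝ} (hr : 0 < r) (s : ℝ≥0) :
    ∫⁻ ω, {ω | H s ω < ∞}.indicator
      (fun ω => ENNReal.ofReal (Real.exp (-(r * (H s ω).toReal)))) ω ∂P =
      ENNReal.ofReal (Real.exp (-(s * f r))) := by
  have hm := hH.measurable s
  have hset : MeasurableSet {ω | H s ω = ∞} := hm (measurableSet_singleton _)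
  have hme : Measurable fun ω => expNeg r (H s ω) := by
    unfold expNeg
    exact Measurable.ite hset measurable_const (by fun_prop)
  have h0 : ∀ ω, 0 ≤ expNeg r (H s ω) := fun ω => by
    unfold expNeg
    split_ifs
    · exact le_rfl
    · exact (Real.exp_pos _).le
  have h1 : ∀ ω, expNeg r (H s ω) ≤ 1 := fun ω => by
    unfold expNeg
    split_ifs
    · exact zero_le_one
    · exact Real.exp_le_one_iff.2 (neg_nonpos.2 (mul_nonneg hr.le ENNReal.toReal_nonneg))
  have hi : Integrable (fun ω => expNeg r (H s ω)) P :=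
    Integrable.of_bound hme.aestronglyMeasurable 1 (ae_of_all _ fun ω => by
      rw [Real.norm_eq_abs, abs_of_nonneg (h0 ω)]; exact h1 ω)
  rw [← hH.laplace s r hr, ofReal_integral_eq_lintegral_ofReal hi (ae_of_all _ h0)]
  refine lintegral_congr fun ω => ?_
  by_cases h : H s ω = ∞
  · simp [h, expNeg]
  · rw [indicator_of_mem (show ω ∈ {ω | H s ω < ∞} from lt_top_iff_ne_top.2 h), expNeg, if_neg h]

theorem laplaceT_potential (hH : IsSubordinator f H P) {q : ℝ → ℝ} (hq : Measurable q) {r : ℝ}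
    (hr : 0 < r) : laplaceT (potential P H q) r =
      ∫⁻ s in Ioi (0 : ℝ), ENNReal.ofReal (q s) * ENNReal.ofReal (Real.exp (-(s * f r))) := by
  rw [laplaceT, hH.lintegral_potential hq (measurable_expKernel r)]
  refine setLIntegral_congr_fun measurableSet_Ioi fun s hs => ?_
  have hs' : (0 : ℝ) < s := hs
  rw [hH.lintegral_exp hr, Real.coe_toNNReal _ hs'.le]

theorem laplaceT_potential_eq (hH : IsSubordinator f H P) {μ : ℝ} (hμ : 0 < μ) {q : ℝ → ℝ}
    (hq : ExpDecay μ q) {r : ℝ} (hr : 0 < r) (hf : 0 ≤ f r) : laplaceT (potential P H q) r =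
      ENNReal.ofReal (∫ s in Ioi (0 : ℝ), q s * Real.exp (-(s * f r))) := by
  rw [hH.laplaceT_potential hq.continuous.measurable hr, ofReal_integral_eq_lintegral_ofReal
    (hq.integrableOn hμ hf)]
  · refine setLIntegral_congr_fun measurableSet_Ioi fun s hs => ?_
    exact (ENNReal.ofReal_mul (hq.nonneg s (le_of_lt hs))).symm
  · filter_upwards [ae_restrict_mem measurableSet_Ioi] with s hs
    exact mul_nonneg (hq.nonneg s (le_of_lt hs)) (Real.exp_pos _).le

theorem isFiniteMeasure_potential (hH : IsSubordinator f H P) {μ : ℝ} (hμ : 0 < μ) {q : ℝ → ℝ}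
    (hq : ExpDecay μ q) : IsFiniteMeasure (potential P H q) := by
  refine ⟨?_⟩
  rw [hH.potential_apply hq.continuous.measurable MeasurableSet.univ]
  have h1 : ∫⁻ x in Ioi (0 : ℝ), ENNReal.ofReal (q x) < ∞ := by
    have := (hq.integrableOn' hμ).2
    rwa [hasFiniteIntegral_iff_ofReal] at this
    filter_upwards [ae_restrict_mem measurableSet_Ioi] with s hs using hq.nonneg s (le_of_lt hs)
  refine lt_of_le_of_lt (lintegral_mono fun s => ?_) h1
  refine mul_le_of_le_one_right' ?_
  have h2 : ∫⁻ _ : Ω, (1 : ℝ≥0∞) ∂P = 1 := by simp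
  rw [← h2]
  refine lintegral_mono fun ω => ?_
  refine indicator_le_self' (fun _ _ => zero_le) ω |>.trans ?_
  simp

/-- Reduces a general exponentially decaying weight to the resolvent weight `e^{-μs}`. -/
theorem potential_le (hH : IsSubordinator f H P) {q₁ q₂ : ℝ → ℝ} (h₁ : Measurable q₁)
    (h₂ : Measurable q₂) {C : ℝ} (hC : 0 ≤ C) (hle : ∀ s, 0 ≤ s → q₁ s ≤ C * q₂ s) :
    potential P H q₁ ≤ ENNReal.ofReal C • potential P H q₂ := by
  refine Measure.le_iff.2 fun s hs => ?_
  rw [Measure.smul_apply, smul_eq_mul, hH.potential_apply h₁ hs, hH.potential_apply h₂ hs,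
    ← lintegral_const_mul' _ _ ENNReal.ofReal_ne_top]
  refine setLIntegral_mono' measurableSet_Ioi fun x hx => ?_
  rw [← mul_assoc, ← ENNReal.ofReal_mul hC]
  gcongr
  exact hle x (le_of_lt hx)

theorem potential_Iic (hH : IsSubordinator f H P) {q : ℝ → ℝ} (hq : Measurable q) {t : ℝ}
    (ht : 0 ≤ t) : potential P H q (Iic t) = ∫⁻ ω, (∫⁻ s in Ioi (0 : ℝ),
      {s : ℝ | H s.toNNReal ω ≤ t.toNNReal}.indicator (fun s => ENNReal.ofReal (q s)) s) ∂P := by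
  have hm := hH.measurable_uncurry
  rw [hH.potential_apply hq measurableSet_Iic]
  have hF : Measurable fun x : Ω × ℝ => {x : Ω × ℝ | H x.2.toNNReal x.1 ≤ t.toNNReal}.indicator
      (fun x => ENNReal.ofReal (q x.2)) x := by
    refine Measurable.indicator (by fun_prop) ?_
    exact (hm.comp measurable_swap) measurableSet_Iic
  refine Eq.trans ?_ (lintegral_lintegral_swap (f := fun (ω : Ω) (s : ℝ) =>
    {s : ℝ | H s.toNNReal ω ≤ t.toNNReal}.indicator (fun s => ENNReal.ofReal (q s)) s)
    hF.aemeasurable).symm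
  refine lintegral_congr fun s => ?_
  rw [← lintegral_const_mul' _ _ ENNReal.ofReal_ne_top]
  refine lintegral_congr fun ω => ?_
  by_cases h : H s.toNNReal ω ≤ t.toNNReal
  · have h1 : H s.toNNReal ω < ∞ := h.trans_lt ENNReal.coe_lt_top
    have h2 : (H s.toNNReal ω).toReal ≤ t := by
      have := ENNReal.toReal_mono ENNReal.coe_ne_top h
      rwa [ENNReal.coe_toReal, Real.coe_toNNReal _ ht] at this
    rw [indicator_of_mem (show s ∈ {s : ℝ | H s.toNNReal ω ≤ t.toNNReal} from h),
      indicator_of_mem (show ω ∈ {ω | H s.toNNReal ω < ∞} from h1),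
      indicator_of_mem (mem_Iic.2 h2)]
    simp
  · rw [indicator_of_notMem (show s ∉ {s : ℝ | H s.toNNReal ω ≤ t.toNNReal} from h)]
    by_cases h1 : H s.toNNReal ω < ∞
    · rw [indicator_of_mem (show ω ∈ {ω | H s.toNNReal ω < ∞} from h1), indicator_of_notMem,
        mul_zero]
      intro h2
      refine h ?_
      rw [← ENNReal.ofReal_toReal h1.ne]
      exact ENNReal.ofReal_le_ofReal h2
    -- Killed paths must be excluded explicitly: `toReal` sends `∞` to `0`, which lies in `Iic t`.
    · rw [indicator_of_notMem (show ω ∉ {ω | H s.toNNReal ω < ∞} from h1), mul_zero]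

/-- On the event that `H` stays below `t`, `e^{-H(n)} ≥ e^{-t}`, while `E e^{-H(n)} = e^{-n f(1)} →
0`. So `Y(t)` is almost surely a genuine infimum and not the default value `0`. -/
theorem ae_exists_lt (hH : IsSubordinator f H P) (hf : 0 < f 1) (t : ℝ≥0) :
    ∀ᵐ ω ∂P, ∃ s, (t : ℝ≥0∞) < H s ω := by
  set A : Set Ω := {ω | ∀ n : ℕ, H n ω ≤ t}
  have hb : ∀ n : ℕ, P A * ENNReal.ofReal (Real.exp (-t)) ≤
      ENNReal.ofReal (Real.exp (-f 1) ^ n) := by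
    intro n
    have h1 := hH.lintegral_exp one_pos n
    rw [NNReal.coe_natCast, ← mul_neg, Real.exp_nat_mul] at h1
    have hA : MeasurableSet A := by
      have : A = ⋂ n : ℕ, {ω | H n ω ≤ t} := by ext; simp [A]
      rw [this]
      exact MeasurableSet.iInter fun n => hH.measurable _ measurableSet_Iic
    rw [← h1, mul_comm, ← setLIntegral_const, ← lintegral_indicator hA]
    refine lintegral_mono fun ω => ?_
    by_cases hω : ω ∈ A
    · have h2 : H n ω < ∞ := (hω n).trans_lt ENNReal.coe_lt_top
      rw [indicator_of_mem hω, indicator_of_mem (show ω ∈ {ω | H n ω < ∞} from h2)]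
      refine ENNReal.ofReal_le_ofReal (Real.exp_le_exp.2 ?_)
      have := ENNReal.toReal_mono ENNReal.coe_ne_top (hω n)
      rw [ENNReal.coe_toReal] at this
      linarith
    · rw [indicator_of_notMem hω]
      exact zero_le
  have hlim : Tendsto (fun n : ℕ => ENNReal.ofReal (Real.exp (-f 1) ^ n)) atTop (𝓝 0) := by
    rw [← ENNReal.ofReal_zero]
    refine ENNReal.tendsto_ofReal (tendsto_pow_atTop_nhds_zero_of_lt_one (Real.exp_pos _).le ?_)
    exact Real.exp_lt_one_iff.2 (by linarith)
  have hz := le_antisymm (ge_of_tendsto' hlim hb) zero_le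
  have hPA : P A = 0 := (mul_eq_zero.1 hz).resolve_right (by simp [Real.exp_pos])
  rw [measure_eq_zero_iff_ae_notMem] at hPA
  filter_upwards [hPA] with ω hω
  simp only [A, mem_ofPred_eq, not_forall, not_le] at hω
  exact ⟨_, hω.choose_spec⟩

/-- `E ∫_0^{Y(t)} q(s) ds = ∫_0^∞ q(s) P(H(s) ≤ t) ds`. -/
theorem integral_intervalIntegral_inverse (hH : IsSubordinator f H P) (hf : 0 < f 1) {μ : ℝ}
    (hμ : 0 < μ) {q : ℝ → ℝ} (hq : ExpDecay μ q) {t : ℝ} (ht : 0 ≤ t) :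
    Integrable (fun ω => ∫ s in (0 : ℝ)..(inverseProcess H t.toNNReal ω : ℝ), q s) P ∧
      ∫ ω, (∫ s in (0 : ℝ)..(inverseProcess H t.toNNReal ω : ℝ), q s) ∂P =
        (potential P H q).real (Iic t) := by
  have hcont := hq.continuous
  have hmono := hH.mono
  have hY := measurable_inverseProcess hH.measurable hmono t.toNNReal
  have hnn : ∀ ω, 0 ≤ ∫ s in (0 : ℝ)..(inverseProcess H t.toNNReal ω : ℝ), q s := fun ω =>
    intervalIntegral.integral_nonneg (by simp) fun s hs => hq.nonneg s hs.1
  have hQ : Continuous fun y : ℝ => ∫ s in (0 : ℝ)..y, q s :=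
    intervalIntegral.continuous_primitive (fun a b => hcont.intervalIntegrable a b) 0
  have hmeas : Measurable fun ω => ∫ s in (0 : ℝ)..(inverseProcess H t.toNNReal ω : ℝ), q s :=
    hQ.measurable.comp hY.coe_nnreal_real
  have hpath : ∀ᵐ ω ∂P, ∫⁻ s in Ioi (0 : ℝ),
      {s : ℝ | H s.toNNReal ω ≤ t.toNNReal}.indicator (fun s => ENNReal.ofReal (q s)) s =
      ENNReal.ofReal (∫ s in (0 : ℝ)..(inverseProcess H t.toNNReal ω : ℝ), q s) := by
    filter_upwards [hH.ae_exists_lt hf t.toNNReal] with ω hω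
    set y : ℝ≥0 := inverseProcess H t.toNNReal ω
    have hne : {s : ℝ≥0 | (t.toNNReal : ℝ≥0∞) < H s ω}.Nonempty := hω
    rw [intervalIntegral.integral_of_le (NNReal.coe_nonneg y), ofReal_integral_eq_lintegral_ofReal
      (hcont.integrableOn_Ioc) (by
        filter_upwards [ae_restrict_mem measurableSet_Ioc] with s hs
        exact hq.nonneg s hs.1.le), ← lintegral_indicator measurableSet_Ioc,
      ← lintegral_indicator measurableSet_Ioi]
    -- For `s < Y(t)` one has `H(s) ≤ t`, and for `s > Y(t)` one has `H(s) > t`; only the single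
    -- time `s = Y(t)` is undecided.
    have hney : ∀ᵐ s : ℝ, s ≠ y := by
      rw [ae_iff]; simp
    refine lintegral_congr_ae ?_
    filter_upwards [hney] with s hs
    by_cases h0 : s ∈ Ioi (0 : ℝ)
    · have h0' : (0 : ℝ) < s := h0
      rw [indicator_of_mem h0]
      rcases lt_or_gt_of_ne hs with h | h
      · have h1 : s.toNNReal < y := by
          rwa [← NNReal.coe_lt_coe, Real.coe_toNNReal _ h0'.le]
        have h2 : H s.toNNReal ω ≤ t.toNNReal := not_lt.1 fun h3 =>
          notMem_of_lt_csInf h1 (OrderBot.bddBelow _) h3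
        rw [indicator_of_mem (show s ∈ {s : ℝ | H s.toNNReal ω ≤ t.toNNReal} from h2),
          indicator_of_mem (show s ∈ Ioc 0 (y : ℝ) from ⟨h0', h.le⟩)]
      · have h1 : y < s.toNNReal := by
          rwa [← NNReal.coe_lt_coe, Real.coe_toNNReal _ h0'.le]
        obtain ⟨s', hs', hlt⟩ := exists_lt_of_csInf_lt hne h1
        have h2 : ¬ H s.toNNReal ω ≤ t.toNNReal :=
          not_le.2 (lt_of_lt_of_le hs' (hmono ω hlt.le))
        rw [indicator_of_notMem (show s ∉ {s : ℝ | H s.toNNReal ω ≤ t.toNNReal} from h2),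
          indicator_of_notMem fun h' => h'.2.not_gt h]
    · rw [indicator_of_notMem h0, indicator_of_notMem fun h' => h0 h'.1]
  have hfinU := hH.isFiniteMeasure_potential hμ hq
  have hkey : ∫⁻ ω, ENNReal.ofReal (∫ s in (0 : ℝ)..(inverseProcess H t.toNNReal ω : ℝ), q s) ∂P =
      potential P H q (Iic t) := by
    rw [hH.potential_Iic hcont.measurable ht]
    exact (lintegral_congr_ae hpath).symm
  refine ⟨⟨hmeas.aestronglyMeasurable, ?_⟩, ?_⟩
  · rw [hasFiniteIntegral_iff_ofReal (ae_of_all _ hnn), hkey]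
    exact measure_lt_top _ _
  · rw [integral_eq_lintegral_of_nonneg_ae (ae_of_all _ hnn) hmeas.aestronglyMeasurable, hkey,
      measureReal_def]

end IsSubordinator

end Potential

/-! ### Distribution functions of potentials and their Laplace transforms. -/

theorem monotone_real_Iic (U : Measure ℝ) [IsFiniteMeasure U] :
    Monotone fun t => U.real (Iic t) := fun _ _ h => measureReal_mono (Iic_subset_Iic.2 h)

theorem continuous_real_Iic {U : Measure ℝ} [IsFiniteMeasure U] (hU : U ≪ volume) :
    Continuous fun t => U.real (Iic t) := by
  have h0 : ∀ t, U {t} = 0 := fun t => hU (by simp)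
  rw [continuous_iff_continuousAt]
  intro t
  have hnn : NullMeasurableSet (Iic t) U := measurableSet_Iic.nullMeasurableSet
  have key : Tendsto (fun s => ∫ y, (Iic s).indicator (1 : ℝ → ℝ) y ∂U) (𝓝 t)
      (𝓝 (∫ y, (Iic t).indicator (1 : ℝ → ℝ) y ∂U)) := by
    refine tendsto_integral_filter_of_dominated_convergence (fun _ => 1)
      (Eventually.of_forall fun s => (measurable_one.indicator
        measurableSet_Iic).aestronglyMeasurable) (Eventually.of_forall fun s => ae_of_all _
          fun y => ?_) (integrable_const _) ?_
    · by_cases h : y ∈ Iic s <;> simp [h]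
    · have hne : ∀ᵐ y ∂U, y ≠ t := by
        rw [ae_iff]; simpa using h0 t
      filter_upwards [hne] with y hy
      refine tendsto_const_nhds.congr' ?_
      rcases lt_or_gt_of_ne hy with h | h
      · filter_upwards [Ioi_mem_nhds h] with s hs
        rw [indicator_of_mem (mem_Iic.2 h.le), indicator_of_mem (mem_Iic.2 (le_of_lt hs))]
      · filter_upwards [Iio_mem_nhds h] with s hs
        rw [indicator_of_notMem (by simpa using h), indicator_of_notMem (by simpa using hs)]
  simpa only [ContinuousAt, integral_indicator_one measurableSet_Iic] using key

/-- Tonelli: for fixed `y`, the integral of `e^{-rt}` over `t > y` is `e^{-ry} / r`. -/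
theorem lintegral_exp_mul_Iic {U : Measure ℝ} [IsFiniteMeasure U] (hU : ∀ᵐ y ∂U, 0 ≤ y) {r : ℝ}
    (hr : 0 < r) : ∫⁻ t in Ioi (0 : ℝ), ENNReal.ofReal (Real.exp (-(r * t))) * U (Iic t) =
      ENNReal.ofReal (1 / r) * laplaceT U r := by
  have hF : Measurable fun x : ℝ × ℝ => {x : ℝ × ℝ | x.2 ≤ x.1}.indicator
      (fun x => ENNReal.ofReal (Real.exp (-(r * x.1)))) x :=
    Measurable.indicator (by fun_prop) (measurableSet_le measurable_snd measurable_fst)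
  have h1 : ∀ t, ENNReal.ofReal (Real.exp (-(r * t))) * U (Iic t) =
      ∫⁻ y, {x : ℝ × ℝ | x.2 ≤ x.1}.indicator
        (fun x => ENNReal.ofReal (Real.exp (-(r * x.1)))) (t, y) ∂U := by
    intro t
    rw [← setLIntegral_const, ← lintegral_indicator measurableSet_Iic]
    rfl
  simp_rw [h1]
  rw [lintegral_lintegral_swap hF.aemeasurable, laplaceT, ← lintegral_const_mul _ (by fun_prop)]
  refine lintegral_congr_ae ?_
  filter_upwards [hU] with y hy
  rw [← ENNReal.ofReal_mul (by positivity), ← lintegral_indicator measurableSet_Ioi]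
  have h := integral_exp_mul_Ioi (neg_lt_zero.2 hr) y
  have hi := integrableOn_exp_mul_Ioi (neg_lt_zero.2 hr) y
  have h2 : ∫⁻ t in Ioi y, ENNReal.ofReal (Real.exp (-r * t)) =
      ENNReal.ofReal (1 / r * Real.exp (-(r * y))) := by
    rw [← ofReal_integral_eq_lintegral_ofReal hi (ae_of_all _ fun t => (Real.exp_pos _).le), h]
    congr 1
    rw [neg_mul]
    field_simp
  rw [← h2, ← lintegral_indicator measurableSet_Ioi]
  have hne : ∀ᵐ t : ℝ, t ≠ y := by rw [ae_iff]; simp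
  refine lintegral_congr_ae ?_
  filter_upwards [hne] with t ht
  by_cases h3 : y < t
  · rw [indicator_of_mem (mem_Ioi.2 (hy.trans_lt h3)), indicator_of_mem (mem_Ioi.2 h3),
      indicator_of_mem (show (t, y) ∈ {x : ℝ × ℝ | x.2 ≤ x.1} from h3.le), neg_mul]
  · rw [indicator_of_notMem (s := Ioi y) (by simpa using h3)]
    refine indicator_apply_eq_zero.2 fun _ => indicator_of_notMem ?_ _
    exact fun h4 : y ≤ t => h3 (lt_of_le_of_ne h4 ht.symm)

theorem integral_exp_mul_real_Iic {U : Measure ℝ} [IsFiniteMeasure U] (hU : ∀ᵐ y ∂U, 0 ≤ y) {r : ℝ}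
    (hr : 0 < r) : IntegrableOn (fun t => Real.exp (-(r * t)) * U.real (Iic t)) (Ioi 0) ∧
      ∫ t in Ioi (0 : ℝ), Real.exp (-(r * t)) * U.real (Iic t) = 1 / r * (laplaceT U r).toReal := by
  have hm : Measurable fun t => Real.exp (-(r * t)) * U.real (Iic t) :=
    Measurable.mul (by fun_prop) (monotone_real_Iic U).measurable
  have h0 : ∀ t, 0 ≤ Real.exp (-(r * t)) * U.real (Iic t) := fun t =>
    mul_nonneg (Real.exp_pos _).le measureReal_nonneg
  have h1 : ∀ t, ENNReal.ofReal (Real.exp (-(r * t)) * U.real (Iic t)) =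
      ENNReal.ofReal (Real.exp (-(r * t))) * U (Iic t) := fun t => by
    rw [ENNReal.ofReal_mul (Real.exp_pos _).le, ofReal_measureReal]
  have h2 := lintegral_exp_mul_Iic hU hr
  refine ⟨⟨hm.aestronglyMeasurable, ?_⟩, ?_⟩
  · rw [hasFiniteIntegral_iff_ofReal (ae_of_all _ h0)]
    simp_rw [h1]
    rw [h2]
    exact ENNReal.mul_lt_top ENNReal.ofReal_lt_top (laplaceT_ne_top hU hr).lt_top
  · rw [integral_eq_lintegral_of_nonneg_ae (ae_of_all _ h0) hm.aestronglyMeasurable]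
    simp_rw [h1]
    rw [h2, ENNReal.toReal_mul, ENNReal.toReal_ofReal (by positivity)]

/-! ### Expectations of functions of the inverse subordinator. -/

section InverseMean

variable {Ω : Type*} [MeasurableSpace Ω] {P : Measure Ω} {H : ℝ≥0 → Ω → ℝ≥0∞} {f : ℝ → ℝ}

/-- `E Φ(Y(t))`. -/
noncomputable def inverseMean (P : Measure Ω) (H : ℝ≥0 → Ω → ℝ≥0∞) (Φ : ℝ → ℝ) (t : ℝ) : ℝ :=
  ∫ ω, Φ (inverseProcess H t.toNNReal ω) ∂P

theorem inverseMean_toNNReal (Φ : ℝ → ℝ) (t : ℝ) :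
    inverseMean P H Φ t.toNNReal = inverseMean P H Φ t := by
  rw [inverseMean, Real.toNNReal_coe]; rfl

theorem inverseMean_nonneg {Φ : ℝ → ℝ} (hΦ : ∀ s, 0 ≤ s → 0 ≤ Φ s) (t : ℝ) :
    0 ≤ inverseMean P H Φ t := integral_nonneg fun _ => hΦ _ (NNReal.coe_nonneg _)

variable [IsProbabilityMeasure P]

theorem inverseMean_le {Φ : ℝ → ℝ} (hΦ : ∀ s, 0 ≤ s → 0 ≤ Φ s) {C : ℝ}
    (hC : ∀ s, 0 ≤ s → Φ s ≤ C) (t : ℝ) : inverseMean P H Φ t ≤ C := by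
  have h : ∫ _ω : Ω, C ∂P = C := by simp
  rw [← h]
  exact integral_mono_of_nonneg (ae_of_all _ fun ω => hΦ _ (NNReal.coe_nonneg _))
    (integrable_const _) (ae_of_all _ fun ω => hC _ (NNReal.coe_nonneg _))

theorem ExpDecay.exists_le {μ : ℝ} (hμ : 0 < μ) {q : ℝ → ℝ} (hq : ExpDecay μ q) :
    ∃ C, ∀ s, 0 ≤ s → q s ≤ C := by
  obtain ⟨C, hC, h⟩ := hq.bound
  exact ⟨C, fun s hs => (h s hs).trans (mul_le_of_le_one_right hC
    (Real.exp_le_one_iff.2 (neg_nonpos.2 (by positivity))))⟩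

theorem expDecay_exp (μ : ℝ) : ExpDecay μ fun s => Real.exp (-(μ * s)) where
  continuous := by fun_prop
  nonneg := fun s _ => (Real.exp_pos _).le
  bound := ⟨1, zero_le_one, fun s _ => by rw [one_mul]⟩

section Linear

variable {ι : Type*} {S : Finset ι} {κ : ι → ℝ} {q : ι → ℝ → ℝ} {Φ : ℝ → ℝ} {μ : ℝ}

/-- Integration of `(Φ(s) e^{-cs})'` over `(0, ∞)`; the boundary term at infinity vanishes by
exponential decay. -/
theorem ExpDecay.integral_deriv_eq (hμ : 0 < μ) (hq : ∀ i ∈ S, ExpDecay μ (q i))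
    (hΦ : ExpDecay μ Φ) (hder : ∀ s, HasDerivAt Φ (∑ i ∈ S, κ i * q i s) s) {c : ℝ} (hc : 0 ≤ c) :
    Φ 0 + ∑ i ∈ S, κ i * ∫ s in Ioi (0 : ℝ), q i s * Real.exp (-(s * c)) =
      c * ∫ s in Ioi (0 : ℝ), Φ s * Real.exp (-(s * c)) := by
  have hd : ∀ s ∈ Ici (0 : ℝ), HasDerivAt (fun s => Φ s * Real.exp (-(s * c)))
      (∑ i ∈ S, κ i * (q i s * Real.exp (-(s * c))) - c * (Φ s * Real.exp (-(s * c)))) s := by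
    intro s _
    have h1 : HasDerivAt (fun s : ℝ => Real.exp (-(s * c))) (Real.exp (-(s * c)) * (-(1 * c))) s :=
      ((hasDerivAt_id s).mul_const c).neg.exp
    refine ((hder s).mul h1).congr_deriv ?_
    rw [Finset.sum_mul]
    simp only [mul_assoc]
    ring
  have hi1 : IntegrableOn (fun s => ∑ i ∈ S, κ i * (q i s * Real.exp (-(s * c)))) (Ioi 0) :=
    integrable_finsetSum _ fun i hi => ((hq i hi).integrableOn hμ hc).const_mul _
  have hi2 : IntegrableOn (fun s => c * (Φ s * Real.exp (-(s * c)))) (Ioi 0) :=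
    (hΦ.integrableOn hμ hc).const_mul _
  have hlim : Tendsto (fun s => Φ s * Real.exp (-(s * c))) atTop (𝓝 0) := by
    obtain ⟨C, hC, hb⟩ := hΦ.bound
    have h1 : Tendsto (fun s : ℝ => C * Real.exp (-(μ * s))) atTop (𝓝 0) := by
      have h2 : Tendsto (fun s : ℝ => Real.exp (-(μ * s))) atTop (𝓝 0) :=
        Real.tendsto_exp_neg_atTop_nhds_zero.comp (tendsto_id.const_mul_atTop hμ)
      simpa using h2.const_mul C
    refine squeeze_zero' ?_ ?_ h1
    · filter_upwards [eventually_ge_atTop 0] with s hs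
      exact mul_nonneg (hΦ.nonneg s hs) (Real.exp_pos _).le
    · filter_upwards [eventually_ge_atTop 0] with s hs
      exact (mul_le_of_le_one_right (hΦ.nonneg s hs)
        (Real.exp_le_one_iff.2 (neg_nonpos.2 (by positivity)))).trans (hb s hs)
  have h := integral_Ioi_of_hasDerivAt_of_tendsto' hd (hi1.sub hi2) hlim
  rw [integral_sub hi1 hi2, integral_finsetSum _ fun i hi =>
    ((hq i hi).integrableOn hμ hc).const_mul _] at h
  simp only [integral_const_mul, zero_mul, neg_zero, Real.exp_zero, mul_one, zero_sub] at h
  linarith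

namespace IsSubordinator

/-- Write `Φ(Y) = Φ(0) + ∫_0^Y Φ'` and take expectations. The sum over `S` with signed `κ` lets a
derivative of varying sign be expressed through potentials of nonnegative weights. -/
theorem inverseMean_eq (hH : IsSubordinator f H P) (hf : 0 < f 1) (hμ : 0 < μ)
    (hq : ∀ i ∈ S, ExpDecay μ (q i)) (hder : ∀ s, HasDerivAt Φ (∑ i ∈ S, κ i * q i s) s) {t : ℝ}
    (ht : 0 ≤ t) :
    inverseMean P H Φ t = Φ 0 + ∑ i ∈ S, κ i * (potential P H (q i)).real (Iic t) := by
  have h1 : ∀ y : ℝ, Φ y = Φ 0 + ∑ i ∈ S, κ i * ∫ s in (0 : ℝ)..y, q i s := by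
    intro y
    have hii : ∀ i ∈ S, IntervalIntegrable (fun s => κ i * q i s) volume 0 y := fun i hi =>
      ((hq i hi).continuous.const_mul _).intervalIntegrable _ _
    have := intervalIntegral.integral_eq_sub_of_hasDerivAt (a := 0) (b := y)
      (fun s _ => hder s) (by
        refine Continuous.intervalIntegrable ?_ _ _
        exact continuous_finsetSum _ fun i hi => (hq i hi).continuous.const_mul _)
    rw [intervalIntegral.integral_finsetSum hii] at this
    simp only [intervalIntegral.integral_const_mul] at this
    linarith
  have h2 := fun i (hi : i ∈ S) => hH.integral_intervalIntegral_inverse hf hμ (hq i hi) ht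
  rw [inverseMean]
  simp_rw [h1 (inverseProcess H t.toNNReal _ : ℝ)]
  rw [integral_add (integrable_const _) (integrable_finsetSum _ fun i hi =>
    (h2 i hi).1.const_mul _), integral_finsetSum _ fun i hi => (h2 i hi).1.const_mul _]
  congr 1
  · simp
  · exact Finset.sum_congr rfl fun i hi => by rw [integral_const_mul, (h2 i hi).2]

theorem inverseMean_eq' (hH : IsSubordinator f H P) (hf : 0 < f 1) (hμ : 0 < μ)
    (hq : ∀ i ∈ S, ExpDecay μ (q i)) (hder : ∀ s, HasDerivAt Φ (∑ i ∈ S, κ i * q i s) s) :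
    inverseMean P H Φ =
      fun t => Φ 0 + ∑ i ∈ S, κ i * (potential P H (q i)).real (Iic (t.toNNReal : ℝ)) := by
  funext t
  rw [← inverseMean_toNNReal, hH.inverseMean_eq hf hμ hq hder (NNReal.coe_nonneg _)]

theorem measurable_inverseMean (hH : IsSubordinator f H P) (hf : 0 < f 1) (hμ : 0 < μ)
    (hq : ∀ i ∈ S, ExpDecay μ (q i)) (hder : ∀ s, HasDerivAt Φ (∑ i ∈ S, κ i * q i s) s) :
    Measurable (inverseMean P H Φ) := by
  rw [hH.inverseMean_eq' hf hμ hq hder]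
  refine measurable_const.add (Finset.measurable_fun_sum _ fun i hi => ?_)
  have := hH.isFiniteMeasure_potential hμ (hq i hi)
  exact ((monotone_real_Iic (potential P H (q i))).measurable.comp
    measurable_real_toNNReal.coe_nnreal_real).const_mul _

theorem continuous_inverseMean (hH : IsSubordinator f H P) (hf : 0 < f 1) (hμ : 0 < μ)
    (hq : ∀ i ∈ S, ExpDecay μ (q i)) (hder : ∀ s, HasDerivAt Φ (∑ i ∈ S, κ i * q i s) s)
    (hac : ∀ i ∈ S, potential P H (q i) ≪ volume) : Continuous (inverseMean P H Φ) := by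
  rw [hH.inverseMean_eq' hf hμ hq hder]
  refine continuous_const.add (continuous_finsetSum _ fun i hi => ?_)
  have := hH.isFiniteMeasure_potential hμ (hq i hi)
  exact ((continuous_real_Iic (hac i hi)).comp
    (NNReal.continuous_coe.comp continuous_real_toNNReal)).const_mul _

/-- `f(r) ∫_0^∞ Φ(s) e^{-s f(r)} ds = r ∫_0^∞ e^{-rt} E Φ(Y(t)) dt`. -/
theorem laplaceT_potential_eq_inverseMean (hH : IsSubordinator f H P) (hf1 : 0 < f 1) (hμ : 0 < μ)
    (hq : ∀ i ∈ S, ExpDecay μ (q i)) (hΦ : ExpDecay μ Φ)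
    (hder : ∀ s, HasDerivAt Φ (∑ i ∈ S, κ i * q i s) s) {r : ℝ} (hr : 0 < r) (hf : 0 ≤ f r) :
    ENNReal.ofReal (f r) * laplaceT (potential P H Φ) r =
      ENNReal.ofReal r *
        ∫⁻ t, ENNReal.ofReal (Real.exp (-(r * t))) * posPart (inverseMean P H Φ) t := by
  have hfin := fun i (hi : i ∈ S) => hH.isFiniteMeasure_potential hμ (hq i hi)
  have hI := fun i (hi : i ∈ S) =>
    have := hfin i hi
    integral_exp_mul_real_Iic (hH.ae_nonneg_potential (q i)) hr
  have hexp : IntegrableOn (fun t : ℝ => Real.exp (-(r * t))) (Ioi 0) := by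
    simpa using integrableOn_exp_mul_Ioi (neg_lt_zero.2 hr) 0
  have hexpv : ∫ t in Ioi (0 : ℝ), Real.exp (-(r * t)) = 1 / r := by
    have := integral_exp_mul_Ioi (neg_lt_zero.2 hr) 0
    simpa [neg_div_neg_eq] using this
  have hev : ∀ t ∈ Ioi (0 : ℝ), Real.exp (-(r * t)) * inverseMean P H Φ t =
      Real.exp (-(r * t)) * Φ 0 +
        ∑ i ∈ S, κ i * (Real.exp (-(r * t)) * (potential P H (q i)).real (Iic t)) := by
    intro t ht
    rw [hH.inverseMean_eq hf1 hμ hq hder (le_of_lt ht), mul_add, Finset.mul_sum]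
    congr 1
    exact Finset.sum_congr rfl fun i _ => by ring
  have hi1 : IntegrableOn (fun t : ℝ => Real.exp (-(r * t)) * Φ 0) (Ioi 0) := hexp.mul_const _
  have hi2 : IntegrableOn (fun t : ℝ => ∑ i ∈ S, κ i * (Real.exp (-(r * t)) *
      (potential P H (q i)).real (Iic t))) (Ioi 0) :=
    integrable_finsetSum _ fun i hi => (hI i hi).1.const_mul _
  have hint : IntegrableOn (fun t => Real.exp (-(r * t)) * inverseMean P H Φ t) (Ioi 0) :=
    (hi1.add hi2).congr_fun (fun t ht => (hev t ht).symm) measurableSet_Ioi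
  -- Both sides equal `Φ(0) + ∑ κ_i ∫ q_i(s) e^{-s f(r)} ds`: the left through the distribution
  -- functions of the potentials, the right by parts in `s`.
  have hval : r * ∫ t in Ioi (0 : ℝ), Real.exp (-(r * t)) * inverseMean P H Φ t =
      f r * ∫ s in Ioi (0 : ℝ), Φ s * Real.exp (-(s * f r)) := by
    rw [setIntegral_congr_fun measurableSet_Ioi hev, integral_add hi1 hi2,
      integral_finsetSum _ fun i hi => (hI i hi).1.const_mul _, integral_mul_const, hexpv,
      ← ExpDecay.integral_deriv_eq hμ hq hΦ hder hf, mul_add, Finset.mul_sum]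
    congr 1
    · field_simp
    · refine Finset.sum_congr rfl fun i hi => ?_
      rw [integral_const_mul, (hI i hi).2, hH.laplaceT_potential_eq hμ (hq i hi) hr hf,
        ENNReal.toReal_ofReal]
      · rw [mul_left_comm, ← mul_assoc r, mul_one_div_cancel hr.ne', one_mul]
      · exact setIntegral_nonneg measurableSet_Ioi fun s hs =>
          mul_nonneg ((hq i hi).nonneg s (le_of_lt hs)) (Real.exp_pos _).le
  have hpos : ∫⁻ t, ENNReal.ofReal (Real.exp (-(r * t))) * posPart (inverseMean P H Φ) t =
      ENNReal.ofReal (∫ t in Ioi (0 : ℝ), Real.exp (-(r * t)) * inverseMean P H Φ t) := by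
    rw [ofReal_integral_eq_lintegral_ofReal hint (ae_of_all _ fun t =>
      mul_nonneg (Real.exp_pos _).le (inverseMean_nonneg hΦ.nonneg t)),
      ← lintegral_indicator measurableSet_Ioi]
    refine lintegral_congr fun t => ?_
    by_cases h : 0 < t
    · rw [posPart_of_pos _ h, indicator_of_mem (mem_Ioi.2 h),
        ENNReal.ofReal_mul (Real.exp_pos _).le]
    · rw [posPart_of_nonpos _ (not_lt.1 h), mul_zero, indicator_of_notMem (by simpa using h)]
  rw [hpos, hH.laplaceT_potential_eq hμ hΦ hr hf, ← ENNReal.ofReal_mul hf,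
    ← ENNReal.ofReal_mul hr.le, hval]

end IsSubordinator

end Linear

namespace IsSubordinator

variable {D : BernsteinData} {μ : ℝ}

theorem hasDerivAt_exp_neg_mul (μ s : ℝ) : HasDerivAt (fun s : ℝ => Real.exp (-(μ * s)))
    (∑ _i ∈ ({()} : Finset Unit), (-μ) * Real.exp (-(μ * s))) s := by
  have h : HasDerivAt (fun s : ℝ => Real.exp (-(μ * s))) (Real.exp (-(μ * s)) * (-(μ * 1))) s :=
    ((hasDerivAt_id s).const_mul μ).neg.exp
  refine h.congr_deriv ?_
  rw [Finset.sum_singleton]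
  ring

theorem resolvent_laplace_relation (hD : D.ConditionI) (hH : IsSubordinator D.fn H P) (hμ : 0 < μ)
    {r : ℝ} (hr : 0 < r) :
    ENNReal.ofReal (D.fn r) * laplaceT (potential P H fun s => Real.exp (-(μ * s))) r =
      ENNReal.ofReal r * ∫⁻ t, ENNReal.ofReal (Real.exp (-(r * t))) *
        posPart (inverseMean P H fun s => Real.exp (-(μ * s))) t :=
  hH.laplaceT_potential_eq_inverseMean (hD.fn_pos one_pos) hμ (fun _ _ => expDecay_exp μ)
    (expDecay_exp μ) (hasDerivAt_exp_neg_mul μ) hr (BernsteinData.fn_nonneg hr)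

theorem laplaceT_resolvent (hH : IsSubordinator D.fn H P) (hμ : 0 < μ) {r : ℝ} (hr : 0 < r) :
    laplaceT (potential P H fun s => Real.exp (-(μ * s))) r =
      ENNReal.ofReal (1 / (μ + D.fn r)) := by
  have hf := BernsteinData.fn_nonneg (D := D) hr
  rw [hH.laplaceT_potential_eq hμ (expDecay_exp μ) hr hf]
  congr 1
  have := integral_exp_mul_Ioi (neg_lt_zero.2 (add_pos_of_pos_of_nonneg hμ hf)) 0
  simp only [mul_zero, Real.exp_zero, neg_div_neg_eq] at this
  rw [← this]
  refine setIntegral_congr_fun measurableSet_Ioi fun s _ => ?_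
  simp only [← Real.exp_add]
  ring_nf

theorem inverseMean_exp_le_one (hμ : 0 < μ) (t : ℝ) :
    inverseMean P H (fun s => Real.exp (-(μ * s))) t ≤ 1 :=
  inverseMean_le (fun _ _ => (Real.exp_pos _).le)
    (fun s hs => Real.exp_le_one_iff.2 (neg_nonpos.2 (by positivity))) t

/-- Proved for the resolvent weight `e^{-μs}`, then inherited by every weight dominated by a
multiple of it. -/
theorem potential_absolutelyContinuous (hD : D.ConditionI) (hH : IsSubordinator D.fn H P)
    (hμ : 0 < μ) {q : ℝ → ℝ} (hq : ExpDecay μ q) : potential P H q ≪ volume := by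
  have hfin := hH.isFiniteMeasure_potential hμ (expDecay_exp μ)
  have hmeas : Measurable (posPart (inverseMean P H fun s => Real.exp (-(μ * s)))) :=
    (hH.measurable_inverseMean (hD.fn_pos one_pos) hμ (fun _ _ => expDecay_exp μ)
      (hasDerivAt_exp_neg_mul μ)).ennreal_ofReal.indicator measurableSet_Ioi
  have hac : potential P H (fun s => Real.exp (-(μ * s))) ≪ volume := by
    rcases D.b_nonneg.eq_or_lt with hb | hb
    · exact BernsteinData.resolvent_absolutelyContinuous hD hb.symm (hH.ae_nonneg_potential _) hμ
        (fun r hr => hH.laplaceT_resolvent hμ hr) hmeas (inverseMean_exp_le_one hμ)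
        fun r hr => hH.resolvent_laplace_relation hD hμ hr
    · exact (Measure.absolutelyContinuous_of_le_smul (BernsteinData.le_smul_volume_of_pos hb
        (hH.ae_nonneg_potential _) hmeas (inverseMean_exp_le_one hμ)
        fun r hr => hH.resolvent_laplace_relation hD hμ hr))
  obtain ⟨C, hC, hle⟩ := hq.bound
  exact (Measure.absolutelyContinuous_of_le_smul (hH.potential_le hq.continuous.measurable
    (by fun_prop) hC hle)).trans hac

/-- With drift the identity is built directly. Without drift the exact identity for `C e^{-μs}`,
which dominates `Φ`, is transferred to `Φ` by `convM_eq_of_le`. -/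
theorem hasPotentialDensity (hD : D.ConditionI) (hH : IsSubordinator D.fn H P) (hμ : 0 < μ)
    {ι : Type*} {S : Finset ι} {κ : ι → ℝ} {q : ι → ℝ → ℝ} {Φ : ℝ → ℝ}
    (hq : ∀ i ∈ S, ExpDecay μ (q i)) (hΦ : ExpDecay μ Φ)
    (hder : ∀ s, HasDerivAt Φ (∑ i ∈ S, κ i * q i s) s) :
    D.HasPotentialDensity (potential P H Φ) (inverseMean P H Φ) := by
  have hf1 : 0 < D.fn 1 := hD.fn_pos one_pos
  have hfin := hH.isFiniteMeasure_potential hμ hΦ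
  have hLT : ∀ r, 0 < r → ENNReal.ofReal (D.fn r) * laplaceT (potential P H Φ) r =
      ENNReal.ofReal r *
        ∫⁻ t, ENNReal.ofReal (Real.exp (-(r * t))) * posPart (inverseMean P H Φ) t := fun r hr =>
    hH.laplaceT_potential_eq_inverseMean hf1 hμ hq hΦ hder hr (BernsteinData.fn_nonneg hr)
  have hcont : Continuous (inverseMean P H Φ) := hH.continuous_inverseMean hf1 hμ hq hder
    fun i hi => hH.potential_absolutelyContinuous hD hμ (hq i hi)
  rcases D.b_nonneg.eq_or_lt with hb | hb
  · obtain ⟨C, hC, hle⟩ := hΦ.bound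
    have hfinE := hH.isFiniteMeasure_potential hμ (expDecay_exp μ)
    have hcontE : Continuous (inverseMean P H fun s => Real.exp (-(μ * s))) :=
      hH.continuous_inverseMean hf1 hμ (fun _ _ => expDecay_exp μ) (hasDerivAt_exp_neg_mul μ)
        fun _ _ => hH.potential_absolutelyContinuous hD hμ (expDecay_exp μ)
    have hE : ∀ t, 0 < t → convM D.etail (ENNReal.ofReal C • potential P H
        fun s => Real.exp (-(μ * s))) t =
        ENNReal.ofReal (C * inverseMean P H (fun s => Real.exp (-(μ * s))) t) := by
      intro t ht
      rw [ENNReal.ofReal_mul hC, ← BernsteinData.resolvent_convM_eq hD hb.symm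
        (hH.ae_nonneg_potential _) hμ (fun r hr => hH.laplaceT_resolvent hμ hr)
        hcontE.continuousOn (inverseMean_exp_le_one hμ)
        (fun r hr => hH.resolvent_laplace_relation hD hμ hr) ht]
      exact lintegral_smul_measure _ _
    have hfinC : IsFiniteMeasure (ENNReal.ofReal C • potential P H
        fun s => Real.exp (-(μ * s))) := Measure.smul_finite _ ENNReal.ofReal_ne_top
    refine BernsteinData.hasPotentialDensity_of_zero hb.symm
      (hH.potential_absolutelyContinuous hD hμ hΦ) (hH.ae_nonneg_potential _) fun t ht => ?_
    exact BernsteinData.convM_eq_of_le hD (hH.potential_le hΦ.continuous.measurable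
      (by fun_prop) hC hle) hcont.continuousOn (hcontE.const_mul C).continuousOn
      (BernsteinData.convM_ae_eq hb.symm (hH.ae_nonneg_potential _)
        (measurable_posPart hcont.continuousOn) hLT) hE ht
  · obtain ⟨C, hle⟩ := hΦ.exists_le hμ
    exact BernsteinData.hasPotentialDensity_of_pos hD hb (hH.ae_nonneg_potential _)
      hcont.continuousOn (inverseMean_nonneg hΦ.nonneg) (inverseMean_le hΦ.nonneg hle) hLT

/-- The generalized Caputo–Djrbashian derivative of `t ↦ E Φ(Y(t))` when `Φ' = ∑ κ_i q_i`. -/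
theorem hasCaputoDeriv_inverseMean (hD : D.ConditionI) (hH : IsSubordinator D.fn H P) (hμ : 0 < μ)
    {ι : Type*} {S : Finset ι} {κ : ι → ℝ} {q : ι → ℝ → ℝ} {Φ : ℝ → ℝ}
    (hq : ∀ i ∈ S, ExpDecay μ (q i)) (hder : ∀ s, HasDerivAt Φ (∑ i ∈ S, κ i * q i s) s)
    (hq' : ∀ i ∈ S, D.HasPotentialDensity (potential P H (q i)) (inverseMean P H (q i))) {t : ℝ}
    (ht : 0 < t) :
    HasCaputoDeriv D (inverseMean P H Φ) (∑ i ∈ S, κ i * inverseMean P H (q i) t) t :=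
  BernsteinData.hasCaputoDeriv_of_sum S κ (fun i hi => hH.isFiniteMeasure_potential hμ (hq i hi))
    hq' (fun i hi t _ => inverseMean_nonneg (hq i hi).nonneg t)
    (fun _ ht => hH.inverseMean_eq (hD.fn_pos one_pos) hμ hq hder ht) ht

end IsSubordinator

end InverseMean

/-! ### The time-changed counting process -/

section Independence

variable {Ω : Type*} [MeasurableSpace Ω] {P : Measure Ω} {M N : ℝ≥0 → Ω → ℕ}
  {G : ℝ≥0 → Ω → ℝ≥0} {H : ℝ≥0 → Ω → ℝ≥0∞}

/-- `M, N, G, H` split into the independent pieces that are used. -/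
theorem indep_of_iIndep (hMm : ∀ t, Measurable (M t)) (hNm : ∀ t, Measurable (N t))
    (hGm : ∀ t, Measurable (G t)) (hHm : ∀ t, Measurable (H t))
    (hindep : iIndep ![processSigma M, processSigma N, processSigma G, processSigma H] P) :
    Indep (processSigma N) (processSigma G) P ∧
    Indep (processSigma H) (processSigma N ⊔ processSigma G) P ∧
    Indep (processSigma N ⊔ processSigma G ⊔ processSigma H) (processSigma M) P := by
  have hle : ∀ i, (![processSigma M, processSigma N, processSigma G, processSigma H] :
      Fin 4 → MeasurableSpace Ω) i ≤ ‹MeasurableSpace Ω› := by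
    intro i
    fin_cases i
    exacts [processSigma_le hMm, processSigma_le hNm, processSigma_le hGm, processSigma_le hHm]
  refine ⟨hindep.indep (i := 1) (j := 2) (by decide), ?_, ?_⟩
  · have := indep_iSup_of_disjoint hle hindep (S := {3}) (T := {1, 2}) (by
      rw [Set.disjoint_left]; simp)
    rw [iSup_singleton, iSup_pair] at this
    exact this
  · have := indep_iSup_of_disjoint hle hindep (S := {1, 2, 3}) (T := {0}) (by
      rw [Set.disjoint_left]; simp)
    rw [iSup_singleton, iSup_insert, iSup_pair, ← sup_assoc] at this
    exact this

end Independence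

section StateProb

variable {k : ℕ} {rate : Fin k → ℝ} {lam α β : ℝ} {Ω : Type*} [MeasurableSpace Ω] {P : Measure Ω}
  [IsProbabilityMeasure P] {M N : ℝ≥0 → Ω → ℕ} {G : ℝ≥0 → Ω → ℝ≥0} {H : ℝ≥0 → Ω → ℝ≥0∞}

theorem gammaRatio_lt_one (hα : 0 < α) (hβ : 0 < β) {x : ℝ} (hx : 0 < x) :
    (β / (β + x)) ^ α < 1 :=
  Real.rpow_lt_one (by positivity) ((div_lt_one (by positivity)).2 (by linarith)) hα

theorem exists_abs_gammaProb_le (hrate : ∀ j, 0 < rate j) (hΛ : 0 < totalRate rate) (hα : 0 < α)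
    (hβ : 0 < β) (hG : IsGammaProcess α β G P) (n : ℕ) :
    ∃ C, ∀ l, |gammaProb rate P G n l| ≤ C := by
  obtain ⟨C, hC, h⟩ := exists_gammaProb_le rate hrate hΛ hα hβ hG n
  refine ⟨C, fun l => ?_⟩
  rw [abs_of_nonneg (gammaProb_nonneg rate P G hrate n l)]
  exact (h l).trans (mul_le_of_le_one_right hC (pow_le_one₀ (by positivity)
    (gammaRatio_lt_one hα hβ (half_pos hΛ)).le))

/-- The rate is `ψ_GN(Λ/2)`, the same for every `n`, so all weights can be compared with a single
resolvent. -/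
theorem expDecay_poissonMix_gammaProb (hlam : 0 < lam) (hrate : ∀ j, 0 < rate j)
    (hΛ : 0 < totalRate rate) (hα : 0 < α) (hβ : 0 < β) (hG : IsGammaProcess α β G P) (n : ℕ) :
    ExpDecay (lam * (1 - (β / (β + totalRate rate / 2)) ^ α))
      (poissonMix lam (gammaProb rate P G n)) where
  continuous := by
    obtain ⟨C, hC⟩ := exists_abs_gammaProb_le hrate hΛ hα hβ hG n
    exact continuous_iff_continuousAt.2 fun s => (hasDerivAt_poissonMix lam hC s).continuousAt
  nonneg := fun s hs => poissonMix_nonneg hlam (gammaProb_nonneg rate P G hrate n) hs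
  bound := by
    obtain ⟨C, hC, h⟩ := exists_gammaProb_le rate hrate hΛ hα hβ hG n
    exact ⟨C, hC, fun s hs => poissonMix_le hlam (gammaProb_nonneg rate P G hrate n)
      (by positivity) (gammaRatio_lt_one hα hβ (half_pos hΛ)).le h hs⟩

/-- The Poisson derivative shifts the number of Gamma jumps by one, and by `gammaProb_succ` this
shift is a convolution in `n`. The subtracted term, present only at `m = 0`, is the loss rate. -/
theorem hasDerivAt_poissonMix_gammaProb (hrate : ∀ j, 0 < rate j) (hΛ : 0 < totalRate rate)
    (hα : 0 < α) (hβ : 0 < β) (hM : IsGCP rate M P) (hG : IsGammaProcess α β G P) (n : ℕ) (s : ℝ) :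
    HasDerivAt (poissonMix lam (gammaProb rate P G n))
      (∑ m ∈ Finset.range (n + 1), (lam * gammaCoef rate α β m - if m = 0 then lam else 0) *
        poissonMix lam (gammaProb rate P G (n - m)) s) s := by
  choose C hC using fun n => exists_abs_gammaProb_le hrate hΛ hα hβ hG n
  refine (hasDerivAt_poissonMix lam (hC n) s).congr_deriv ?_
  have h1 : ∀ l, gammaProb rate P G n (l + 1) = ∑ m ∈ Finset.range (n + 1),
      gammaCoef rate α β m * gammaProb rate P G (n - m) l := by
    intro l
    rw [gammaProb_succ rate hrate hΛ hM hG,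
      ← Finset.Nat.sum_antidiagonal_swap, Finset.Nat.sum_antidiagonal_eq_sum_range_succ_mk]
    exact Finset.sum_congr rfl fun m _ => mul_comm _ _
  have h2 : poissonMix lam (fun l => gammaProb rate P G n (l + 1)) s =
      ∑ m ∈ Finset.range (n + 1), gammaCoef rate α β m *
        poissonMix lam (gammaProb rate P G (n - m)) s := by
    simp only [poissonMix, h1, Finset.mul_sum]
    rw [Summable.tsum_finsetSum fun m _ => ?_, Finset.mul_sum]
    · refine Finset.sum_congr rfl fun m _ => ?_
      rw [mul_left_comm, ← tsum_mul_left (a := gammaCoef rate α β m)]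
      exact congrArg _ (tsum_congr fun l => by ring)
    · have := (summable_pow_div_factorial_mul (hC (n - m)) (lam * s)).mul_left
        (gammaCoef rate α β m)
      exact this.congr fun l => by ring
  rw [h2]
  simp only [sub_mul, Finset.sum_sub_distrib, ite_mul, zero_mul, Finset.sum_ite_eq',
    Finset.mem_range, Nat.succ_pos, if_true, Nat.sub_zero, mul_sub, Finset.mul_sum, mul_assoc]

/-- Given `Y(t) = s`, the Laplace transform of `G_N(s)` is `e^{-s ψ_GN(L)}`. -/
theorem laplaceOf_psiGN (hlam : 0 < lam) (hα : 0 < α) (hβ : 0 < β) (hN : IsPoissonProcess lam N P)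
    (hG : IsGammaProcess α β G P) (hHm : ∀ t, Measurable (H t))
    (hHmono : ∀ ω, Monotone fun t => H t ω)
    (hNG : Indep (processSigma N) (processSigma G) P)
    (hHNG : Indep (processSigma H) (processSigma N ⊔ processSigma G) P) (t : ℝ≥0) {L : ℝ}
    (hL : 0 ≤ L) : laplaceOf (inverseProcess H) P t (psiGN lam α β L) =
      ∫ ω, Real.exp (-(L * compoundProcess G N (inverseProcess H t ω) ω)) ∂P := by
  have hXm := measurable_compound_inverse hN.measurable hN.mono hN.right_cont hG.measurable hG.mono
    hG.right_cont hHm hHmono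
  rw [integral_compound_inverse hlam hN hG hHm hHmono hNG hHNG hXm
    (u := fun x : ℝ≥0 => Real.exp (-(L * x))) (by fun_prop) (fun x => (Real.exp_pos _).le) (C := 1)
    (fun x => Real.exp_le_one_iff.2 (neg_nonpos.2 (by positivity))) t]
  simp_rw [hG.integral_exp_neg hα hβ hL]
  refine integral_congr_ae (ae_of_all _ fun ω => ?_)
  have := poissonMix_pow lam ((β / (β + L)) ^ α) 1 (inverseProcess H t ω)
  simp only [one_mul] at this
  exact (by rw [psiGN_eq hβ hL] : _ = _).trans this.symm

theorem eventuallyEq_laplaceOf_psiGN (hlam : 0 < lam) (hα : 0 < α) (hβ : 0 < β)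
    (hN : IsPoissonProcess lam N P) (hG : IsGammaProcess α β G P) (hHm : ∀ t, Measurable (H t))
    (hHmono : ∀ ω, Monotone fun t => H t ω)
    (hNG : Indep (processSigma N) (processSigma G) P)
    (hHNG : Indep (processSigma H) (processSigma N ⊔ processSigma G) P) (t : ℝ≥0) {L : ℝ}
    (hL : 0 < L) : (fun L => laplaceOf (inverseProcess H) P t (psiGN lam α β L)) =ᶠ[𝓝 L]
      fun L => ∫ ω, Real.exp (-(L * compoundProcess G N (inverseProcess H t ω) ω)) ∂P := by
  filter_upwards [Ioi_mem_nhds hL] with L hL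
  exact laplaceOf_psiGN hlam hα hβ hN hG hHm hHmono hNG hHNG t (le_of_lt hL)

theorem stateProb_eq_inverseMean (hrate : ∀ j, 0 < rate j) (hΛ : 0 < totalRate rate)
    (hlam : 0 < lam) (hM : IsGCP rate M P) (hN : IsPoissonProcess lam N P)
    (hG : IsGammaProcess α β G P) (hHm : ∀ t, Measurable (H t))
    (hHmono : ∀ ω, Monotone fun t => H t ω)
    (hNG : Indep (processSigma N) (processSigma G) P)
    (hHNG : Indep (processSigma H) (processSigma N ⊔ processSigma G) P)
    (hind : Indep (processSigma N ⊔ processSigma G ⊔ processSigma H) (processSigma M) P) (n : ℕ) :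
    stateProb (timeChanged M G N H) P n =
      inverseMean P H (poissonMix lam (gammaProb rate P G n)) := by
  funext t
  obtain ⟨C, hC, hle⟩ := exists_gcpProb_le rate hrate hΛ n
  have hXm := measurable_compound_inverse hN.measurable hN.mono hN.right_cont hG.measurable hG.mono
    hG.right_cont hHm hHmono
  rw [stateProb_timeChanged hM hN hG hHm hHmono hrate hind,
    integral_compound_inverse hlam hN hG hHm hHmono hNG hHNG hXm
      (u := fun x : ℝ≥0 => gcpProb rate n x)
      ((continuous_gcpProb rate n).measurable.comp measurable_coe_nnreal_real)
      (fun x => gcpProb_nonneg rate hrate n x.2) (C := C)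
      (fun x => (hle x x.2).trans (mul_le_of_le_one_right hC
        (Real.exp_le_one_iff.2 (neg_nonpos.2 (by positivity)))))]
  rfl

theorem hasCaputoDeriv_stateProb {D : BernsteinData} (hD : D.ConditionI)
    (hrate : ∀ j, 0 < rate j) (hΛ : 0 < totalRate rate) (hlam : 0 < lam) (hα : 0 < α) (hβ : 0 < β)
    (hM : IsGCP rate M P) (hN : IsPoissonProcess lam N P) (hG : IsGammaProcess α β G P)
    (hH : IsSubordinator D.fn H P) (hNG : Indep (processSigma N) (processSigma G) P)
    (hHNG : Indep (processSigma H) (processSigma N ⊔ processSigma G) P)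
    (hind : Indep (processSigma N ⊔ processSigma G ⊔ processSigma H) (processSigma M) P) (n : ℕ)
    {t : ℝ} (ht : 0 < t) :
    HasCaputoDeriv D (stateProb (timeChanged M G N H) P n)
      (∑ m ∈ Finset.range (n + 1), (lam * gammaCoef rate α β m - if m = 0 then lam else 0) *
        stateProb (timeChanged M G N H) P (n - m) t) t := by
  have hμ : 0 < lam * (1 - (β / (β + totalRate rate / 2)) ^ α) :=
    mul_pos hlam (sub_pos.2 (gammaRatio_lt_one hα hβ (half_pos hΛ)))
  have hq := expDecay_poissonMix_gammaProb hlam hrate hΛ hα hβ hG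
  have hder := hasDerivAt_poissonMix_gammaProb (lam := lam) hrate hΛ hα hβ hM hG
  simp only [stateProb_eq_inverseMean hrate hΛ hlam hM hN hG hH.measurable hH.mono hNG hHNG hind]
  -- The mixtures with indices at most `n` are closed under differentiation, so each weight
  -- `Φ_{n-m}` in `Φ_n'` has a derivative of the same form; this supplies its potential density.
  exact hH.hasCaputoDeriv_inverseMean hD hμ (fun m _ => hq (n - m)) (hder n)
    (fun m _ => hH.hasPotentialDensity hD hμ (fun i _ => hq (n - m - i)) (hq (n - m))
      (hder (n - m))) ht

/-- The term `m = 0` is isolated: only the zero vector contributes there, and `Γ(α)` cancels. -/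
theorem sum_gammaCoef_mul (hα : 0 < α) (hβ : 0 < β) (hΛ : 0 < totalRate rate) (n : ℕ) (p : ℕ → ℝ) :
    ∑ m ∈ Finset.range (n + 1), (lam * gammaCoef rate α β m - if m = 0 then lam else 0) *
        p (n - m) =
      (lam * β ^ α / (totalRate rate + β) ^ α - lam) * p n +
        lam * β ^ α / ((totalRate rate + β) ^ α * Real.Gamma α) *
          ∑ m ∈ Finset.Icc 1 n, ∑ x ∈ partitions k m,
            Real.Gamma (((∑ j, x j : ℕ) : ℝ) + α) / (totalRate rate + β) ^ (∑ j, x j) *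
              (∏ j, rate j ^ x j / (x j)!) * p (n - m) := by
  have hG := Real.Gamma_pos_of_pos hα
  have h0 : partitions k 0 = {0} := by
    ext x
    simp [mem_partitions, funext_iff]
  have hc0 : gammaCoef rate α β 0 = β ^ α / (totalRate rate + β) ^ α := by
    rw [gammaCoef_eq rate α β hα hβ hΛ, h0, Finset.sum_singleton]
    simp
    field_simp
  have hIcc : Finset.Ico 1 (n + 1) = Finset.Icc 1 n := by ext; simp
  rw [Finset.range_eq_Ico, Finset.sum_eq_sum_Ico_succ_bot n.succ_pos, if_pos rfl, hc0, hIcc,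
    Nat.sub_zero, mul_div_assoc, Finset.mul_sum]
  congr 1
  refine Finset.sum_congr rfl fun m hm => ?_
  rw [if_neg (by have := (Finset.mem_Icc.1 hm).1; omega), sub_zero,
    gammaCoef_eq rate α β hα hβ hΛ, ← Finset.sum_mul]
  ring

end StateProb

theorem psiGN_one {lam β u : ℝ} (hβ : 0 < β) (hu : 0 ≤ u) : psiGN lam 1 β u = psiE lam β u := by
  rw [psiGN_eq hβ hu, psiE, Real.rpow_one]
  have : 0 < β + u := by positivity
  field_simp
  ring

end GenCounting

open scoped ContDiff in
theorem mainTheorem5 {Ω : Type*} [MeasurableSpace Ω] (P : Measure Ω) [IsProbabilityMeasure P]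
    (D : GenCounting.BernsteinData) (hD : D.ConditionI)
    {k : ℕ} (hk : 1 ≤ k) (rate : Fin k → ℝ) (hrate : ∀ j, 0 < rate j)
    (lam α β : ℝ) (hlam : 0 < lam) (hα : 0 < α) (hβ : 0 < β)
    (M N : ℝ≥0 → Ω → ℕ) (G : ℝ≥0 → Ω → ℝ≥0) (H : ℝ≥0 → Ω → ℝ≥0∞)
    (hM : GenCounting.IsGCP rate M P)
    (hN : GenCounting.IsPoissonProcess lam N P)
    (hG : GenCounting.IsGammaProcess α β G P)
    (hH : GenCounting.IsSubordinator D.fn H P)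
    (hindep : iIndep ![GenCounting.processSigma M, GenCounting.processSigma N,
      GenCounting.processSigma G, GenCounting.processSigma H] P) :
    -- the general compound Poisson–Gamma case
    ((∀ t : ℝ, 0 ≤ t →
        ContDiffAt ℝ ∞ (fun L => GenCounting.laplaceOf (GenCounting.inverseProcess H) P
          t.toNNReal (GenCounting.psiGN lam α β L)) (GenCounting.totalRate rate)) ∧
      (∀ (n : ℕ) (t : ℝ), 0 ≤ t →
        GenCounting.stateProb (GenCounting.timeChanged M G N H) P n t =
          GenCounting.probFormula rate n fun L =>
            GenCounting.laplaceOf (GenCounting.inverseProcess H) P t.toNNReal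
              (GenCounting.psiGN lam α β L)) ∧
      (∀ (n : ℕ) (t : ℝ), 0 < t →
        GenCounting.HasCaputoDeriv D
          (GenCounting.stateProb (GenCounting.timeChanged M G N H) P n)
          ((lam * β ^ α / (GenCounting.totalRate rate + β) ^ α - lam) *
              GenCounting.stateProb (GenCounting.timeChanged M G N H) P n t +
            lam * β ^ α / ((GenCounting.totalRate rate + β) ^ α * Real.Gamma α) *
              ∑ m ∈ Finset.Icc 1 n, ∑ x ∈ GenCounting.partitions k m,
                Real.Gamma (((∑ j, x j : ℕ) : ℝ) + α) /
                    (GenCounting.totalRate rate + β) ^ (∑ j, x j) *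
                  (∏ j, rate j ^ x j / (x j)!) *
                  GenCounting.stateProb (GenCounting.timeChanged M G N H) P (n - m) t)
          t)) ∧
    -- the compound Poisson–exponential case
    (α = 1 →
      (∀ t : ℝ, 0 ≤ t →
        ContDiffAt ℝ ∞ (fun L => GenCounting.laplaceOf (GenCounting.inverseProcess H) P
          t.toNNReal (GenCounting.psiE lam β L)) (GenCounting.totalRate rate)) ∧
      (∀ (n : ℕ) (t : ℝ), 0 ≤ t →
        GenCounting.stateProb (GenCounting.timeChanged M G N H) P n t =
          GenCounting.probFormula rate n fun L =>
            GenCounting.laplaceOf (GenCounting.inverseProcess H) P t.toNNReal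
              (GenCounting.psiE lam β L)) ∧
      (∀ (n : ℕ) (t : ℝ), 0 < t →
        GenCounting.HasCaputoDeriv D
          (GenCounting.stateProb (GenCounting.timeChanged M G N H) P n)
          (-(lam * (GenCounting.totalRate rate / (GenCounting.totalRate rate + β))) *
              GenCounting.stateProb (GenCounting.timeChanged M G N H) P n t +
            lam * β / (GenCounting.totalRate rate + β) *
              ∑ m ∈ Finset.Icc 1 n, ∑ x ∈ GenCounting.partitions k m,
                Real.Gamma (((∑ j, x j : ℕ) : ℝ) + 1) /
                    (GenCounting.totalRate rate + β) ^ (∑ j, x j) *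
                  (∏ j, rate j ^ x j / (x j)!) *
                  GenCounting.stateProb (GenCounting.timeChanged M G N H) P (n - m) t)
          t)) := by
  have hne : Nonempty (Fin k) := ⟨⟨0, hk⟩⟩
  have hΛ : 0 < GenCounting.totalRate rate := Finset.sum_pos (fun j _ => hrate j)
    Finset.univ_nonempty
  have hHm := hH.measurable
  obtain ⟨hNG, hHNG, hind⟩ := GenCounting.indep_of_iIndep hM.measurable hN.measurable hG.measurable
    hHm hindep
  have hXm := GenCounting.measurable_compound_inverse hN.measurable hN.mono hN.right_cont
    hG.measurable hG.mono hG.right_cont hHm hH.mono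
  have hev := fun t : ℝ => GenCounting.eventuallyEq_laplaceOf_psiGN hlam hα hβ hN hG hHm hH.mono
    hNG hHNG t.toNNReal hΛ
  have hC : ∀ t : ℝ, 0 ≤ t →
      ContDiffAt ℝ ∞ (fun L => GenCounting.laplaceOf (GenCounting.inverseProcess H) P
        t.toNNReal (GenCounting.psiGN lam α β L)) (GenCounting.totalRate rate) := fun t _ =>
    GenCounting.contDiffAt_of_eventuallyEq_laplace (hXm _).coe_nnreal_real
      (fun _ => NNReal.coe_nonneg _) hΛ (hev t)
  have hS : ∀ (n : ℕ) (t : ℝ), 0 ≤ t →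
      GenCounting.stateProb (GenCounting.timeChanged M G N H) P n t =
        GenCounting.probFormula rate n fun L =>
          GenCounting.laplaceOf (GenCounting.inverseProcess H) P t.toNNReal
            (GenCounting.psiGN lam α β L) := fun n t _ => by
    rw [GenCounting.stateProb_timeChanged hM hN hG hHm hH.mono hrate hind]
    exact GenCounting.integral_gcpProb_eq_probFormula rate hΛ (hXm _).coe_nnreal_real
      (fun _ => NNReal.coe_nonneg _) (hev t) n
  have hCap := fun (n : ℕ) (t : ℝ) (ht : 0 < t) =>
    (GenCounting.sum_gammaCoef_mul (lam := lam) hα hβ hΛ n fun m =>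
      GenCounting.stateProb (GenCounting.timeChanged M G N H) P m t) ▸
    GenCounting.hasCaputoDeriv_stateProb hD hrate hΛ hlam hα hβ hM hN hG hH hNG hHNG hind n ht
  refine ⟨⟨hC, hS, hCap⟩, ?_⟩
  rintro rfl
  -- The two exponents are compared only for `L > 0`. Equality near `Λ` suffices, since smoothness
  -- and the iterated derivatives depend only on the germ.
  have hE : ∀ t : ℝ, (fun L => GenCounting.laplaceOf (GenCounting.inverseProcess H) P t.toNNReal
      (GenCounting.psiE lam β L)) =ᶠ[𝓝 (GenCounting.totalRate rate)]
      fun L => GenCounting.laplaceOf (GenCounting.inverseProcess H) P t.toNNReal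
        (GenCounting.psiGN lam 1 β L) := fun t => by
    filter_upwards [Ioi_mem_nhds hΛ] with L hL
    rw [GenCounting.psiGN_one hβ (le_of_lt hL)]
  refine ⟨fun t ht => (hC t ht).congr_of_eventuallyEq (hE t), fun n t _ => ?_, fun n t ht => ?_⟩
  · rw [GenCounting.stateProb_timeChanged hM hN hG hHm hH.mono hrate hind]
    exact GenCounting.integral_gcpProb_eq_probFormula rate hΛ (hXm _).coe_nnreal_real
      (fun _ => NNReal.coe_nonneg _) ((hE t).trans (hev t)) n
  · have h := hCap n t ht
    have h1 : lam * β / (GenCounting.totalRate rate + β) - lam =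
        -(lam * (GenCounting.totalRate rate / (GenCounting.totalRate rate + β))) := by
      field_simp
      ring
    simpa only [Real.rpow_one, Real.Gamma_one, mul_one, h1] using h
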